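/- For a finite group $G$ let $c(G)$ be the number of cyclic subgroups of $G$ and let $\alpha(G)=c(G)/|G|$. Write $C_n$ for the cyclic group of order $n$ and $D_8$ for the dihedral group of order $8$. Let $X$ be a finite group with $\alpha(X)>3/4$. Then there are an integer $m\ge 0$ and a group $G$ such that $X\cong C_2^m\times G$, $\alpha(X)=\alpha(G)$, $G$ does not have $C_2$ as a direct factor, and either $G$ is trivial (in which case $\alpha(X)=1$) or one of the following occurs. 1. $G\cong A\rtimes\langle\varepsilon\rangle$, where $\langle\varepsilon\rangle\cong C_2$ acts on $A$ by inversion, and there is an integer $n\ge 1$ such that either $A=C_3^n$ and $\alpha(G)=\frac{3\cdot 3^n+1}{4\cdot 3^n}$, or $A=C_4^n$ and $\alpha(G)=\frac{3\cdot 2^n+1}{4\cdot 2^n}$. 2. $G\cong D_8\times D_8$ and $\alpha(G)=25/32$. 3. There is an integer $r\ge 1$ such that $G\cong D_8^r/N$, where $N=\{(a_1,\ldots,a_r)\in Z(D_8)^r : a_1\cdots a_r=1\}$, and $\alpha(G)=\frac{3\cdot 2^r+1}{4\cdot 2^r}$. 4. There is an integer $r\ge 1$ such that $G\cong V\rtimes\langle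 c\rangle$, where $V=\mathbb{F}_2^{2r}$ (written multiplicatively) has a basis $x_1,y_1,\ldots,x_r,y_r$, $c$ has order $2$, $c\,y_i\,c=y_i$ and $c\,x_i\,c=x_iy_i$ for $i=1,\ldots,r$, and $\alpha(G)=\frac{3\cdot 2^r+1}{4\cdot 2^r}$. -/

import Mathlib

universe u

noncomputable section

namespace CyclicRatio

open scoped IsMulCommutative

/-- `c(G)`: the number of cyclic subgroups of `G`. -/
def numCyclic (G : Type*) [Group G] : ℕ :=
  Nat.card {H : Subgroup G // IsCyclic H}

/-- `α(G) = c(G) / |G|`. -/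
def alpha (G : Type*) [Group G] : ℚ :=
  (numCyclic G : ℚ) / (Nat.card G : ℚ)

/-- The cyclic group `C_n`, written multiplicatively. -/
abbrev C (n : ℕ) : Type := Multiplicative (ZMod n)

/-- The direct power `(C_n)^k`. -/
abbrev CPow (n k : ℕ) : Type := Fin k → C n

/-- `G` has a direct factor isomorphic to `C_2`. -/
def HasC2Factor (G : Type*) [Group G] : Prop :=
  ∃ H K : Subgroup G, H.Normal ∧ K.Normal ∧ IsCompl H K ∧ Nonempty (H ≃* C 2)

/-- The homomorphism from `C_2` sending the generator to `g`, where `g * g = 1`. -/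
def involutionHom {M : Type*} [Group M] (g : M) (hg : g * g = 1) : C 2 →* M where
  toFun t := if t = 1 then 1 else g
  map_one' := by simp
  map_mul' s t := by
    have h : ∀ x : C 2, x = 1 ∨ x = Multiplicative.ofAdd 1 := by decide
    have h1 : (Multiplicative.ofAdd (1 : ZMod 2)) ≠ 1 := by decide
    have h2 : Multiplicative.ofAdd (1 : ZMod 2) * Multiplicative.ofAdd 1 = 1 := by decide
    rcases h s with rfl | rfl <;> rcases h t with rfl | rfl <;> simp only [h1, h2, hg, if_true,
      if_false, one_mul, mul_one]

/-- `A ⋊ ⟨ε⟩`, where `⟨ε⟩ = C_2` acts on the abelian group `A` by inversion. -/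
abbrev InvSemidirect (A : Type*) [CommGroup A] : Type _ :=
  A ⋊[involutionHom (MulEquiv.inv A : MulAut A) (by ext; simp)] C 2

/-- The dihedral group of order `8`. -/
abbrev D8 : Type := DihedralGroup 4

/-- `N = {(a_1, …, a_r) ∈ Z(D_8)^r : a_1 ⋯ a_r = 1}` as a subgroup of `(D_8)^r`. The product is
formed in the commutative group `Z(D_8)`. -/
def centralN (r : ℕ) : Subgroup (Fin r → D8) where
  carrier := {a | ∃ z : Fin r → Subgroup.center D8, (∀ i, (z i : D8) = a i) ∧ ∏ i, z i = 1}
  one_mem' := ⟨1, by simp, by simp⟩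
  mul_mem' := by
    rintro a b ⟨z, hz, hz1⟩ ⟨w, hw, hw1⟩
    exact ⟨z * w, fun i => by simp [hz, hw], by simp [Finset.prod_mul_distrib, hz1, hw1]⟩
  inv_mem' := by
    rintro a ⟨z, hz, hz1⟩
    exact ⟨z⁻¹, fun i => by simp [hz], by simp [hz1]⟩

instance centralN_normal (r : ℕ) : (centralN r).Normal where
  conj_mem := by
    rintro a ⟨z, hz, hz1⟩ g
    refine ⟨z, fun i => ?_, hz1⟩
    have h := Subgroup.mem_center_iff.1 (z i).2 (g i)
    simp only [Pi.mul_apply, Pi.inv_apply, ← hz i]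
    rw [h, mul_inv_cancel_right]

/-- The central product of `r` copies of `D_8`, i.e. `(D_8)^r / N`. -/
abbrev CentralProductD8 (r : ℕ) : Type := (Fin r → D8) ⧸ centralN r

/-- `V = (𝔽_2)^{2r}`, written multiplicatively. The pair `(a, b)` stands for the vector
`∑ a_i x_i + ∑ b_i y_i` in the basis `x_1, y_1, …, x_r, y_r`. -/
abbrev V (r : ℕ) : Type := Multiplicative ((Fin r → ZMod 2) × (Fin r → ZMod 2))

/-- The basis vector `x_i`. -/
def V.x {r : ℕ} (i : Fin r) : V r := Multiplicative.ofAdd (Pi.single i 1, 0)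

/-- The basis vector `y_i`. -/
def V.y {r : ℕ} (i : Fin r) : V r := Multiplicative.ofAdd (0, Pi.single i 1)

/-- The automorphism `(a, b) ↦ (a, a + b)` of `V`. -/
def shear (r : ℕ) : MulAut (V r) :=
  AddEquiv.toMultiplicative
    { toFun := fun v => (v.1, v.1 + v.2)
      invFun := fun v => (v.1, v.1 + v.2)
      left_inv := fun v => by ext i <;> simp [← add_assoc, CharTwo.add_self_eq_zero]
      right_inv := fun v => by ext i <;> simp [← add_assoc, CharTwo.add_self_eq_zero]
      map_add' := fun v w => by
        ext i
        · simp
        · simp [add_add_add_comm] }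

theorem shear_x {r : ℕ} (i : Fin r) : shear r (V.x i) = V.x i * V.y i := by
  apply Multiplicative.toAdd.injective
  ext j <;> simp [shear, V.x, V.y]

theorem shear_y {r : ℕ} (i : Fin r) : shear r (V.y i) = V.y i := by
  apply Multiplicative.toAdd.injective
  ext j <;> simp [shear, V.y]

theorem shear_mul_self (r : ℕ) : shear r * shear r = 1 := by
  refine MulEquiv.ext fun v => Multiplicative.toAdd.injective (Prod.ext rfl ?_)
  ext j
  simp [shear, ← add_assoc, CharTwo.add_self_eq_zero]

/-- `V ⋊ ⟨c⟩`, where `c` has order `2`, `c x_i c = x_i y_i` and `c y_i c = y_i` for all `i`. -/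
abbrev ShearSemidirect (r : ℕ) : Type :=
  V r ⋊[involutionHom (shear r) (shear_mul_self r)] C 2

end CyclicRatio

end

namespace CyclicRatio

/-!
A cyclic subgroup of order `k` has `φ(k)` generators, so `c(X)` is the sum of `1 / φ(o(g))` over all
`g`, and `α(X) > 3/4` forces more than half of the elements of `X` to satisfy `g * g = 1`.

Take `t` with `t * t = 1` and a subgroup `A` inverted by `t` of the largest possible order. Counting
in each coset of `A` the elements inverted by `t` shows that every coset contains one, that `A` is
normal and that `X / A` is elementary abelian. An element outside `A` acts on `A` either as a
transvection, with centralizer of index `2`, or exceptionally, with centralizer of index `4`. An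
exceptional element forces `X / A` to have order `4` and `X` to be generated, modulo its center, by
two commuting dihedral pairs. If there are only transvections and `X / A` has order at least `4`,
then the product of two of them is a third one, so they share an axis or a center. Replacing `A` by
`C_A(x)⟨x⟩` excludes a common axis; a common center makes `X` a central product of copies of `D_8`
and an elementary abelian group. In the remaining case `A` is abelian of index at most `2`; it is
either elementary abelian or inverted by an involution outside it, and then a finer count forces `A`
to have exponent dividing `4` or `6`.
-/

/-! ### Counting cyclic subgroups by their generators -/

section Alpha

variable {G : Type*} [Group G]

/-- The number of solutions of `g * g = 1` in `G`, the identity included. -/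
noncomputable def numInvol (G : Type*) [Group G] : ℕ := Nat.card {g : G // g * g = 1}

theorem numInvol_eq_card_filter (G : Type*) [Group G] [Fintype G] [DecidableEq G] :
    numInvol G = (Finset.univ.filter fun g : G => g * g = 1).card := by
  rw [numInvol, Nat.card_eq_fintype_card, Fintype.card_subtype]

theorem orderOf_eq_of_zpowers_eq {g h : G} (e : Subgroup.zpowers g = Subgroup.zpowers h) :
    orderOf g = orderOf h := by
  rw [← Nat.card_zpowers, ← Nat.card_zpowers, e]

theorem card_generators_zpowers [Fintype G] (g₀ : G)
    [DecidablePred fun g : G => Subgroup.zpowers g = Subgroup.zpowers g₀] :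
    (Finset.univ.filter fun g : G => Subgroup.zpowers g = Subgroup.zpowers g₀).card =
      (orderOf g₀).totient := by
  classical
  have hd : orderOf g₀ ∣ Fintype.card (Subgroup.zpowers g₀) := by rw [Fintype.card_zpowers]
  rw [← IsCyclic.card_orderOf_eq_totient hd]
  symm
  refine Finset.card_bij (fun a _ => (a : G)) (fun a ha => ?_) (fun a _ b _ => Subtype.ext)
    fun b hb => ?_
  · simp only [Finset.mem_filter, Finset.mem_univ, true_and] at ha ⊢
    refine Subgroup.eq_of_le_of_card_ge (Subgroup.zpowers_le.2 a.2) ?_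
    rw [Nat.card_zpowers, Nat.card_zpowers, Subgroup.orderOf_coe, ha]
  · simp only [Finset.mem_filter, Finset.mem_univ, true_and] at hb
    refine ⟨⟨b, hb ▸ Subgroup.mem_zpowers b⟩, ?_, rfl⟩
    simp only [Finset.mem_filter, Finset.mem_univ, true_and]
    rw [Subgroup.orderOf_mk, orderOf_eq_of_zpowers_eq hb]

theorem numCyclic_eq_sum (G : Type*) [Group G] [Fintype G] :
    (numCyclic G : ℚ) = ∑ g : G, ((orderOf g).totient : ℚ)⁻¹ := by
  classical
  have hmap : ∀ g ∈ (Finset.univ : Finset G), Subgroup.zpowers g ∈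
      Finset.univ.filter (fun H : Subgroup G => IsCyclic H) := by
    intro g _
    simp only [Finset.mem_filter, Finset.mem_univ, true_and]
    infer_instance
  rw [← Finset.sum_fiberwise_of_maps_to hmap, numCyclic, Nat.card_eq_fintype_card,
    Fintype.card_subtype, Finset.card_eq_sum_ones, Nat.cast_sum]
  refine Finset.sum_congr rfl fun H hH => ?_
  simp only [Finset.mem_filter, Finset.mem_univ, true_and] at hH
  obtain ⟨g₀, rfl⟩ := (Subgroup.isCyclic_iff_exists_zpowers_eq_top H).1 hH
  have hord : ∀ g ∈ Finset.univ.filter fun g : G => Subgroup.zpowers g = Subgroup.zpowers g₀,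
      ((orderOf g).totient : ℚ)⁻¹ = ((orderOf g₀).totient : ℚ)⁻¹ := by
    intro g hg
    rw [orderOf_eq_of_zpowers_eq (Finset.mem_filter.1 hg).2]
  have hφ : ((orderOf g₀).totient : ℚ) ≠ 0 := by
    exact_mod_cast (Nat.totient_pos.2 (orderOf_pos g₀)).ne'
  rw [Finset.sum_congr rfl hord, Finset.sum_const, card_generators_zpowers, nsmul_eq_mul,
    mul_inv_cancel₀ hφ, Nat.cast_one]

theorem alpha_eq_sum (G : Type*) [Group G] [Fintype G] :
    alpha G = (∑ g : G, ((orderOf g).totient : ℚ)⁻¹) / Fintype.card G := by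
  rw [alpha, numCyclic_eq_sum, Nat.card_eq_fintype_card]

theorem alpha_congr {H : Type*} [Group H] [Finite G] (e : G ≃* H) : alpha G = alpha H := by
  have : Fintype G := Fintype.ofFinite G
  have : Fintype H := Fintype.ofEquiv G e.toEquiv
  rw [alpha_eq_sum, alpha_eq_sum, Fintype.card_congr e.toEquiv]
  congr 1
  refine Fintype.sum_equiv e.toEquiv _ _ fun g => ?_
  exact congrArg (fun n : ℕ => (n.totient : ℚ)⁻¹) (MulEquiv.orderOf_eq e g).symm

theorem totient_lcm_of_dvd_two {d n : ℕ} (hd : d ∣ 2) : (Nat.lcm d n).totient = n.totient := by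
  rcases (Nat.dvd_prime Nat.prime_two).1 hd with rfl | rfl
  · simp
  · rcases Nat.even_or_odd n with h | h
    · rw [Nat.lcm_eq_right h.two_dvd]
    · have hc : Nat.Coprime 2 n := Nat.coprime_two_left.2 h
      rw [hc.lcm_eq_mul, Nat.totient_mul hc, Nat.totient_two, one_mul]

theorem alpha_prod_of_mul_self {E : Type*} [Group E] [Finite E] [Finite G]
    (hE : ∀ e : E, e * e = 1) : alpha (E × G) = alpha G := by
  have : Fintype G := Fintype.ofFinite G
  have : Fintype E := Fintype.ofFinite E
  have h : ∀ (e : E) (g : G), ((orderOf (e, g)).totient : ℚ)⁻¹ = ((orderOf g).totient : ℚ)⁻¹ := by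
    intro e g
    rw [Prod.orderOf_mk,
      totient_lcm_of_dvd_two (orderOf_dvd_of_pow_eq_one ((pow_two e).trans (hE e)))]
  rw [alpha_eq_sum, alpha_eq_sum, Fintype.sum_prod_type, Fintype.card_prod]
  simp only [h, Finset.sum_const, nsmul_eq_mul, Finset.card_univ, Nat.cast_mul]
  exact mul_div_mul_left _ _ (by exact_mod_cast Fintype.card_ne_zero)

theorem cpow_two_mul_self {m : ℕ} (e : CPow 2 m) : e * e = 1 :=
  funext fun i => (by decide : ∀ x : C 2, x * x = 1) (e i)

theorem totient_orderOf_eq_one_iff (g : G) : (orderOf g).totient = 1 ↔ g * g = 1 := by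
  rw [← pow_two, ← orderOf_dvd_iff_pow_eq_one, Nat.totient_eq_one_iff,
    Nat.dvd_prime Nat.prime_two]

theorem totient_orderOf_eq_two {g : G} (h : orderOf g ∣ 4 ∨ orderOf g ∣ 6) (hg : g * g ≠ 1) :
    (orderOf g).totient = 2 := by
  have hfour : ∀ n ∈ Nat.divisors 4, n.totient = 1 ∨ n.totient = 2 := by decide
  have hsix : ∀ n ∈ Nat.divisors 6, n.totient = 1 ∨ n.totient = 2 := by decide
  refine Or.resolve_left ?_ (mt (totient_orderOf_eq_one_iff g).1 hg)
  rcases h with h | h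
  · exact hfour _ (Nat.mem_divisors.2 ⟨h, by norm_num⟩)
  · exact hsix _ (Nat.mem_divisors.2 ⟨h, by norm_num⟩)

theorem inv_totient_orderOf_le_half [Finite G] {g : G} (hg : g * g ≠ 1) :
    ((orderOf g).totient : ℚ)⁻¹ ≤ 1 / 2 := by
  have hpos := Nat.totient_pos.2 (orderOf_pos g)
  have hne := mt (totient_orderOf_eq_one_iff g).1 hg
  have htwo : (2 : ℚ) ≤ (orderOf g).totient := by
    exact_mod_cast (by omega : 2 ≤ (orderOf g).totient)
  rw [one_div]
  exact inv_anti₀ two_pos htwo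

theorem sum_ite_mul_self_eq_one (G : Type*) [Group G] [Fintype G] [DecidableEq G] :
    ∑ g : G, (if g * g = 1 then (1 : ℚ) else 1 / 2) = (Fintype.card G + numInvol G) / 2 := by
  have h : ∀ g : G, (if g * g = 1 then (1 : ℚ) else 1 / 2) =
      1 / 2 + (if g * g = 1 then (1 / 2 : ℚ) else 0) := by
    intro g; split_ifs <;> norm_num
  simp only [h]
  rw [Finset.sum_add_distrib, ← Finset.sum_filter, Finset.sum_const, Finset.sum_const,
    numInvol_eq_card_filter, Finset.card_univ]
  simp only [nsmul_eq_mul]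
  ring

theorem card_lt_two_mul_numInvol [Finite G] (h : 3 / 4 < alpha G) :
    Nat.card G < 2 * numInvol G := by
  classical
  have : Fintype G := Fintype.ofFinite G
  have hle : ∑ g : G, ((orderOf g).totient : ℚ)⁻¹ ≤
      ∑ g : G, (if g * g = 1 then (1 : ℚ) else 1 / 2) := by
    refine Finset.sum_le_sum fun g _ => ?_
    split_ifs with hg
    · rw [(totient_orderOf_eq_one_iff g).2 hg, Nat.cast_one, inv_one]
    · exact inv_totient_orderOf_le_half hg
  have hpos : (0 : ℚ) < Fintype.card G := by exact_mod_cast Fintype.card_pos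
  rw [sum_ite_mul_self_eq_one] at hle
  rw [alpha_eq_sum, lt_div_iff₀ hpos] at h
  have hlt : (Fintype.card G : ℚ) < 2 * numInvol G := by linarith
  rw [Nat.card_eq_fintype_card]
  exact_mod_cast hlt

theorem alpha_eq_of_orderOf_dvd [Finite G] (h : ∀ g : G, orderOf g ∣ 4 ∨ orderOf g ∣ 6) :
    alpha G = (Nat.card G + numInvol G) / (2 * Nat.card G) := by
  classical
  have : Fintype G := Fintype.ofFinite G
  rw [alpha_eq_sum, Nat.card_eq_fintype_card, mul_comm 2, ← div_div, div_right_comm,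
    ← sum_ite_mul_self_eq_one]
  congr 1
  refine Finset.sum_congr rfl fun g _ => ?_
  split_ifs with hg
  · rw [(totient_orderOf_eq_one_iff g).2 hg, Nat.cast_one, inv_one]
  · rw [totient_orderOf_eq_two (h g) hg, Nat.cast_two, one_div]

theorem alpha_eq_one_of_mul_self [Finite G] (h : ∀ g : G, g * g = 1) : alpha G = 1 := by
  have hI : numInvol G = Nat.card G := Nat.card_congr (Equiv.subtypeUnivEquiv h)
  have hpos : (Nat.card G : ℚ) ≠ 0 := by exact_mod_cast Nat.card_pos.ne'
  have hord : ∀ g : G, orderOf g ∣ 4 := fun g =>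
    (orderOf_dvd_of_pow_eq_one ((pow_two g).trans (h g))).trans (by norm_num)
  rw [alpha_eq_of_orderOf_dvd fun g => Or.inl (hord g), hI, ← two_mul]
  exact div_self (mul_ne_zero two_ne_zero hpos)

end Alpha

/-! ### Abelian subgroups inverted by an involution -/

section Inversion

variable {X : Type*} [Group X]

/-- `t * t = 1` and conjugation by `t` inverts every element of `A`; in particular `A` is
commutative. The case `t = 1` is allowed, and then `A` has exponent dividing `2`. -/
structure Inverts (t : X) (A : Subgroup X) : Prop where
  sq : t * t = 1
  conj : ∀ a ∈ A, t * a * t = a⁻¹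

theorem conj_mul_of_sq {t : X} (ht : t * t = 1) (x y : X) :
    t * (x * y) * t = (t * x * t) * (t * y * t) := by
  have h : (t * x * t) * (t * y * t) = t * x * (t * t) * y * t := by group
  rw [h, ht]; group

theorem conj_inv_of_sq {t : X} (ht : t * t = 1) (x : X) : t * x⁻¹ * t = (t * x * t)⁻¹ := by
  rw [mul_inv_rev, mul_inv_rev, inv_eq_of_mul_eq_one_left ht, mul_assoc]

theorem Inverts.inv_eq {t : X} {A : Subgroup X} (h : Inverts t A) : t⁻¹ = t :=
  inv_eq_of_mul_eq_one_left h.sq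

theorem Inverts.mono {t : X} {A B : Subgroup X} (h : Inverts t A) (hB : B ≤ A) : Inverts t B :=
  ⟨h.sq, fun a ha => h.conj a (hB ha)⟩

theorem Inverts.comm {t : X} {A : Subgroup X} (h : Inverts t A) {a b : X} (ha : a ∈ A)
    (hb : b ∈ A) : a * b = b * a := by
  have hconj := h.conj _ (A.mul_mem (A.inv_mem ha) (A.inv_mem hb))
  rw [conj_mul_of_sq h.sq, h.conj _ (A.inv_mem ha), h.conj _ (A.inv_mem hb)] at hconj
  simpa using hconj

theorem inverts_closure {t : X} (ht : t * t = 1) {s : Set X}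
    (hs : ∀ x ∈ s, t * x * t = x⁻¹) (hc : ∀ x ∈ s, ∀ y ∈ s, x * y = y * x) :
    Inverts t (Subgroup.closure s) := by
  have := Subgroup.isMulCommutative_closure hc
  refine ⟨ht, fun a ha => ?_⟩
  induction ha using Subgroup.closure_induction with
  | mem x hx => exact hs x hx
  | one => simp [ht]
  | mul x y hx hy ihx ihy =>
    rw [conj_mul_of_sq ht, ihx, ihy, ← mul_inv_rev, setLike_mul_comm hx hy]
  | inv x hx ih => rw [conj_inv_of_sq ht, ih]

theorem Inverts.closure_union {t : X} {B : Subgroup X} (h : Inverts t B) {s : Set X}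
    (hs : ∀ x ∈ s, t * x * t = x⁻¹) (hc : ∀ x ∈ s, ∀ y ∈ s, x * y = y * x)
    (hB : ∀ b ∈ B, ∀ x ∈ s, b * x = x * b) :
    Inverts t (Subgroup.closure ((B : Set X) ∪ s)) := by
  refine inverts_closure h.sq ?_ ?_
  · rintro x (hx | hx)
    · exact h.conj x hx
    · exact hs x hx
  · rintro x (hx | hx) y (hy | hy)
    · exact h.comm hx hy
    · exact hB x hx y hy
    · exact (hB y hy x hx).symm
    · exact hc x hx y hy

theorem mul_card_le_of_cosets_ne [Finite X] {B M : Subgroup X} (hBM : B ≤ M) {r : ℕ}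
    (f : Fin r → X) (hf : ∀ i, f i ∈ M) (hd : ∀ i j, i < j → (f i)⁻¹ * f j ∉ B) :
    r * Nat.card B ≤ Nat.card M := by
  have hinj : Function.Injective fun i => (QuotientGroup.mk ⟨f i, hf i⟩ : M ⧸ B.subgroupOf M) :=
    Function.Injective.of_lt_imp_ne fun i j hij h => hd i j hij
      ((QuotientGroup.eq (s := B.subgroupOf M)).1 h)
  have hcard := Nat.card_le_card_of_injective _ hinj
  rw [Nat.card_eq_fintype_card, Fintype.card_fin] at hcard
  rw [Subgroup.card_eq_card_quotient_mul_card_subgroup (B.subgroupOf M),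
    Nat.card_congr (Subgroup.subgroupOfEquivOfLe hBM).toEquiv]
  exact Nat.mul_le_mul_right _ hcard

theorem card_eq_relIndex_mul {B M : Subgroup X} (hBM : B ≤ M) :
    Nat.card M = B.relIndex M * Nat.card B := by
  rw [← Subgroup.relIndex_bot_left B, mul_comm, Subgroup.relIndex_mul_relIndex _ _ _ bot_le hBM,
    Subgroup.relIndex_bot_left]

theorem two_mul_card_le_of_notMem [Finite X] {B M : Subgroup X} (hBM : B ≤ M) {a : X}
    (ha : a ∈ M) (haB : a ∉ B) : 2 * Nat.card B ≤ Nat.card M := by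
  have hne_one : B.relIndex M ≠ 1 := fun h => haB (Subgroup.relIndex_eq_one.1 h ha)
  have hpos : 0 < B.relIndex M := Nat.pos_of_dvd_of_pos (B.relIndex_dvd_card M) Nat.card_pos
  rw [card_eq_relIndex_mul hBM]
  exact Nat.mul_le_mul_right _ (by omega)

theorem mul_mem_of_card_lt [Finite X] {B M : Subgroup X} (hBM : B ≤ M)
    (h : Nat.card M < 3 * Nat.card B) {a b : X} (ha : a ∈ M) (hb : b ∈ M) (haB : a ∉ B)
    (hbB : b ∉ B) : a * b ∈ B := by
  have hcard := two_mul_card_le_of_notMem hBM ha haB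
  rw [card_eq_relIndex_mul hBM] at h hcard
  have htwo : (B.subgroupOf M).index = 2 :=
    le_antisymm (Nat.le_of_lt_succ (Nat.lt_of_mul_lt_mul_right h))
      (Nat.le_of_mul_le_mul_right hcard Nat.card_pos)
  exact (Subgroup.mul_mem_iff_of_index_two htwo (a := ⟨a, ha⟩) (b := ⟨b, hb⟩)).2
    (iff_of_false haB hbB)

theorem exists_mem_notMem_of_card_lt [Finite X] {B M : Subgroup X}
    (h : Nat.card B < Nat.card M) : ∃ a ∈ M, a ∉ B := by
  by_contra! hc
  exact absurd (Subgroup.card_le_of_le hc) (not_le.2 h)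

/-- The centralizer `C_A(x)` of `x` in `A`, where `x` need not lie in `A`. -/
def cent (A : Subgroup X) (x : X) : Subgroup X := A ⊓ Subgroup.centralizer {x}

theorem mem_cent {A : Subgroup X} {x a : X} : a ∈ cent A x ↔ a ∈ A ∧ a * x = x * a := by
  rw [cent, Subgroup.mem_inf, Subgroup.mem_centralizer_singleton_iff]

theorem cent_le (A : Subgroup X) (x : X) : cent A x ≤ A := inf_le_left

theorem cent_eq_self_iff {A : Subgroup X} {x : X} : cent A x = A ↔ ∀ a ∈ A, a * x = x * a :=
  ⟨fun h _ ha => (mem_cent.1 (h ▸ ha)).2,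
    fun h => le_antisymm (cent_le A x) fun a ha => mem_cent.2 ⟨ha, h a ha⟩⟩

theorem cent_inv (A : Subgroup X) (x : X) : cent A x⁻¹ = cent A x := by
  ext b
  exact mem_cent.trans ((and_congr_right fun _ => Commute.inv_right_iff).trans mem_cent.symm)

theorem cent_inf_le (A : Subgroup X) (x y : X) : cent A x ⊓ cent A y ≤ cent A (x * y) := by
  rintro b ⟨hx, hy⟩
  exact mem_cent.2 ⟨(mem_cent.1 hx).1, Commute.mul_right (mem_cent.1 hx).2 (mem_cent.1 hy).2⟩

/-- `A` is inverted by `t`, and no subgroup of `X` inverted by an element is larger than `A`. -/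
structure MaxInverts (t : X) (A : Subgroup X) : Prop extends Inverts t A where
  max : ∀ (u : X) (B : Subgroup X), Inverts u B → Nat.card B ≤ Nat.card A

theorem exists_maxInverts (X : Type*) [Group X] [Finite X] :
    ∃ (t : X) (A : Subgroup X), MaxInverts t A := by
  have : Nonempty {p : X × Subgroup X // Inverts p.1 p.2} := ⟨⟨(1, ⊥), by simp, by simp⟩⟩
  obtain ⟨p, hp⟩ := Finite.exists_max
    (fun p : {p : X × Subgroup X // Inverts p.1 p.2} => Nat.card p.1.2)
  exact ⟨p.1.1, p.1.2, p.2, fun u B h => hp ⟨(u, B), h⟩⟩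

variable {t : X} {A : Subgroup X}

theorem Inverts.cent_mul_left (h : Inverts t A) {a : X} (ha : a ∈ A) (x : X) :
    cent A (a * x) = cent A x := by
  ext b
  rw [mem_cent, mem_cent]
  refine and_congr_right fun hb => ?_
  rw [← mul_assoc, h.comm hb ha, mul_assoc, mul_assoc, mul_right_inj]

theorem Inverts.cent_mul_right (h : Inverts t A) {a : X} (ha : a ∈ A) (x : X) :
    cent A (x * a) = cent A x := by
  rw [← cent_inv, mul_inv_rev, h.cent_mul_left (A.inv_mem ha), cent_inv]

/-! ### Counting inverted elements coset by coset -/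

/-- The number of elements inverted by `t` in a coset of `A`. -/
noncomputable def cosetCount (t : X) (A : Subgroup X) (c : X ⧸ A) : ℕ :=
  Nat.card {s : X // t * s * t = s⁻¹ ∧ (s : X ⧸ A) = c}

theorem card_inverted (t : X) : Nat.card {x : X // t * x * t = x⁻¹} = numInvol X := by
  refine Nat.card_congr (Equiv.subtypeEquiv (Equiv.mulLeft t) fun x => ?_)
  rw [Equiv.coe_mulLeft, eq_inv_iff_mul_eq_one, ← mul_assoc]

theorem sum_cosetCount [Finite X] [Fintype (X ⧸ A)] (t : X) :
    ∑ c : X ⧸ A, cosetCount t A c = numInvol X := by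
  classical
  have : Fintype X := Fintype.ofFinite X
  rw [← card_inverted t, Nat.card_eq_fintype_card, Fintype.card_subtype,
    Finset.card_eq_sum_card_fiberwise (f := fun s : X => (s : X ⧸ A)) (t := Finset.univ)
      (fun _ _ => Finset.mem_coe.2 (Finset.mem_univ _))]
  refine Finset.sum_congr rfl fun c _ => ?_
  rw [cosetCount, Nat.card_eq_fintype_card, Fintype.card_subtype, Finset.filter_filter]

theorem exists_inverted_of_cosetCount_ne_zero {c : X ⧸ A} (h : cosetCount t A c ≠ 0) :
    ∃ s : X, t * s * t = s⁻¹ ∧ (s : X ⧸ A) = c :=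
  nonempty_subtype.1 (Nat.card_ne_zero.1 h).1

theorem Inverts.conj_mul_eq_inv_iff (h : Inverts t A) {x : X} (hx : t * x * t = x⁻¹) {a : X}
    (ha : a ∈ A) : t * (x * a) * t = (x * a)⁻¹ ↔ a ∈ cent A x := by
  rw [conj_mul_of_sq h.sq, hx, h.conj a ha, mem_cent, ← mul_inv_rev, inv_inj, and_iff_right ha]

theorem Inverts.cosetCount_of_inverted (h : Inverts t A) {x : X} (hx : t * x * t = x⁻¹) :
    cosetCount t A x = Nat.card (cent A x) := by
  refine (Nat.card_congr (Equiv.subtypeEquiv (Equiv.mulLeft x) fun a => ?_)).symm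
  rw [Equiv.coe_mulLeft, eq_comm (a := ((x * a : X) : X ⧸ A)), QuotientGroup.eq,
    inv_mul_cancel_left]
  exact ⟨fun ha => ⟨(h.conj_mul_eq_inv_iff hx (cent_le A x ha)).2 ha, cent_le A x ha⟩,
    fun ha => (h.conj_mul_eq_inv_iff hx ha.2).1 ha.1⟩

theorem Inverts.cosetCount_one (h : Inverts t A) :
    cosetCount t A ((1 : X) : X ⧸ A) = Nat.card A := by
  rw [h.cosetCount_of_inverted (by rw [mul_one, h.sq, inv_one]),
    cent_eq_self_iff.2 fun a _ => Commute.one_right a]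

theorem MaxInverts.mem_of_inverted_of_commute [Finite X] (h : MaxInverts t A) {x : X}
    (hx : t * x * t = x⁻¹) (hc : ∀ a ∈ A, a * x = x * a) : x ∈ A := by
  by_contra hxA
  have hmax := h.max t _ (h.toInverts.closure_union (s := {x}) (by simpa using hx)
    (by simp) (by simpa using hc))
  have hle : A ≤ Subgroup.closure ((A : Set X) ∪ {x}) :=
    fun a ha => Subgroup.subset_closure (Or.inl ha)
  have htwo := two_mul_card_le_of_notMem hle (Subgroup.subset_closure (Or.inr rfl)) hxA
  have hpos : 0 < Nat.card A := Nat.card_pos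
  omega

theorem MaxInverts.two_mul_cosetCount_le [Finite X] (h : MaxInverts t A) {c : X ⧸ A}
    (hc : c ≠ ((1 : X) : X ⧸ A)) : 2 * cosetCount t A c ≤ Nat.card A := by
  by_cases hzero : cosetCount t A c = 0
  · omega
  obtain ⟨s, hs, rfl⟩ := exists_inverted_of_cosetCount_ne_zero hzero
  have hsA : s ∉ A := fun hsA => hc (QuotientGroup.eq.2 (by simpa using hsA))
  obtain ⟨a, ha, has⟩ : ∃ a ∈ A, a * s ≠ s * a := by
    by_contra! hcomm
    exact hsA (h.mem_of_inverted_of_commute hs hcomm)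
  rw [h.toInverts.cosetCount_of_inverted hs]
  exact two_mul_card_le_of_notMem (cent_le A s) ha fun h' => has (mem_cent.1 h').2

theorem Inverts.sum_deficit [Finite X] [Fintype (X ⧸ A)] [DecidableEq (X ⧸ A)]
    (h : Inverts t A) :
    ∑ c ∈ Finset.univ.erase ((1 : X) : X ⧸ A), ((Nat.card A : ℤ) - 2 * cosetCount t A c) =
      Nat.card X + Nat.card A - 2 * numInvol X := by
  have hone := Finset.add_sum_erase Finset.univ
    (fun c => (Nat.card A : ℤ) - 2 * cosetCount t A c) (Finset.mem_univ ((1 : X) : X ⧸ A))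
  have hall : ∑ c : X ⧸ A, ((Nat.card A : ℤ) - 2 * cosetCount t A c) =
      Nat.card X - 2 * numInvol X := by
    rw [Finset.sum_sub_distrib, ← Finset.mul_sum, Finset.sum_const, Finset.card_univ,
      nsmul_eq_mul, ← Nat.cast_sum, sum_cosetCount, ← Nat.cast_mul,
      ← Nat.card_eq_fintype_card, ← Subgroup.card_eq_card_quotient_mul_card_subgroup]
  rw [h.cosetCount_one, hall] at hone
  linarith

theorem MaxInverts.sum_deficit_lt [Finite X] (h : MaxInverts t A)
    (hX : Nat.card X < 2 * numInvol X) (T : Finset (X ⧸ A)) (hT : ((1 : X) : X ⧸ A) ∉ T) :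
    ∑ c ∈ T, ((Nat.card A : ℤ) - 2 * cosetCount t A c) < Nat.card A := by
  classical
  have : Fintype (X ⧸ A) := Fintype.ofFinite _
  calc ∑ c ∈ T, ((Nat.card A : ℤ) - 2 * cosetCount t A c)
      ≤ ∑ c ∈ Finset.univ.erase ((1 : X) : X ⧸ A), ((Nat.card A : ℤ) - 2 * cosetCount t A c) := by
        refine Finset.sum_le_sum_of_subset_of_nonneg (fun c hc => ?_) fun c hc _ => ?_
        · exact Finset.mem_erase.2 ⟨ne_of_mem_of_not_mem hc hT, Finset.mem_univ _⟩
        · have := h.two_mul_cosetCount_le (Finset.ne_of_mem_erase hc)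
          omega
    _ < Nat.card A := by
        rw [h.toInverts.sum_deficit]
        omega

theorem MaxInverts.exists_mul_inverted [Finite X] (h : MaxInverts t A)
    (hX : Nat.card X < 2 * numInvol X) (x : X) : ∃ a ∈ A, t * (x * a) * t = (x * a)⁻¹ := by
  by_cases hx : x ∈ A
  · exact ⟨x⁻¹, A.inv_mem hx, by rw [mul_inv_cancel, mul_one, h.sq, inv_one]⟩
  have hlt := h.sum_deficit_lt hX {(x : X ⧸ A)} (by
    rw [Finset.mem_singleton, QuotientGroup.eq]; simpa using hx)
  rw [Finset.sum_singleton] at hlt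
  obtain ⟨s, hs, hsx⟩ :=
    exists_inverted_of_cosetCount_ne_zero (t := t) (c := (x : X ⧸ A)) (by omega)
  exact ⟨x⁻¹ * s, QuotientGroup.eq.1 hsx.symm, by rwa [mul_inv_cancel_left]⟩

theorem MaxInverts.cosetCount_mk [Finite X] (h : MaxInverts t A)
    (hX : Nat.card X < 2 * numInvol X) (x : X) : cosetCount t A x = Nat.card (cent A x) := by
  obtain ⟨a, ha, hs⟩ := h.exists_mul_inverted hX x
  rw [← QuotientGroup.mk_mul_of_mem x ha, h.toInverts.cosetCount_of_inverted hs,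
    h.cent_mul_right ha]

theorem MaxInverts.two_mul_card_cent_le [Finite X] (h : MaxInverts t A)
    (hX : Nat.card X < 2 * numInvol X) {x : X} (hxA : x ∉ A) :
    2 * Nat.card (cent A x) ≤ Nat.card A := by
  rw [← h.cosetCount_mk hX]
  refine h.two_mul_cosetCount_le fun hx => hxA ?_
  simpa using QuotientGroup.eq.1 hx

theorem MaxInverts.mem_of_commute [Finite X] (h : MaxInverts t A)
    (hX : Nat.card X < 2 * numInvol X) {x : X} (hc : ∀ a ∈ A, a * x = x * a) : x ∈ A := by
  by_contra hxA
  have hle := h.two_mul_card_cent_le hX hxA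
  have hpos : 0 < Nat.card A := Nat.card_pos
  rw [cent_eq_self_iff.2 hc] at hle
  omega

theorem MaxInverts.card_lt_of_two_cosets [Finite X] (h : MaxInverts t A)
    (hX : Nat.card X < 2 * numInvol X) {x y : X} (hxA : x ∉ A) (hyA : y ∉ A)
    (hxy : x⁻¹ * y ∉ A) : Nat.card A < 2 * (Nat.card (cent A x) + Nat.card (cent A y)) := by
  classical
  have hlt := h.sum_deficit_lt hX {(x : X ⧸ A), (y : X ⧸ A)} (by
    simp only [Finset.mem_insert, Finset.mem_singleton, QuotientGroup.eq, inv_one, one_mul]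
    tauto)
  rw [Finset.sum_pair (by rwa [Ne, QuotientGroup.eq]), h.cosetCount_mk hX,
    h.cosetCount_mk hX] at hlt
  omega

theorem MaxInverts.card_lt_of_three_cosets [Finite X] (h : MaxInverts t A)
    (hX : Nat.card X < 2 * numInvol X) {x y z : X} (hxA : x ∉ A) (hyA : y ∉ A) (hzA : z ∉ A)
    (hxy : x⁻¹ * y ∉ A) (hxz : x⁻¹ * z ∉ A) (hyz : y⁻¹ * z ∉ A) :
    Nat.card A < Nat.card (cent A x) + Nat.card (cent A y) + Nat.card (cent A z) := by
  classical
  have hlt := h.sum_deficit_lt hX {(x : X ⧸ A), (y : X ⧸ A), (z : X ⧸ A)} (by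
    simp only [Finset.mem_insert, Finset.mem_singleton, QuotientGroup.eq, inv_one, one_mul]
    tauto)
  rw [Finset.sum_insert (by
      simp only [Finset.mem_insert, Finset.mem_singleton, QuotientGroup.eq]; tauto),
    Finset.sum_pair (by rwa [Ne, QuotientGroup.eq]), h.cosetCount_mk hX, h.cosetCount_mk hX,
    h.cosetCount_mk hX] at hlt
  omega

end Inversion

section Normality

variable {X : Type*} [Group X] {t : X} {A : Subgroup X}

theorem Inverts.subgroupOf_normal (h : Inverts t A) (B : Subgroup X) :
    (B.subgroupOf A).Normal := by
  refine ⟨fun b hb g => ?_⟩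
  rwa [show g * b * g⁻¹ = b from mul_inv_eq_of_eq_mul (Subtype.ext (h.comm g.2 b.2))]

theorem Inverts.pow_relIndex_mem (h : Inverts t A) (B : Subgroup X) {a : X} (ha : a ∈ A) :
    a ^ B.relIndex A ∈ B := by
  have := h.subgroupOf_normal B
  exact (B.subgroupOf A).pow_index_mem ⟨a, ha⟩

theorem Inverts.exists_dvd_card_eq_mul [Finite X] (h : Inverts t A) {B C : Subgroup X}
    (hB : B ≤ A) (hC : C ≤ A) {m : ℕ} (hm : Nat.card A = m * Nat.card B) :
    ∃ p, p ∣ m ∧ Nat.card C = p * Nat.card (C ⊓ B : Subgroup X) := by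
  have := h.subgroupOf_normal B
  have hdvd := Subgroup.relIndex_dvd_index_of_normal (B.subgroupOf A) (C.subgroupOf A)
  rw [Subgroup.relIndex_subgroupOf hC] at hdvd
  have hindex : B.relIndex A = m :=
    Nat.eq_of_mul_eq_mul_right Nat.card_pos ((card_eq_relIndex_mul hB).symm.trans hm)
  refine ⟨B.relIndex C, hindex ▸ hdvd, ?_⟩
  rw [← Subgroup.inf_relIndex_left, card_eq_relIndex_mul inf_le_left]

theorem MaxInverts.mul_self_mem_of_card_lt [Finite X] (h : MaxInverts t A) {u : X}
    {B : Subgroup X} (hB : Inverts u B) (hcard : Nat.card A < 3 * Nat.card B) {g : X}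
    (hg : u * g * u = g⁻¹) (hc : ∀ b ∈ B, b * g = g * b) : g * g ∈ B := by
  by_cases hgB : g ∈ B
  · exact B.mul_mem hgB hgB
  have hmax := h.max u _ (hB.closure_union (s := {g}) (by simpa using hg) (by simp)
    (by simpa using hc))
  have hle : B ≤ Subgroup.closure ((B : Set X) ∪ {g}) :=
    fun a ha => Subgroup.subset_closure (Or.inl ha)
  have hmem : g ∈ Subgroup.closure ((B : Set X) ∪ {g}) := Subgroup.subset_closure (Or.inr rfl)
  exact mul_mem_of_card_lt hle (by omega) hmem hmem hgB hgB

theorem Inverts.mul_inverts_cent (h : Inverts t A) {x : X} (hx : t * x * t = x⁻¹) :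
    Inverts (x * t) (cent A x) := by
  refine ⟨by rw [mul_assoc, ← mul_assoc t, hx, mul_inv_cancel], fun b hb => ?_⟩
  have hcomm : b⁻¹ * x = x * b⁻¹ := (mem_cent.1 ((cent A x).inv_mem hb)).2
  calc x * t * b * (x * t) = x * (t * (b * x) * t) := by group
    _ = x * (b⁻¹ * x⁻¹) := by rw [conj_mul_of_sq h.sq, h.conj b (cent_le A x hb), hx]
    _ = b⁻¹ := by rw [← mul_assoc, ← hcomm, mul_inv_cancel_right]

theorem MaxInverts.conj_mem_of_inverted [Finite X] (h : MaxInverts t A) {x : X}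
    (hx : t * x * t = x⁻¹) (hcard : 2 * Nat.card (cent A x) = Nat.card A) {a : X} (ha : a ∈ A) :
    x * a * x⁻¹ ∈ A := by
  have hlt : Nat.card A < 3 * Nat.card (cent A x) := by
    have hpos : 0 < Nat.card (cent A x) := Nat.card_pos
    omega
  have hxx : x * x ∈ A := cent_le A x <| h.mul_self_mem_of_card_lt
    (h.toInverts.mono (cent_le A x)) hlt hx fun b hb => (mem_cent.1 hb).2
  have hax_inverted : x * t * (a * x) * (x * t) = (a * x)⁻¹ := by
    have hcomm := h.toInverts.comm (A.inv_mem ha) (A.inv_mem hxx)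
    calc x * t * (a * x) * (x * t) = x * (t * (a * (x * x)) * t) := by group
      _ = x * ((x * x)⁻¹ * a⁻¹) := by
          rw [conj_mul_of_sq h.sq, h.conj a ha, h.conj _ hxx, hcomm]
      _ = (a * x)⁻¹ := by group
  have hax_sq : a * x * (a * x) ∈ A := cent_le A x <|
    h.mul_self_mem_of_card_lt (h.toInverts.mul_inverts_cent hx) hlt hax_inverted fun b hb => by
      rw [← mul_assoc, h.toInverts.comm (cent_le A x hb) ha, mul_assoc, (mem_cent.1 hb).2,
        mul_assoc]
  have heq : x * a * x⁻¹ = a⁻¹ * (a * x * (a * x)) * (x * x)⁻¹ := by group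
  rw [heq]
  exact A.mul_mem (A.mul_mem (A.inv_mem ha) hax_sq) (A.inv_mem hxx)

theorem MaxInverts.conj_mem_of_two_mul_card_cent [Finite X] (h : MaxInverts t A)
    (hX : Nat.card X < 2 * numInvol X) {x : X} (hcard : 2 * Nat.card (cent A x) = Nat.card A)
    {a : X} (ha : a ∈ A) : x * a * x⁻¹ ∈ A := by
  obtain ⟨b, hb, hxb⟩ := h.exists_mul_inverted hX x
  rw [← h.cent_mul_right hb] at hcard
  have hmem := h.conj_mem_of_inverted hxb hcard (A.mul_mem (A.mul_mem (A.inv_mem hb) ha) hb)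
  rwa [show x * b * (b⁻¹ * a * b) * (x * b)⁻¹ = x * a * x⁻¹ by group] at hmem

/- If `x⁻¹ a x ∉ A`, then `x A`, `a x A` and possibly `a² x A` are distinct cosets whose elements
have the same centralizer in `A`, and the coset inequalities bound its index. -/
theorem MaxInverts.inv_mul_mul_mem [Finite X] (h : MaxInverts t A)
    (hX : Nat.card X < 2 * numInvol X) (x : X) {a : X} (ha : a ∈ A) : x⁻¹ * a * x ∈ A := by
  by_contra hax
  have haa := A.mul_mem ha ha
  have hxA : x ∉ A := fun hxA => hax (A.mul_mem (A.mul_mem (A.inv_mem hxA) ha) hxA)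
  have htwo := h.card_lt_of_two_cosets hX hxA (fun hc => hxA ((A.mul_mem_cancel_left ha).1 hc))
    (by rwa [← mul_assoc])
  have hle := h.two_mul_card_cent_le hX hxA
  have hindex := card_eq_relIndex_mul (cent_le A x)
  rw [h.cent_mul_left ha] at htwo
  obtain hrel | hrel : (cent A x).relIndex A = 2 ∨ (cent A x).relIndex A = 3 := by
    rw [hindex] at hle htwo
    have hge := Nat.le_of_mul_le_mul_right hle Nat.card_pos
    have hlt : (cent A x).relIndex A < 4 :=
      Nat.lt_of_mul_lt_mul_right (a := Nat.card (cent A x)) (by omega)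
    omega
  · have hmem := h.conj_mem_of_two_mul_card_cent hX (x := x⁻¹) (by rw [cent_inv, hindex, hrel]) ha
    rw [inv_inv] at hmem
    exact hax hmem
  · rw [hrel] at hindex
    by_cases hsq : x⁻¹ * (a * a) * x ∈ A
    · have hcube : a ^ 3 ∈ cent A x := hrel ▸ h.toInverts.pow_relIndex_mem (cent A x) ha
      have heq : x⁻¹ * a * x = a ^ 3 * (x⁻¹ * (a * a) * x)⁻¹ := by
        rw [eq_mul_inv_iff_mul_eq, show x⁻¹ * a * x * (x⁻¹ * (a * a) * x) = x⁻¹ * (a ^ 3 * x) by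
          simp only [pow_succ, pow_zero, one_mul]; group, (mem_cent.1 hcube).2,
          inv_mul_cancel_left]
      rw [heq] at hax
      exact hax (A.mul_mem (cent_le A x hcube) (A.inv_mem hsq))
    · have hthree := h.card_lt_of_three_cosets hX hxA
        (fun hc => hxA ((A.mul_mem_cancel_left ha).1 hc))
        (fun hc => hxA ((A.mul_mem_cancel_left haa).1 hc))
        (by rwa [← mul_assoc]) (by rwa [← mul_assoc])
        (by rwa [show (a * x)⁻¹ * (a * a * x) = x⁻¹ * a * x by group])
      rw [h.cent_mul_left ha, h.cent_mul_left haa] at hthree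
      omega

theorem MaxInverts.normal [Finite X] (h : MaxInverts t A)
    (hX : Nat.card X < 2 * numInvol X) : A.Normal :=
  ⟨fun a ha x => by simpa using h.inv_mul_mul_mem hX x⁻¹ ha⟩

theorem MaxInverts.quotient_conj [Finite X] (h : MaxInverts t A)
    (hX : Nat.card X < 2 * numInvol X) [A.Normal] (x : X ⧸ A) :
    (t : X ⧸ A) * x * (t : X ⧸ A) = x⁻¹ := by
  obtain ⟨x, rfl⟩ := QuotientGroup.mk_surjective x
  obtain ⟨a, ha, hs⟩ := h.exists_mul_inverted hX x
  rw [← QuotientGroup.mk_mul_of_mem x ha]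
  exact congrArg _ hs

theorem MaxInverts.quotient_comm [Finite X] (h : MaxInverts t A)
    (hX : Nat.card X < 2 * numInvol X) [A.Normal] (x y : X ⧸ A) : x * y = y * x := by
  have ht : (t : X ⧸ A) * (t : X ⧸ A) = 1 := congrArg (QuotientGroup.mk (s := A)) h.sq
  have hinv := h.quotient_conj hX (x⁻¹ * y⁻¹)
  rw [conj_mul_of_sq ht, h.quotient_conj hX, h.quotient_conj hX] at hinv
  simpa using hinv

theorem MaxInverts.quotient_sq [Finite X] (h : MaxInverts t A)
    (hX : Nat.card X < 2 * numInvol X) [A.Normal] (x : X ⧸ A) : x * x = 1 := by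
  have ht : (t : X ⧸ A) * (t : X ⧸ A) = 1 := congrArg (QuotientGroup.mk (s := A)) h.sq
  have hinv := h.quotient_conj hX x
  rw [h.quotient_comm hX, ← mul_assoc, ht, one_mul] at hinv
  rw [← eq_inv_iff_mul_eq_one, ← hinv]

theorem MaxInverts.mul_self_mem [Finite X] (h : MaxInverts t A)
    (hX : Nat.card X < 2 * numInvol X) (x : X) : x * x ∈ A := by
  have := h.normal hX
  exact (QuotientGroup.eq_one_iff _).1 (h.quotient_sq hX x)

theorem MaxInverts.commutator_mem [Finite X] (h : MaxInverts t A)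
    (hX : Nat.card X < 2 * numInvol X) (x y : X) : x * y * x⁻¹ * y⁻¹ ∈ A := by
  have := h.normal hX
  refine (QuotientGroup.eq_one_iff _).1 ?_
  simp only [QuotientGroup.mk_mul, QuotientGroup.mk_inv]
  rw [h.quotient_comm hX (x : X ⧸ A) y, mul_inv_cancel_right, mul_inv_cancel]

theorem MaxInverts.inv_mul_mem_iff [Finite X] (h : MaxInverts t A)
    (hX : Nat.card X < 2 * numInvol X) (x y : X) : x⁻¹ * y ∈ A ↔ x * y ∈ A := by
  rw [← A.mul_mem_cancel_left (h.mul_self_mem hX x), mul_assoc, mul_inv_cancel_left]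

theorem cent_inf_cent_mul (A : Subgroup X) (x y : X) :
    cent A x ⊓ cent A (x * y) = cent A x ⊓ cent A y := by
  refine le_antisymm (le_inf inf_le_left ?_) (le_inf inf_le_left (cent_inf_le A x y))
  simpa only [cent_inv, inv_mul_cancel_left] using cent_inf_le A x⁻¹ (x * y)

theorem cent_mul_inf_cent (A : Subgroup X) (x y : X) :
    cent A (x * y) ⊓ cent A y = cent A x ⊓ cent A y := by
  refine le_antisymm (le_inf ?_ inf_le_right) (le_inf (cent_inf_le A x y) inf_le_right)
  simpa only [cent_inv, mul_inv_cancel_right] using cent_inf_le A (x * y) y⁻¹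

theorem MaxInverts.exceptional_of_half [Finite X] (h : MaxInverts t A)
    (hX : Nat.card X < 2 * numInvol X) {x u : X} (hx : x ∉ A) (hu : u ∉ A) (hxu : x * u ∉ A)
    (hxc : 2 * Nat.card (cent A x) ≠ Nat.card A) (huc : 2 * Nat.card (cent A u) = Nat.card A) :
    4 * Nat.card (cent A x) = Nat.card A ∧ 2 * Nat.card (cent A (x * u)) = Nat.card A := by
  obtain ⟨p, hp, hpd⟩ := h.toInverts.exists_dvd_card_eq_mul (cent_le A u) (cent_le A x) huc.symm
  obtain ⟨q, hq, hqd⟩ :=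
    h.toInverts.exists_dvd_card_eq_mul (cent_le A u) (cent_le A (x * u)) huc.symm
  obtain ⟨l, hl⟩ := Subgroup.card_dvd_of_le (inf_le_right : cent A x ⊓ cent A u ≤ cent A u)
  have hlt := h.card_lt_of_two_cosets hX hx hxu (by rwa [inv_mul_cancel_left])
  have hle := h.two_mul_card_cent_le hX hx
  have hthird := h.toInverts.exists_dvd_card_eq_mul (cent_le A (x * u)) (cent_le A x) (m := 3)
  rw [cent_inf_cent_mul] at hthird
  rw [cent_mul_inf_cent] at hqd
  have hd : 0 < Nat.card (cent A x ⊓ cent A u : Subgroup X) := Nat.card_pos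
  generalize Nat.card (cent A x ⊓ cent A u : Subgroup X) = d at *
  have hlpq : l < p + q := by nlinarith
  have hpl : p < l := by nlinarith [hle.lt_of_ne hxc]
  obtain ⟨rfl, rfl, rfl⟩ | ⟨rfl, rfl, rfl⟩ : (p = 1 ∧ q = 2 ∧ l = 2) ∨ (p = 2 ∧ q = 2 ∧ l = 3) := by
    have := (Nat.dvd_prime Nat.prime_two).1 hp
    have := (Nat.dvd_prime Nat.prime_two).1 hq
    omega
  · omega
  · obtain ⟨r, hr, hrd⟩ := hthird (by omega)
    obtain rfl : 2 = r := Nat.eq_of_mul_eq_mul_right hd (hpd.symm.trans hrd)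
    omega

theorem MaxInverts.three_mul_card_cent_le [Finite X] (h : MaxInverts t A)
    (hX : Nat.card X < 2 * numInvol X) {x : X} (hx : x ∉ A)
    (hxc : 2 * Nat.card (cent A x) ≠ Nat.card A) : 3 * Nat.card (cent A x) ≤ Nat.card A := by
  have hle := h.two_mul_card_cent_le hX hx
  rw [card_eq_relIndex_mul (cent_le A x)] at hle hxc ⊢
  have hge := Nat.le_of_mul_le_mul_right hle Nat.card_pos
  exact Nat.mul_le_mul_right _ (hge.lt_of_ne fun heq => hxc (by rw [← heq]))

theorem MaxInverts.exceptional [Finite X] (h : MaxInverts t A)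
    (hX : Nat.card X < 2 * numInvol X) {x u : X} (hx : x ∉ A) (hu : u ∉ A) (hxu : x * u ∉ A)
    (hxc : 2 * Nat.card (cent A x) ≠ Nat.card A) :
    4 * Nat.card (cent A x) = Nat.card A ∧ 2 * Nat.card (cent A u) = Nat.card A ∧
      2 * Nat.card (cent A (x * u)) = Nat.card A := by
  by_cases huc : 2 * Nat.card (cent A u) = Nat.card A
  · have ⟨hfour, htwo⟩ := h.exceptional_of_half hX hx hu hxu hxc huc
    exact ⟨hfour, huc, htwo⟩
  have hxx := h.mul_self_mem hX x
  by_cases hxuc : 2 * Nat.card (cent A (x * u)) = Nat.card A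
  · have ⟨_, htwo⟩ := h.exceptional_of_half hX hx hxu
      (by rwa [← mul_assoc, A.mul_mem_cancel_left hxx]) hxc hxuc
    rw [← mul_assoc, h.cent_mul_left hxx] at htwo
    exact absurd htwo huc
  have hlt := h.card_lt_of_three_cosets hX hx hu hxu (by rwa [h.inv_mul_mem_iff hX])
    (by rwa [inv_mul_cancel_left])
    (fun hmem => hx <| by simpa using (h.normal hX).mem_comm hmem)
  have hx_le := h.three_mul_card_cent_le hX hx hxc
  have hu_le := h.three_mul_card_cent_le hX hu huc
  have hxu_le := h.three_mul_card_cent_le hX hxu hxuc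
  omega

end Normality

/-! ### Transvections -/

section Transvections

variable {X : Type*} [Group X] {t : X} {A : Subgroup X}

/-- Conjugation by `x` acts on `A` as a transvection with axis `cent A x`, a subgroup of index `2`,
and center the involution `v`: it multiplies the elements off the axis by `v`. -/
structure IsTransvection (A : Subgroup X) (x v : X) : Prop where
  mem : v ∈ A
  ne_one : v ≠ 1
  sq : v * v = 1
  conj : ∀ a ∈ A, a ∉ cent A x → x * a * x⁻¹ = v * a
  half : 2 * Nat.card (cent A x) = Nat.card A

theorem conj_of_mem_cent {x a : X} (ha : a ∈ cent A x) : x * a * x⁻¹ = a := by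
  rw [← (mem_cent.1 ha).2, mul_inv_cancel_right]

theorem mem_cent_of_conj {x a : X} (ha : a ∈ A) (h : x * a * x⁻¹ = a) : a ∈ cent A x :=
  mem_cent.2 ⟨ha, (mul_inv_eq_iff_eq_mul.1 h).symm⟩

theorem MaxInverts.exists_isTransvection [Finite X] (h : MaxInverts t A)
    (hX : Nat.card X < 2 * numInvol X) {x : X} (hx : 2 * Nat.card (cent A x) = Nat.card A) :
    ∃ v, IsTransvection A x v := by
  have hn := h.normal hX
  have hpos : 0 < Nat.card (cent A x) := Nat.card_pos
  obtain ⟨a, ha, hax⟩ := exists_mem_notMem_of_card_lt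
    (show Nat.card (cent A x) < Nat.card A by omega)
  have hconj : x * a * x⁻¹ ∈ A := hn.conj_mem a ha x
  refine ⟨x * a * x⁻¹ * a⁻¹, A.mul_mem hconj (A.inv_mem ha),
    fun hone => hax (mem_cent_of_conj ha (mul_inv_eq_one.1 hone)), ?_, fun b hb hbx => ?_, hx⟩
  · have hsq : x * a * x⁻¹ * (x * a * x⁻¹) = a * a := by
      rw [← conj_of_mem_cent (mul_mem_of_card_lt (cent_le A x) (by omega) ha ha hax hax)]
      group
    calc x * a * x⁻¹ * a⁻¹ * (x * a * x⁻¹ * a⁻¹)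
        = x * a * x⁻¹ * (a⁻¹ * (x * a * x⁻¹)) * a⁻¹ := by group
      _ = x * a * x⁻¹ * (x * a * x⁻¹) * a⁻¹ * a⁻¹ := by
          rw [h.comm (A.inv_mem ha) hconj]; group
      _ = 1 := by rw [hsq]; group
  · have hba : b⁻¹ * a ∈ cent A x :=
      mul_mem_of_card_lt (cent_le A x) (by omega) (A.inv_mem hb) ha
        ((cent A x).inv_mem_iff.not.2 hbx) hax
    calc x * b * x⁻¹ = x * a * x⁻¹ * (x * (b⁻¹ * a) * x⁻¹)⁻¹ := by group
      _ = x * a * x⁻¹ * a⁻¹ * b := by rw [conj_of_mem_cent hba]; group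

theorem IsTransvection.conj_or {x v : X} (hv : IsTransvection A x v) {a : X} (ha : a ∈ A) :
    x * a * x⁻¹ = a ∨ x * a * x⁻¹ = v * a := by
  by_cases hc : a ∈ cent A x
  · exact Or.inl (conj_of_mem_cent hc)
  · exact Or.inr (hv.conj a ha hc)

theorem IsTransvection.mul_left (h : Inverts t A) {x v a : X} (hv : IsTransvection A x v)
    (ha : a ∈ A) : IsTransvection A (a * x) v := by
  refine ⟨hv.mem, hv.ne_one, hv.sq, fun b hb hbx => ?_, ?_⟩ <;> rw [h.cent_mul_left ha] at *
  · have hconj := hv.conj b hb hbx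
    calc a * x * b * (a * x)⁻¹ = a * (x * b * x⁻¹) * a⁻¹ := by group
      _ = v * b := by
          rw [hconj, h.comm ha (A.mul_mem hv.mem hb), mul_inv_cancel_right]
  · exact hv.half

theorem IsTransvection.center_mem_cent {x v : X} (hv : IsTransvection A x v) : v ∈ cent A x := by
  by_contra hc
  have hconj := hv.conj v hv.mem hc
  rw [hv.sq, mul_inv_eq_one] at hconj
  exact hv.ne_one (by simpa using hconj)

theorem IsTransvection.exists_notMem_cent [Finite X] {x v : X} (hv : IsTransvection A x v) :
    ∃ a ∈ A, a ∉ cent A x := by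
  have hpos : 0 < Nat.card (cent A x) := Nat.card_pos
  have hhalf := hv.half
  exact exists_mem_notMem_of_card_lt (by omega)

theorem exists_mem_notMem_of_ne [Finite X] {B C : Subgroup X} (h : Nat.card B = Nat.card C)
    (hne : B ≠ C) : ∃ a ∈ B, a ∉ C := by
  by_contra! hc
  exact hne (Subgroup.eq_of_le_of_card_ge hc h.ge)

theorem IsTransvection.cent_eq_or_center_eq [Finite X] {x y v w u : X}
    (hv : IsTransvection A x v) (hw : IsTransvection A y w) (hu : IsTransvection A (x * y) u) :
    cent A x = cent A y ∨ v = w := by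
  by_contra! ⟨hne, hvw⟩
  have hcard : Nat.card (cent A x) = Nat.card (cent A y) := by
    have := hv.half
    have := hw.half
    omega
  obtain ⟨b, hbx, hby⟩ := exists_mem_notMem_of_ne hcard hne
  obtain ⟨a, hay, hax⟩ := exists_mem_notMem_of_ne hcard.symm hne.symm
  have hb := cent_le A x hbx
  have ha := cent_le A y hay
  have huv : u = v := by
    have hconj : x * y * a * (x * y)⁻¹ = v * a :=
      calc x * y * a * (x * y)⁻¹ = x * (y * a * y⁻¹) * x⁻¹ := by group
        _ = v * a := by rw [conj_of_mem_cent hay, hv.conj a ha hax]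
    rcases hu.conj_or ha with hua | hua <;> rw [hconj] at hua
    · exact absurd (mul_eq_right.1 hua) hv.ne_one
    · exact (mul_right_cancel hua).symm
  have hxw : x * w * x⁻¹ = 1 ∨ x * w * x⁻¹ = v := by
    have hconj : x * y * b * (x * y)⁻¹ = x * w * x⁻¹ * b :=
      calc x * y * b * (x * y)⁻¹ = x * (y * b * y⁻¹) * x⁻¹ := by group
        _ = x * w * x⁻¹ * (x * b * x⁻¹) := by rw [hw.conj b hb hby]; group
        _ = x * w * x⁻¹ * b := by rw [conj_of_mem_cent hbx]
    rw [← huv]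
    exact (hu.conj_or hb).imp (fun hub => mul_eq_right.1 (hconj.symm.trans hub))
      fun hub => mul_right_cancel (hconj.symm.trans hub)
  rcases hv.conj_or hw.mem with hfix | hmul <;> rcases hxw with hone | hcenter
  · exact hw.ne_one (hfix.symm.trans hone)
  · exact hvw (hcenter.symm.trans hfix)
  · exact hvw (mul_left_cancel (hv.sq.trans (hone.symm.trans hmul)))
  · exact hw.ne_one (mul_eq_left.1 (hmul.symm.trans hcenter))

theorem Inverts.card_le_two_mul_cent (hA : Inverts t A) {x v : X} (hv : v ∈ A)
    (h : ∀ a ∈ A, x * a * x⁻¹ = a ∨ x * a * x⁻¹ = v * a) :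
    Nat.card A ≤ 2 * Nat.card (cent A x) := by
  rw [card_eq_relIndex_mul (cent_le A x)]
  refine Nat.mul_le_mul_right _ (Nat.le_of_dvd two_pos (Subgroup.relIndex_dvd_two_iff.2 ?_))
  by_cases hc : ∃ a ∈ A, x * a * x⁻¹ ≠ a
  · obtain ⟨a, ha, hax⟩ := hc
    refine ⟨a⁻¹, A.inv_mem ha, fun b hb => ?_⟩
    rcases h b hb with hfix | hmul
    · exact Or.inr (mem_cent_of_conj hb hfix)
    · have hba := A.mul_mem hb (A.inv_mem ha)
      refine Or.inl (mem_cent_of_conj hba ?_)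
      calc x * (b * a⁻¹) * x⁻¹ = x * b * x⁻¹ * (x * a * x⁻¹)⁻¹ := by group
        _ = v * (b * a⁻¹) * v⁻¹ := by rw [hmul, (h a ha).resolve_left hax]; group
        _ = b * a⁻¹ := by rw [hA.comm hv hba, mul_inv_cancel_right]
  · push Not at hc
    exact ⟨1, A.one_mem, fun b hb => Or.inr (mem_cent_of_conj hb (hc b hb))⟩

theorem MaxInverts.mul_mem_iff [Finite X] (h : MaxInverts t A)
    (hX : Nat.card X < 2 * numInvol X) (x y : X) :
    x * y ∈ A ↔ (x : X ⧸ A) = y := by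
  rw [← h.inv_mul_mem_iff hX, QuotientGroup.eq]

theorem MaxInverts.cent_congr [Finite X] (h : MaxInverts t A)
    (hX : Nat.card X < 2 * numInvol X) {x y : X} (hxy : x * y ∈ A) : cent A x = cent A y := by
  rw [← h.inv_mul_mem_iff hX] at hxy
  rw [← h.cent_mul_right hxy, mul_inv_cancel_left]

theorem MaxInverts.isTransvection_congr [Finite X] (h : MaxInverts t A)
    (hX : Nat.card X < 2 * numInvol X) {x y v : X} (hxy : x * y ∈ A)
    (hv : IsTransvection A x v) : IsTransvection A y v := by
  have hyx : y * x⁻¹ ∈ A := (h.normal hX).mem_comm ((h.inv_mul_mem_iff hX x y).2 hxy)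
  simpa using hv.mul_left h.toInverts hyx

theorem MaxInverts.same_axis_or_center [Finite X] (h : MaxInverts t A)
    (hX : Nat.card X < 2 * numInvol X)
    (hall : ∀ x ∉ A, 2 * Nat.card (cent A x) = Nat.card A) :
    (∀ x ∉ A, ∀ y ∉ A, cent A x = cent A y) ∨ ∃ v, ∀ x ∉ A, IsTransvection A x v := by
  by_cases hc : ∀ x ∉ A, ∀ y ∉ A, cent A x = cent A y
  · exact Or.inl hc
  push Not at hc
  obtain ⟨x, hx, y, hy, hxy⟩ := hc
  choose! v hv using fun x (hx : x ∉ A) => h.exists_isTransvection hX (hall x hx)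
  have axis_or_center : ∀ x ∉ A, ∀ y ∉ A, cent A x = cent A y ∨ v x = v y := by
    intro x hx y hy
    by_cases hxy : x * y ∈ A
    · exact Or.inl (h.cent_congr hX hxy)
    · exact (hv x hx).cent_eq_or_center_eq (hv y hy) (hv _ hxy)
  have hvxy := (axis_or_center x hx y hy).resolve_left hxy
  refine Or.inr ⟨v x, fun z hz => ?_⟩
  have hvz : v z = v x := by
    by_contra hvz
    have hzx := (axis_or_center z hz x hx).resolve_right hvz
    have hzy := (axis_or_center z hz y hy).resolve_right (hvxy ▸ hvz)
    exact hxy (hzx.symm.trans hzy)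
  exact hvz ▸ hv z hz

theorem MaxInverts.half_of_exceptional [Finite X] (h : MaxInverts t A)
    (hX : Nat.card X < 2 * numInvol X) {x u : X} (hx : x ∉ A)
    (hxc : 2 * Nat.card (cent A x) ≠ Nat.card A) (hu : u ∉ A) (hux : (u : X ⧸ A) ≠ x) :
    2 * Nat.card (cent A u) = Nat.card A :=
  (h.exceptional hX hx hu (fun hc => hux ((h.mul_mem_iff hX x u).1 hc).symm) hxc).2.1

theorem Inverts.card_le_two_mul_cent_of_center_eq (h : Inverts t A) [A.Normal]
    {x u v : X} (hu : IsTransvection A u v) (hxu : IsTransvection A (x * u) v) :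
    Nat.card A ≤ 2 * Nat.card (cent A x) := by
  refine h.card_le_two_mul_cent hu.mem fun a ha => ?_
  have hb : u⁻¹ * a * u ∈ A := by
    simpa using (inferInstance : A.Normal).conj_mem a ha u⁻¹
  have hxa : x * a * x⁻¹ = (x * u) * (u⁻¹ * a * u) * (x * u)⁻¹ := by group
  have hua : a = u * (u⁻¹ * a * u) * u⁻¹ := by group
  generalize u⁻¹ * a * u = b at hb hxa hua
  rw [hxa]
  rcases hu.conj_or hb with hub | hub <;> rcases hxu.conj_or hb with hxub | hxub <;>
    rw [hxub, hua, hub]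
  · exact Or.inl rfl
  · exact Or.inr rfl
  · exact Or.inr (by rw [← mul_assoc, hu.sq, one_mul])
  · exact Or.inl rfl

theorem MaxInverts.cent_ne_of_exceptional [Finite X] (h : MaxInverts t A)
    (hX : Nat.card X < 2 * numInvol X) [A.Normal] {x u v w : X} (hx : x ∉ A)
    (hxc : 2 * Nat.card (cent A x) ≠ Nat.card A) (hu : u ∉ A) (hux : (u : X ⧸ A) ≠ x)
    (hv : IsTransvection A u v) (hw : IsTransvection A (x * u) w) :
    cent A u ≠ cent A (x * u) ∧ v ≠ w := by
  have hxu : x * u ∉ A := fun hc => hux ((h.mul_mem_iff hX x u).1 hc).symm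
  have hfour := (h.exceptional hX hx hu hxu hxc).1
  have hpos : 0 < Nat.card A := Nat.card_pos
  constructor
  · intro hcent
    have hle : cent A u ≤ cent A x := by
      rw [← inf_idem (cent A u)]
      nth_rw 1 [hcent]
      rw [cent_mul_inf_cent]
      exact inf_le_left
    have := Subgroup.card_le_of_le hle
    have := hv.half
    omega
  · rintro rfl
    have := h.toInverts.card_le_two_mul_cent_of_center_eq hv hw
    omega

theorem IsTransvection.cent_mul_of_cent_eq [Finite X] {x y v u : X}
    (hv : IsTransvection A x v) (hu : IsTransvection A (x * y) u)
    (hxy : cent A x = cent A y) : cent A (x * y) = cent A x := by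
  refine (Subgroup.eq_of_le_of_card_ge ?_ ?_).symm
  · simpa only [← hxy, inf_idem] using cent_inf_le A x y
  · have := hv.half
    have := hu.half
    omega

theorem IsTransvection.center_mul_of_cent_eq [Finite X] {x y v w u : X}
    (hv : IsTransvection A x v) (hw : IsTransvection A y w) (hu : IsTransvection A (x * y) u)
    (hxy : cent A x = cent A y) : u = w * v := by
  obtain ⟨a, ha, hax⟩ := hv.exists_notMem_cent
  have haxy : a ∉ cent A (x * y) := by rwa [hv.cent_mul_of_cent_eq hu hxy]
  have hwx : x * w * x⁻¹ = w := conj_of_mem_cent (hxy ▸ hw.center_mem_cent)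
  refine mul_right_cancel (b := a) ?_
  calc u * a = x * y * a * (x * y)⁻¹ := (hu.conj a ha haxy).symm
    _ = x * (y * a * y⁻¹) * x⁻¹ := by group
    _ = x * w * x⁻¹ * (x * a * x⁻¹) := by rw [hw.conj a ha (hxy ▸ hax)]; group
    _ = w * v * a := by rw [hwx, hv.conj a ha hax, mul_assoc]

theorem IsTransvection.not_crossing [Finite X] {u u' y v v' w w' : X}
    (hu : IsTransvection A u v) (hu' : IsTransvection A u' v') (hy : IsTransvection A y v')
    (huy : IsTransvection A (u * y) w) (hu'uy : IsTransvection A (u' * (u * y)) w')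
    (hne : cent A u ≠ cent A u') (heq : cent A u = cent A y) : False := by
  have hw : w = v' * v := hu.center_mul_of_cent_eq hy huy heq
  rcases hu'.cent_eq_or_center_eq huy hu'uy with haxis | hcenter
  · exact hne ((haxis.trans (hu.cent_mul_of_cent_eq huy heq)).symm)
  · exact hu.ne_one (mul_eq_left.1 (hw.symm.trans hcenter.symm))

/- For a fourth coset `y A`, both `u, y` and `x u, y` share their axis or their center, while
`u, x u` share neither. So `y` has, say, the axis of `u` and the center of `x u`; then `u y` shares
neither with `x u`. -/
theorem MaxInverts.quotient_of_exceptional [Finite X] (h : MaxInverts t A)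
    (hX : Nat.card X < 2 * numInvol X) [A.Normal] {x u : X} (hx : x ∉ A)
    (hxc : 2 * Nat.card (cent A x) ≠ Nat.card A) (hu : u ∉ A) (hux : (u : X ⧸ A) ≠ x)
    (y : X ⧸ A) : y = 1 ∨ y = x ∨ y = u ∨ y = x * u := by
  by_contra! hc
  obtain ⟨y, rfl⟩ := QuotientGroup.mk_surjective y
  obtain ⟨hy_one, hyx, hyu, hyxu⟩ := hc
  have hsq := h.quotient_sq hX
  have hcomm := h.quotient_comm hX
  have hmul : ∀ a b c : X ⧸ A, a * b = c ↔ b = a * c := fun a b c =>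
    ⟨by rintro rfl; rw [← mul_assoc, hsq, one_mul], by rintro rfl; rw [← mul_assoc, hsq, one_mul]⟩
  have exists_center : ∀ z : X, z ∉ A → (z : X ⧸ A) ≠ x → ∃ v, IsTransvection A z v :=
    fun z hz hzx => h.exists_isTransvection hX (h.half_of_exceptional hX hx hxc hz hzx)
  have exists_center_mul : ∀ p q : X, (q : X ⧸ A) ≠ p → (q : X ⧸ A) ≠ p * x →
      ∃ v, IsTransvection A (p * q) v := fun p q hone hne =>
    exists_center _ (fun hmem => hone ((h.mul_mem_iff hX p q).1 hmem).symm)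
      fun heq => hne ((hmul _ _ _).1 heq)
  have hu_one : (u : X ⧸ A) ≠ 1 := (QuotientGroup.eq_one_iff u).not.2 hu
  have hxux : ((x * u : X) : X ⧸ A) * x = u := by
    rw [QuotientGroup.mk_mul, hcomm, ← mul_assoc, hsq, one_mul]
  obtain ⟨v, hv⟩ := exists_center u hu hux
  obtain ⟨v', hv'⟩ := exists_center_mul x u hux (by rwa [hsq])
  obtain ⟨w, hw⟩ := exists_center y ((QuotientGroup.eq_one_iff y).not.1 hy_one) hyx
  obtain ⟨w₁, hw₁⟩ := exists_center_mul u y hyu (by rwa [hcomm])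
  obtain ⟨w₂, hw₂⟩ := exists_center_mul (x * u) y hyxu (by rwa [hxux])
  obtain ⟨hne, hvne⟩ := h.cent_ne_of_exceptional hX hx hxc hu hux hv hv'
  rcases hv.cent_eq_or_center_eq hw hw₁ with haxis | rfl <;>
    rcases hv'.cent_eq_or_center_eq hw hw₂ with haxis' | rfl
  · exact hne (haxis.trans haxis'.symm)
  · obtain ⟨w₃, hw₃⟩ := exists_center_mul (x * u) (u * y)
      (by rw [QuotientGroup.mk_mul, QuotientGroup.mk_mul, hcomm x u]; simpa using hyx)
      (by rw [hxux]; simpa using hy_one)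
    exact hv.not_crossing hv' hw hw₁ hw₃ hne haxis
  · obtain ⟨w₃, hw₃⟩ := exists_center_mul u (x * u * y)
      (fun hc => hyx (by
        have hy : (y : X ⧸ A) = (x * u : X) * u := (hmul _ _ _).1 hc
        rw [hy, QuotientGroup.mk_mul, mul_assoc, hsq, mul_one]))
      (by rw [hcomm, QuotientGroup.mk_mul]; simpa using hy_one)
    exact hv'.not_crossing hv hw hw₂ hw₃ hne.symm haxis'
  · exact hvne rfl

end Transvections

section Cases

variable {X : Type*} [Group X] {t : X} {A : Subgroup X}

theorem MaxInverts.all_half_iff [Finite X] (h : MaxInverts t A)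
    (hX : Nat.card X < 2 * numInvol X) :
    (∀ x ∉ A, 2 * Nat.card (cent A x) = Nat.card A) ↔
      2 * numInvol X = Nat.card X + Nat.card A := by
  classical
  have : Fintype (X ⧸ A) := Fintype.ofFinite _
  have mk_ne_one : ∀ x : X, (x : X ⧸ A) ≠ (1 : X) ↔ x ∉ A := fun x => by
    rw [ne_eq, eq_comm, QuotientGroup.eq, inv_one, one_mul]
  have hsum := h.toInverts.sum_deficit
  calc (∀ x ∉ A, 2 * Nat.card (cent A x) = Nat.card A)
      ↔ ∀ c ∈ Finset.univ.erase ((1 : X) : X ⧸ A),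
          (Nat.card A : ℤ) - 2 * cosetCount t A c = 0 := by
        refine ⟨fun hx c hc => ?_, fun hc x hx => ?_⟩
        · obtain ⟨x, rfl⟩ := QuotientGroup.mk_surjective c
          have := hx x ((mk_ne_one x).1 (Finset.ne_of_mem_erase hc))
          rw [h.cosetCount_mk hX x]
          omega
        · have := hc x (Finset.mem_erase.2 ⟨(mk_ne_one x).2 hx, Finset.mem_univ _⟩)
          rw [h.cosetCount_mk hX x] at this
          omega
    _ ↔ ∑ c ∈ Finset.univ.erase ((1 : X) : X ⧸ A),
          ((Nat.card A : ℤ) - 2 * cosetCount t A c) = 0 := by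
        refine (Finset.sum_eq_zero_iff_of_nonneg fun c hc => ?_).symm
        have := h.two_mul_cosetCount_le (Finset.ne_of_mem_erase hc)
        omega
    _ ↔ 2 * numInvol X = Nat.card X + Nat.card A := by omega

/-- The subgroup `C_A(x)⟨x⟩`. If `A` is a maximal inverted subgroup on which `x` acts as a
transvection, it has the order of `A` and can take its place. -/
def exchangeWith (A : Subgroup X) (x : X) : Subgroup X :=
  Subgroup.closure ((cent A x : Set X) ∪ {x})

theorem cent_le_exchangeWith (A : Subgroup X) (x : X) : cent A x ≤ exchangeWith A x :=
  fun _ ha => Subgroup.subset_closure (Or.inl ha)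

theorem mem_exchangeWith (A : Subgroup X) (x : X) : x ∈ exchangeWith A x :=
  Subgroup.subset_closure (Or.inr rfl)

theorem Inverts.exchange {u : X} {x : X} (h : Inverts u (cent A x)) (hx : u * x * u = x⁻¹) :
    Inverts u (exchangeWith A x) :=
  h.closure_union (s := {x}) (by simpa using hx) (by simp)
    (fun b hb y hy => by rw [Set.mem_singleton_iff.1 hy]; exact (mem_cent.1 hb).2)

theorem MaxInverts.exchange_of_inverts [Finite X] (h : MaxInverts t A) {u x : X} (hxA : x ∉ A)
    (hc : 2 * Nat.card (cent A x) = Nat.card A) (hu : Inverts u (exchangeWith A x)) :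
    MaxInverts u (exchangeWith A x) ∧ Nat.card (exchangeWith A x) = Nat.card A := by
  have hle := two_mul_card_le_of_notMem (cent_le_exchangeWith A x) (mem_exchangeWith A x)
    fun hx => hxA (cent_le A x hx)
  have hcard : Nat.card (exchangeWith A x) = Nat.card A :=
    le_antisymm (h.max _ _ hu) (hc ▸ hle)
  exact ⟨⟨hu, fun v B hB => hcard ▸ h.max v B hB⟩, hcard⟩

theorem MaxInverts.exchange [Finite X] (h : MaxInverts t A) {x : X} (hx : t * x * t = x⁻¹)
    (hxA : x ∉ A) (hc : 2 * Nat.card (cent A x) = Nat.card A) :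
    MaxInverts t (exchangeWith A x) ∧ Nat.card (exchangeWith A x) = Nat.card A :=
  h.exchange_of_inverts hxA hc ((h.toInverts.mono (cent_le A x)).exchange hx)

theorem one_mul_mul_one_eq_inv_iff {x : X} : 1 * x * 1 = x⁻¹ ↔ x * x = 1 := by
  rw [one_mul, mul_one, mul_eq_one_iff_eq_inv]

theorem Inverts.mul_self_eq_one (h : Inverts 1 A) {a : X} (ha : a ∈ A) : a * a = 1 :=
  one_mul_mul_one_eq_inv_iff.1 (h.conj a ha)

theorem Inverts.one_of_commute (h : Inverts t A) (hc : ∀ a ∈ A, a * t = t * a) : Inverts 1 A :=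
  ⟨one_mul 1, fun a ha => by
    rw [one_mul, mul_one, ← h.conj a ha, ← hc a ha, mul_assoc, h.sq, mul_one]⟩

theorem MaxInverts.exists_maxInverts_one [Finite X] (h : MaxInverts t A)
    (ht : t ∉ A → 2 * Nat.card (cent A t) = Nat.card A) :
    ∃ B : Subgroup X, MaxInverts 1 B ∧ Nat.card B = Nat.card A := by
  by_cases htA : t ∈ A
  · exact ⟨A, ⟨h.toInverts.one_of_commute fun b hb => h.comm hb htA, h.max⟩, rfl⟩
  · have hone : Inverts 1 (cent A t) :=
      (h.toInverts.mono (cent_le A t)).one_of_commute fun b hb => (mem_cent.1 hb).2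
    exact ⟨_, h.exchange_of_inverts htA (ht htA)
      (hone.exchange (one_mul_mul_one_eq_inv_iff.2 h.sq))⟩

theorem exists_independent (hA : 2 * Nat.card A < Nat.card X) :
    ∃ x y, x ∉ A ∧ y ∉ A ∧ x * y ∉ A := by
  by_contra! hc
  have hdvd : A.index ∣ 2 := by
    rw [Subgroup.index_dvd_two_iff]
    by_cases hA : ∃ x, x ∉ A
    · obtain ⟨x, hx⟩ := hA
      exact ⟨x, fun b => or_iff_not_imp_right.2 fun hb => hc b x hb hx⟩
    · push Not at hA
      exact ⟨1, fun b => Or.inr (hA b)⟩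
  have hle := Nat.mul_le_mul_right (Nat.card A) (Nat.le_of_dvd two_pos hdvd)
  rw [A.index_mul_card] at hle
  omega

theorem MaxInverts.exists_independent_involutions [Finite X] (h : MaxInverts 1 A)
    (hX : Nat.card X < 2 * numInvol X) (hA : 2 * Nat.card A < Nat.card X) :
    ∃ x y, (x * x = 1 ∧ x ∉ A) ∧ (y * y = 1 ∧ y ∉ A) ∧ x * y ∉ A := by
  obtain ⟨x, y, hx, hy, hxy⟩ := exists_independent hA
  obtain ⟨a, ha, hxa⟩ := h.exists_mul_inverted hX x
  obtain ⟨b, hb, hyb⟩ := h.exists_mul_inverted hX y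
  refine ⟨x * a, y * b, ⟨one_mul_mul_one_eq_inv_iff.1 hxa, by rwa [A.mul_mem_cancel_right ha]⟩,
    ⟨one_mul_mul_one_eq_inv_iff.1 hyb, by rwa [A.mul_mem_cancel_right hb]⟩, fun hmem => hxy ?_⟩
  have hn := h.normal hX
  rw [← mul_assoc, A.mul_mem_cancel_right hb, hn.mem_comm_iff, ← mul_assoc,
    A.mul_mem_cancel_right ha, hn.mem_comm_iff] at hmem
  exact hmem

theorem MaxInverts.not_four_cosets [Finite X] (h : MaxInverts t A) {B : Subgroup X}
    (hcard : 2 * Nat.card B = Nat.card A) {u p q : X} (hu : Inverts u B)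
    (hp : u * p * u = p⁻¹) (hq : u * q * u = q⁻¹) (hpq : p * q = q * p)
    (hpB : ∀ b ∈ B, b * p = p * b) (hqB : ∀ b ∈ B, b * q = q * b)
    (hp_mem : p ∉ B) (hq_mem : q ∉ B) (hinv_mem : p⁻¹ * q ∉ B) (hmul_mem : p * q ∉ B) :
    False := by
  let M : Subgroup X := Subgroup.closure ((B : Set X) ∪ {p, q})
  have hpM : p ∈ M := Subgroup.subset_closure (by simp)
  have hqM : q ∈ M := Subgroup.subset_closure (by simp)
  have hle : Nat.card M ≤ Nat.card A :=
    h.max u _ (hu.closure_union (s := {p, q}) (by rintro x (rfl | rfl) <;> assumption)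
      (by rintro x (rfl | rfl) y (rfl | rfl) <;> simp only [hpq])
      (by rintro b hb x (rfl | rfl); exacts [hpB b hb, hqB b hb]))
  have hfour : 4 * Nat.card B ≤ Nat.card M := by
    refine mul_card_le_of_cosets_ne (fun b hb => Subgroup.subset_closure (Or.inl hb))
      ![1, p, q, p * q] (fun i => ?_) (fun i j hij => ?_)
    · fin_cases i
      exacts [M.one_mem, hpM, hqM, M.mul_mem hpM hqM]
    · fin_cases i <;> fin_cases j <;> first | exact absurd hij (by decide) | skip
      exacts [by simpa using hp_mem, by simpa using hq_mem, by simpa using hmul_mem, hinv_mem,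
        by simpa using hq_mem, by simpa [hpq] using hp_mem]
  have hpos : 0 < Nat.card B := Nat.card_pos
  omega

theorem Inverts.central_of_same_axis (h : Inverts t A)
    (hax : ∀ x ∉ A, ∀ y ∉ A, cent A x = cent A y) {x b : X} (hx : x ∉ A) (hb : b ∈ cent A x)
    (z : X) : b * z = z * b := by
  by_cases hz : z ∈ A
  · exact h.comm (cent_le A x hb) hz
  · rw [hax x hx z hz] at hb
    exact (mem_cent.1 hb).2

theorem mul_comm_of_involutions {x y a u : X} (hx : x * x = 1) (hy : y * y = 1) (ha : a * a = 1)
    (hxya : x * y * a * (x * y * a) = 1) (hu : u * u = 1) (hcen : ∀ z, u * z = z * u)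
    (hconj : x * y * a * (x * y)⁻¹ = u * a) : x * y * (y * a) = y * a * (x * y) := by
  have hrev : x * y * a = a * (y * x) := by
    rwa [mul_eq_one_iff_eq_inv, mul_inv_rev, mul_inv_rev, inv_eq_of_mul_eq_one_left ha,
      inv_eq_of_mul_eq_one_left hx, inv_eq_of_mul_eq_one_left hy] at hxya
  have hxya_eq : x * y * a = u * (a * (x * y)) := by
    rw [← mul_assoc u, ← hconj, inv_mul_cancel_right]
  have haxy : a * (x * y) = u * (x * y * a) := by rw [hxya_eq, ← mul_assoc u, hu, one_mul]
  have hyx : y * x = u * (x * y) := mul_left_cancel (a := a) (by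
    rw [← hrev, hxya_eq, ← mul_assoc, hcen, mul_assoc])
  calc x * y * (y * a) = u * (u * (x * y)) * (y * a) := by rw [← mul_assoc u, hu, one_mul]
    _ = y * (u * (x * y * a)) := by rw [← hyx, ← mul_assoc y, ← hcen]; simp only [mul_assoc]
    _ = y * a * (x * y) := by rw [← haxy, mul_assoc]

/- For `a ∈ A` with `(x y a)² = 1`, the involution `y` inverts `⟨C, x y, y a⟩`, where `C` is the
common axis. This subgroup contradicts maximality because `x y` and `y a` commute. -/
theorem MaxInverts.not_same_axis [Finite X] (h : MaxInverts 1 A)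
    (hX : Nat.card X < 2 * numInvol X) (hA : 2 * Nat.card A < Nat.card X)
    (hall : ∀ x ∉ A, 2 * Nat.card (cent A x) = Nat.card A) :
    ¬ ∀ x ∉ A, ∀ y ∉ A, cent A x = cent A y := by
  intro hax
  obtain ⟨x, y, ⟨hxx, hx⟩, ⟨hyy, hy⟩, hxy⟩ := h.exists_independent_involutions hX hA
  have hcent : ∀ b ∈ cent A x, ∀ z, b * z = z * b := fun b hb =>
    h.toInverts.central_of_same_axis hax hx hb
  have hnot : ∀ {z}, z ∉ A → z ∉ cent A x := fun hz hc => hz (cent_le A x hc)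
  have hxi := inv_eq_of_mul_eq_one_left hxx
  have hyi := inv_eq_of_mul_eq_one_left hyy
  obtain ⟨u, hu⟩ := h.exists_isTransvection hX (hall _ hxy)
  obtain ⟨a, ha, hxya⟩ := h.exists_mul_inverted hX (x * y)
  rw [one_mul_mul_one_eq_inv_iff] at hxya
  have haa := h.toInverts.mul_self_eq_one ha
  have hai := inv_eq_of_mul_eq_one_left haa
  have ha_cent : a ∉ cent A (x * y) := fun hc => by
    have hcomm : x * y = y * x := by
      rwa [mul_eq_one_iff_eq_inv, mul_inv_rev, mul_inv_rev, hai, hxi, hyi, ← (mem_cent.1 hc).2,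
        mul_right_inj] at hxya
    exact h.not_four_cosets (hall x hx) (h.toInverts.mono (cent_le A x))
      (one_mul_mul_one_eq_inv_iff.2 hxx) (one_mul_mul_one_eq_inv_iff.2 hyy) hcomm
      (fun b hb => hcent b hb x) (fun b hb => hcent b hb y) (hnot hx) (hnot hy)
      (by rw [hxi]; exact hnot hxy) (hnot hxy)
  refine h.not_four_cosets (u := y) (p := x * y) (q := y * a) (hall x hx)
    ⟨hyy, fun b hb => ?_⟩ ?_ ?_
    (mul_comm_of_involutions hxx hyy haa hxya hu.sq
      (hcent u (by rw [hax x hx _ hxy]; exact hu.center_mem_cent)) (hu.conj a ha ha_cent))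
    (fun b hb => hcent b hb _) (fun b hb => hcent b hb _)
    (hnot hxy) (hnot ?_) (hnot ?_) (hnot ?_)
  · rw [← hcent b hb y, mul_assoc, hyy, mul_one, eq_inv_iff_mul_eq_one]
    exact h.toInverts.mul_self_eq_one (cent_le A x hb)
  · rw [mul_inv_rev, hxi, hyi, mul_assoc, mul_assoc, hyy, mul_one]
  · rw [mul_inv_rev, hai, hyi, ← mul_assoc, hyy, one_mul]
  · rwa [A.mul_mem_cancel_right ha]
  · rwa [mul_inv_rev, hxi, hyi, ← mul_assoc, A.mul_mem_cancel_right ha,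
      (h.normal hX).mem_comm_iff, ← mul_assoc, hyy, one_mul]
  · rwa [mul_assoc, ← mul_assoc y, hyy, one_mul, A.mul_mem_cancel_right ha]

theorem MaxInverts.exists_common_center [Finite X] (h : MaxInverts 1 A)
    (hX : Nat.card X < 2 * numInvol X) (hA : 2 * Nat.card A < Nat.card X)
    (hall : ∀ x ∉ A, 2 * Nat.card (cent A x) = Nat.card A) :
    ∃ v, ∀ x ∉ A, IsTransvection A x v :=
  (h.same_axis_or_center hX hall).resolve_left (h.not_same_axis hX hA hall)

/-- The element `v` is a central involution. -/
structure IsCentralInvol (v : X) : Prop where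
  ne_one : v ≠ 1
  sq : v * v = 1
  central : ∀ z, v * z = z * v

/-- The element `v` is a central involution and the derived subgroup lies in `{1, v}`: conjugation
multiplies an element by `1` or `v`. Extraspecial `2`-groups are the typical examples. -/
structure IsExtraspecial (v : X) : Prop extends IsCentralInvol v where
  conj : ∀ g z : X, g * z * g⁻¹ = z ∨ g * z * g⁻¹ = v * z

theorem conj_mul_eq_or {v g s b : X} (hsq : v * v = 1) (hcen : ∀ z, v * z = z * v)
    (hs : g * s * g⁻¹ = s ∨ g * s * g⁻¹ = v * s) (hb : g * b * g⁻¹ = b ∨ g * b * g⁻¹ = v * b) :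
    g * (s * b) * g⁻¹ = s * b ∨ g * (s * b) * g⁻¹ = v * (s * b) := by
  rw [← conj_mul]
  rcases hs with hs | hs <;> rcases hb with hb | hb <;> rw [hs, hb]
  · exact Or.inl rfl
  · exact Or.inr (by rw [← mul_assoc, ← hcen, mul_assoc])
  · exact Or.inr (mul_assoc _ _ _)
  · exact Or.inl (by rw [hcen s, mul_assoc, ← mul_assoc v, hsq, one_mul])

theorem Inverts.conj_eq_or_of_mem (h : Inverts t A) {v : X}
    (hv : ∀ x ∉ A, IsTransvection A x v) (g : X) {a : X} (ha : a ∈ A) :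
    g * a * g⁻¹ = a ∨ g * a * g⁻¹ = v * a := by
  by_cases hg : g ∈ A
  · exact Or.inl (by rw [h.comm hg ha, mul_inv_cancel_right])
  · exact (hv g hg).conj_or ha

/- After exchanging `A` for `C_A(x)⟨x⟩` there is again a common center, and it is the same one
because both are the commutator of some `b ∈ C_A(x)` with some `y`. -/
theorem MaxInverts.conj_eq_or_of_mul_self_eq_one [Finite X] (h : MaxInverts 1 A)
    (hX : Nat.card X < 2 * numInvol X) (hA : 2 * Nat.card A < Nat.card X) {v : X}
    (hv : ∀ x ∉ A, IsTransvection A x v) (g : X) {x : X} (hxx : x * x = 1) :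
    g * x * g⁻¹ = x ∨ g * x * g⁻¹ = v * x := by
  by_cases hx : x ∈ A
  · exact h.toInverts.conj_eq_or_of_mem hv g hx
  have hall : ∀ x ∉ A, 2 * Nat.card (cent A x) = Nat.card A := fun x hx => (hv x hx).half
  obtain ⟨hE, hcard⟩ := h.exchange (one_mul_mul_one_eq_inv_iff.2 hxx) hx (hall x hx)
  obtain ⟨w, hw⟩ := hE.exists_common_center hX (by rwa [hcard])
    ((hE.all_half_iff hX).2 (by rw [hcard]; exact (h.all_half_iff hX).1 hall))
  obtain ⟨y, hy, hxy⟩ : ∃ y ∉ A, cent A x ≠ cent A y := by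
    by_contra! hc
    exact h.not_same_axis hX hA hall fun z hz y hy => (hc z hz).symm.trans (hc y hy)
  have hcard_cent : Nat.card (cent A x) = Nat.card (cent A y) :=
    Nat.eq_of_mul_eq_mul_left two_pos ((hall x hx).trans (hall y hy).symm)
  obtain ⟨b, hbx, hby⟩ := exists_mem_notMem_of_ne hcard_cent hxy
  have hbA := cent_le A x hbx
  have hbE := cent_le_exchangeWith A x hbx
  have hyE : y ∉ exchangeWith A x := fun hc => hby (mem_cent.2 ⟨hbA, hE.comm hbE hc⟩)
  have hbyE : b ∉ cent (exchangeWith A x) y := fun hc => hby (mem_cent.2 ⟨hbA, (mem_cent.1 hc).2⟩)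
  have hvw : v = w :=
    mul_right_cancel (((hv y hy).conj b hbA hby).symm.trans ((hw y hyE).conj b hbE hbyE))
  subst hvw
  exact hE.toInverts.conj_eq_or_of_mem hw g (mem_exchangeWith A x)

theorem MaxInverts.exists_isExtraspecial [Finite X] (h : MaxInverts 1 A)
    (hX : Nat.card X < 2 * numInvol X) (hA : 2 * Nat.card A < Nat.card X)
    (hall : ∀ x ∉ A, 2 * Nat.card (cent A x) = Nat.card A) :
    ∃ v : X, IsExtraspecial v := by
  obtain ⟨v, hv⟩ := h.exists_common_center hX hA hall
  obtain ⟨x, -, hx, -, -⟩ := exists_independent hA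
  have hcen : ∀ z, v * z = z * v := by
    intro z
    by_cases hz : z ∈ A
    · exact h.comm (hv x hx).mem hz
    · exact (mem_cent.1 (hv z hz).center_mem_cent).2
  refine ⟨v, ⟨(hv x hx).ne_one, (hv x hx).sq, hcen⟩, fun g z => ?_⟩
  obtain ⟨a, ha, hza⟩ := h.exists_mul_inverted hX z
  rw [← mul_inv_cancel_right z a]
  exact conj_mul_eq_or (hv x hx).sq hcen
    (h.conj_eq_or_of_mul_self_eq_one hX hA hv g (one_mul_mul_one_eq_inv_iff.1 hza))
    (h.toInverts.conj_eq_or_of_mem hv g (A.inv_mem ha))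

end Cases

/-! ### Dihedral pairs -/

section DihedralPairs

variable {X : Type*} [Group X]

/-- Two involutions whose commutator is the central involution `v`; they generate a dihedral group
of order `8` with center `⟨v⟩`. -/
structure DihedralPair (d e v : X) : Prop extends IsCentralInvol v where
  d_sq : d * d = 1
  e_sq : e * e = 1
  rel : e * d = v * (d * e)

/-- Pairs of involutions, each generating a dihedral group of order `8`, which commute with each
other and generate the group together with its elementary abelian center. -/
structure DihedralFamily {r : ℕ} (d e v : Fin r → X) : Prop where
  pair : ∀ i, DihedralPair (d i) (e i) (v i)
  comm : ∀ i j, i ≠ j → Commute (d i) (d j) ∧ Commute (d i) (e j) ∧ Commute (e i) (e j)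
  gen : ∀ H : Subgroup X, Subgroup.center X ≤ H → (∀ i, d i ∈ H ∧ e i ∈ H) → H = ⊤
  center_sq : ∀ z ∈ Subgroup.center X, z * z = 1

/-- The elements `1, a, y, y a`: representatives of `⟨a, y⟩` modulo its center when the commutator
of `a` and `y` is a central involution. -/
def pairProducts (a y : X) : Set X := {1, a, y, y * a}

theorem pairProducts_subset {a y : X} {H : Subgroup X} (ha : a ∈ H) (hy : y ∈ H) :
    pairProducts a y ⊆ H := by
  rintro w (rfl | rfl | rfl | rfl)
  exacts [H.one_mem, ha, hy, H.mul_mem hy ha]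

theorem commute_of_mem_pairProducts {a y g w : X} (hw : w ∈ pairProducts a y)
    (ha : Commute a g) (hy : Commute y g) : Commute w g :=
  Subgroup.mem_centralizer_singleton_iff.1 (pairProducts_subset
    (Subgroup.mem_centralizer_singleton_iff.2 ha) (Subgroup.mem_centralizer_singleton_iff.2 hy) hw)

theorem mul_mem_pairProducts {a y p q : X} (hp : p = 1 ∨ p = y) (hq : q = 1 ∨ q = a) :
    p * q ∈ pairProducts a y := by
  rcases hp with rfl | rfl <;> rcases hq with rfl | rfl <;> simp [pairProducts]

theorem commute_of_mem_iff {a y d e g : X}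
    (h : ∀ H : Subgroup X, d ∈ H ∧ e ∈ H ↔ a ∈ H ∧ y ∈ H) (ha : Commute a g) (hy : Commute y g) :
    Commute d g ∧ Commute e g :=
  (h (Subgroup.centralizer {g})).2 ⟨Subgroup.mem_centralizer_singleton_iff.2 ha,
    Subgroup.mem_centralizer_singleton_iff.2 hy⟩ |>.imp
      Subgroup.mem_centralizer_singleton_iff.1 Subgroup.mem_centralizer_singleton_iff.1

theorem rel_mul_right {p q q' c c' : X} (hc' : ∀ z, c' * z = z * c') (h : p * q = c * (q * p))
    (h' : p * q' = c' * (q' * p)) : p * (q * q') = c * c' * (q * q' * p) := by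
  calc p * (q * q') = c * (q * (p * q')) := by rw [← mul_assoc, h]; group
    _ = c * (c' * q * (q' * p)) := by rw [h', hc' q]; group
    _ = c * c' * (q * q' * p) := by group

theorem rel_mul_left {p p' q c c' : X} (hc' : ∀ z, c' * z = z * c') (h : p * q = c * (q * p))
    (h' : p' * q = c' * (q * p')) : p * p' * q = c * c' * (q * (p * p')) := by
  calc p * p' * q = c' * (p * q) * p' := by rw [mul_assoc, h', ← mul_assoc, ← hc' p]; group
    _ = c * c' * (q * (p * p')) := by rw [h, ← mul_assoc c', hc' c]; group

theorem mul_self_eq_of_conj_eq {g z v : X} (hv : v * v = 1) (hconj : g * z * g⁻¹ = v * z)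
    (hinv : g * z * g⁻¹ = z⁻¹) : z * z = v := by
  rw [hconj, eq_inv_iff_mul_eq_one, mul_assoc] at hinv
  exact mul_left_cancel (hinv.trans hv.symm)

/- The second alternative occurs exactly when `a` and `y` generate a quaternion group. -/
theorem exists_dihedralPair {a y v w : X} (hv : IsCentralInvol v) (hya : y * a = v * (a * y))
    (hw : w ∈ pairProducts a y) (hwa : w * a * w⁻¹ = a⁻¹) (hwy : w * y * w⁻¹ = y⁻¹) :
    (w * w = 1 ∧ ∃ d e : X, DihedralPair d e v ∧
      ∀ H : Subgroup X, d ∈ H ∧ e ∈ H ↔ a ∈ H ∧ y ∈ H) ∨ w * w = v := by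
  have hay : a * y = v * (y * a) := by rw [hya, ← mul_assoc, hv.sq, one_mul]
  have hconj_a : y * a * y⁻¹ = v * a := by rw [hya, ← mul_assoc, mul_inv_cancel_right]
  have hconj_y : a * y * a⁻¹ = v * y := by rw [hay, ← mul_assoc, mul_inv_cancel_right]
  have mul_self_mul : a * y * (a * y) = v * (a * a * (y * y)) := by
    calc a * y * (a * y) = a * (y * a) * y := by group
      _ = (a * v) * (a * y) * y := by rw [hya]; group
      _ = v * (a * a * (y * y)) := by rw [← hv.central]; group
  have sq_eq_one : ∀ {z : X}, z * z * z⁻¹ = z⁻¹ → z * z = 1 := fun {z} hz => by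
    rwa [mul_inv_cancel_right, ← mul_eq_one_iff_eq_inv] at hz
  rcases hw with rfl | rfl | rfl | rfl
  · simp only [one_mul, inv_one, mul_one] at hwa hwy
    exact Or.inl ⟨one_mul 1, a, y, ⟨hv, mul_eq_one_iff_eq_inv.2 hwa, mul_eq_one_iff_eq_inv.2 hwy,
      hya⟩, fun H => Iff.rfl⟩
  · have hww := sq_eq_one hwa
    have hyy := mul_self_eq_of_conj_eq hv.sq hconj_y hwy
    refine Or.inl ⟨hww, w, w * y, ⟨hv, hww, ?_, ?_⟩,
      fun H => and_congr_right fun hH => H.mul_mem_cancel_left hH⟩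
    · rw [mul_self_mul, hww, hyy, one_mul, hv.sq]
    · rw [mul_assoc, hya, ← mul_assoc, ← hv.central, mul_assoc]
  · have hww := sq_eq_one hwy
    have haa := mul_self_eq_of_conj_eq hv.sq hconj_a hwa
    refine Or.inl ⟨hww, a * w, w, ⟨hv, ?_, hww, ?_⟩,
      fun H => and_congr_left fun hH => H.mul_mem_cancel_right hH⟩
    · rw [mul_self_mul, hww, haa, mul_one, hv.sq]
    · rw [← mul_assoc, hya, mul_assoc]
  · have haa := mul_self_eq_of_conj_eq hv.sq (g := y * a) (z := a) (by rw [← hconj_a]; group) hwa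
    have hyy := mul_self_eq_of_conj_eq hv.sq (g := y * a) (z := y)
      (by rw [mul_assoc y a y, hay, hv.central y]; group) hwy
    refine Or.inr ?_
    calc y * a * (y * a) = v * (a * y) * (v * (a * y)) := by rw [hya]
      _ = v * v * (a * y * (a * y)) :=
        Commute.mul_mul_mul_comm (hv.central (a * y)).symm v (a * y)
      _ = v := by rw [hv.sq, one_mul, mul_self_mul, haa, hyy, hv.sq, mul_one]

theorem DihedralPair.family_two {d₁ e₁ v₁ d₂ e₂ v₂ : X} (h₁ : DihedralPair d₁ e₁ v₁)
    (h₂ : DihedralPair d₂ e₂ v₂) (hd : Commute d₁ d₂ ∧ Commute e₁ d₂)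
    (he : Commute d₁ e₂ ∧ Commute e₁ e₂)
    (hgen : ∀ H : Subgroup X, Subgroup.center X ≤ H → d₁ ∈ H ∧ e₁ ∈ H → d₂ ∈ H ∧ e₂ ∈ H → H = ⊤)
    (hcenter : ∀ z ∈ Subgroup.center X, z * z = 1) :
    DihedralFamily ![d₁, d₂] ![e₁, e₂] ![v₁, v₂] where
  pair := Fin.forall_fin_two.2 ⟨h₁, h₂⟩
  comm := Fin.forall_fin_two.2
    ⟨Fin.forall_fin_two.2 ⟨fun h => absurd rfl h, fun _ => ⟨hd.1, he.1, he.2⟩⟩,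
      Fin.forall_fin_two.2
        ⟨fun _ => ⟨hd.1.symm, hd.2.symm, he.2.symm⟩, fun h => absurd rfl h⟩⟩
  gen H hH hde :=
    hgen H hH (Fin.forall_fin_two.1 hde).1 (Fin.forall_fin_two.1 hde).2
  center_sq := hcenter

end DihedralPairs

section Exceptional

variable {X : Type*} [Group X] {t : X} {A : Subgroup X}

theorem MaxInverts.center_sq [Finite X] (h : MaxInverts t A)
    (hX : Nat.card X < 2 * numInvol X) {z : X} (hz : z ∈ Subgroup.center X) : z * z = 1 := by
  rw [Subgroup.mem_center_iff] at hz
  have hinv := h.conj z (h.mem_of_commute hX fun a _ => hz a)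
  rw [hz t, mul_assoc, h.sq, mul_one] at hinv
  exact mul_eq_one_iff_eq_inv.2 hinv

/-- The coordinates used when some coset of `A` acts on `A` exceptionally: inverted elements
`x₁, x₂ ∉ A` which generate `X` modulo `A` and act on `A` as transvections with distinct centers
`v₁, v₂`, and elements `a₁, a₂ ∈ A`, where `aᵢ` is moved by `xᵢ` but not by the other element. -/
structure ExceptionalData (t : X) (A : Subgroup X) (x₁ x₂ a₁ a₂ v₁ v₂ : X) : Prop where
  x₁_conj : t * x₁ * t = x₁⁻¹
  x₂_conj : t * x₂ * t = x₂⁻¹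
  x₁_notMem : x₁ ∉ A
  x₂_notMem : x₂ ∉ A
  tr₁ : IsTransvection A x₁ v₁
  tr₂ : IsTransvection A x₂ v₂
  ne : v₁ ≠ v₂
  a₁_mem : a₁ ∈ cent A x₂
  a₁_notMem : a₁ ∉ cent A x₁
  a₂_mem : a₂ ∈ cent A x₁
  a₂_notMem : a₂ ∉ cent A x₂
  gen : ∀ g : X, ∃ p₁ p₂ a, (p₁ = 1 ∨ p₁ = x₁) ∧ (p₂ = 1 ∨ p₂ = x₂) ∧ a ∈ A ∧ g = p₁ * p₂ * a

theorem MaxInverts.exists_exceptional_inverted [Finite X] (h : MaxInverts t A)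
    (hX : Nat.card X < 2 * numInvol X) (hA : 2 * Nat.card A < Nat.card X) [A.Normal] {x : X}
    (hx : x ∉ A) (hxc : 2 * Nat.card (cent A x) ≠ Nat.card A) :
    ∃ x u, (x ∉ A ∧ 2 * Nat.card (cent A x) ≠ Nat.card A) ∧ (u ∉ A ∧ (u : X ⧸ A) ≠ x) ∧
      t * u * t = u⁻¹ ∧ t * (x * u) * t = (x * u)⁻¹ := by
  obtain ⟨u₀, hu₀, hu₀x⟩ : ∃ u, u ∉ A ∧ (u : X ⧸ A) ≠ x := by
    obtain ⟨p, q, hp, hq, hpq⟩ := exists_independent hA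
    by_cases hpx : (p : X ⧸ A) = x
    · exact ⟨q, hq, fun hqx => hpq ((h.mul_mem_iff hX p q).2 (hpx.trans hqx.symm))⟩
    · exact ⟨p, hp, hpx⟩
  obtain ⟨a, ha, hua⟩ := h.exists_mul_inverted hX u₀
  obtain ⟨b, hb, hxub⟩ := h.exists_mul_inverted hX (x * (u₀ * a))
  have hc : u₀ * a * b * (u₀ * a)⁻¹ ∈ A := ‹A.Normal›.conj_mem b hb _
  refine ⟨x * (u₀ * a * b * (u₀ * a)⁻¹), u₀ * a,
    ⟨by rwa [A.mul_mem_cancel_right hc], by rwa [h.cent_mul_right hc]⟩,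
    ⟨by rwa [A.mul_mem_cancel_right ha], ?_⟩, hua, ?_⟩
  · rwa [QuotientGroup.mk_mul_of_mem _ ha, QuotientGroup.mk_mul_of_mem _ hc]
  · have hprod : x * (u₀ * a * b * (u₀ * a)⁻¹) * (u₀ * a) = x * (u₀ * a) * b := by group
    rwa [hprod]

theorem MaxInverts.exists_exceptionalData [Finite X] (h : MaxInverts t A)
    (hX : Nat.card X < 2 * numInvol X) (hA : 2 * Nat.card A < Nat.card X)
    (hex : ¬ ∀ x ∉ A, 2 * Nat.card (cent A x) = Nat.card A) :
    ∃ x₁ x₂ a₁ a₂ v₁ v₂, ExceptionalData t A x₁ x₂ a₁ a₂ v₁ v₂ := by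
  have hn := h.normal hX
  push Not at hex
  obtain ⟨x₀, hx₀, hx₀c⟩ := hex
  obtain ⟨x, u, ⟨hx, hxc⟩, ⟨hu, hux⟩, hu_inv, hxu_inv⟩ :=
    h.exists_exceptional_inverted hX hA hx₀ hx₀c
  have hxu : x * u ∉ A := fun hc => hux ((h.mul_mem_iff hX x u).1 hc).symm
  obtain ⟨-, hhalf₁, hhalf₂⟩ := h.exceptional hX hx hu hxu hxc
  obtain ⟨v₁, hv₁⟩ := h.exists_isTransvection hX hhalf₁
  obtain ⟨v₂, hv₂⟩ := h.exists_isTransvection hX hhalf₂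
  obtain ⟨hne, hvne⟩ := h.cent_ne_of_exceptional hX hx hxc hu hux hv₁ hv₂
  obtain ⟨a₂, ha₂, ha₂'⟩ := exists_mem_notMem_of_ne (by omega) hne
  obtain ⟨a₁, ha₁, ha₁'⟩ := exists_mem_notMem_of_ne (by omega) hne.symm
  refine ⟨u, x * u, a₁, a₂, v₁, v₂, hu_inv, hxu_inv, hu, hxu, hv₁, hv₂, hvne, ha₁, ha₁', ha₂, ha₂',
    fun g => ?_⟩
  have of_mk_eq : ∀ p : X, (g : X ⧸ A) = p → p⁻¹ * g ∈ A ∧ g = p * (p⁻¹ * g) := fun p hp =>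
    ⟨QuotientGroup.eq.1 hp.symm, (mul_inv_cancel_left p g).symm⟩
  rcases h.quotient_of_exceptional hX hx hxc hu hux g with hg | hg | hg | hg
  · exact ⟨1, 1, _, Or.inl rfl, Or.inl rfl, of_mk_eq (1 * 1) (by rw [hg, one_mul]; rfl)⟩
  · refine ⟨u, x * u, _, Or.inr rfl, Or.inr rfl, of_mk_eq _ ?_⟩
    rw [hg, QuotientGroup.mk_mul, QuotientGroup.mk_mul, h.quotient_comm hX (x : X ⧸ A),
      ← mul_assoc, h.quotient_sq hX, one_mul]
  · exact ⟨u, 1, _, Or.inr rfl, Or.inl rfl, of_mk_eq _ (by rw [hg, mul_one])⟩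
  · exact ⟨1, x * u, _, Or.inl rfl, Or.inr rfl, of_mk_eq _ (by rw [hg, one_mul]; rfl)⟩

theorem MaxInverts.conj_eq_or_of_exceptional [Finite X] (h : MaxInverts t A)
    (hX : Nat.card X < 2 * numInvol X) {z y v a x : X} (hz : z ∉ A)
    (hzc : 2 * Nat.card (cent A z) ≠ Nat.card A) (hyz : (y : X ⧸ A) ≠ z) (hv : v ≠ 1)
    (ha : a ∈ A) (hya : y * a * y⁻¹ = v * a) (hx : x ∈ A) :
    y * x * y⁻¹ = x ∨ y * x * y⁻¹ = v * x := by
  have hya_ne : y * a * y⁻¹ ≠ a := fun hc => hv (mul_eq_right.1 (hya.symm.trans hc))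
  have hy : y ∉ A := fun hc => hya_ne (by rw [h.comm hc ha, mul_inv_cancel_right])
  obtain ⟨w, hw⟩ := h.exists_isTransvection hX (h.half_of_exceptional hX hz hzc hy hyz)
  have hwv : w = v :=
    mul_right_cancel (((hw.conj_or ha).resolve_left hya_ne).symm.trans hya)
  exact hwv ▸ hw.conj_or hx

variable {x₁ x₂ a₁ a₂ v₁ v₂ : X}

theorem ExceptionalData.symm [Finite X] (h : MaxInverts t A) (hX : Nat.card X < 2 * numInvol X)
    (D : ExceptionalData t A x₁ x₂ a₁ a₂ v₁ v₂) : ExceptionalData t A x₂ x₁ a₂ a₁ v₂ v₁ := by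
  refine ⟨D.x₂_conj, D.x₁_conj, D.x₂_notMem, D.x₁_notMem, D.tr₂, D.tr₁, D.ne.symm, D.a₂_mem,
    D.a₂_notMem, D.a₁_mem, D.a₁_notMem, fun g => ?_⟩
  obtain ⟨p₁, p₂, a, hp₁, hp₂, ha, rfl⟩ := D.gen g
  exact ⟨p₂, p₁, p₁⁻¹ * p₂⁻¹ * p₁⁻¹⁻¹ * p₂⁻¹⁻¹ * a, hp₂, hp₁,
    A.mul_mem (h.commutator_mem hX p₁⁻¹ p₂⁻¹) ha, by group⟩

theorem ExceptionalData.mem_center (h : Inverts t A) (D : ExceptionalData t A x₁ x₂ a₁ a₂ v₁ v₂)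
    {z : X} (h₁ : z ∈ cent A x₁) (h₂ : z ∈ cent A x₂) : z ∈ Subgroup.center X := by
  refine Subgroup.mem_center_iff.2 fun g => Eq.symm ?_
  obtain ⟨p₁, p₂, a, hp₁, hp₂, ha, rfl⟩ := D.gen g
  have commute_of_eq_or : ∀ {p x : X}, (p = 1 ∨ p = x) → z ∈ cent A x → Commute z p := by
    rintro p x (rfl | rfl) hz
    exacts [Commute.one_right z, (mem_cent.1 hz).2]
  exact ((commute_of_eq_or hp₁ h₁).mul_right (commute_of_eq_or hp₂ h₂)).mul_right
    (h.comm (cent_le _ _ h₁) ha)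

/- The center `v₁` is the commutator of `x₁` and `a₁`, and `x₂` fixes `a₁` and commutes with `x₁`
modulo the abelian group `A`. -/
theorem ExceptionalData.v₁_mem [Finite X] (h : MaxInverts t A) (hX : Nat.card X < 2 * numInvol X)
    (D : ExceptionalData t A x₁ x₂ a₁ a₂ v₁ v₂) : v₁ ∈ cent A x₂ := by
  refine mem_cent_of_conj D.tr₁.mem ?_
  have ha₁ := cent_le _ _ D.a₁_mem
  have hv₁ : v₁ = x₁ * a₁ * x₁⁻¹ * a₁⁻¹ := by
    rw [D.tr₁.conj a₁ ha₁ D.a₁_notMem, mul_inv_cancel_right]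
  have hcomm := h.comm (h.commutator_mem hX x₂ x₁) ((h.normal hX).conj_mem a₁ ha₁ x₁)
  calc x₂ * v₁ * x₂⁻¹
      = (x₂ * x₁ * x₂⁻¹ * x₁⁻¹) * (x₁ * (x₂ * a₁ * x₂⁻¹) * x₁⁻¹) *
          (x₂ * x₁ * x₂⁻¹ * x₁⁻¹)⁻¹ * (x₂ * a₁ * x₂⁻¹)⁻¹ := by rw [hv₁]; group
    _ = v₁ := by rw [conj_of_mem_cent D.a₁_mem, hcomm, mul_inv_cancel_right, hv₁]

theorem ExceptionalData.isCentralInvol [Finite X] (h : MaxInverts t A)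
    (hX : Nat.card X < 2 * numInvol X) (D : ExceptionalData t A x₁ x₂ a₁ a₂ v₁ v₂) :
    IsCentralInvol v₁ where
  ne_one := D.tr₁.ne_one
  sq := D.tr₁.sq
  central z := (Subgroup.mem_center_iff.1
    (D.mem_center h.toInverts D.tr₁.center_mem_cent (D.v₁_mem h hX)) z).symm

theorem ExceptionalData.rel (D : ExceptionalData t A x₁ x₂ a₁ a₂ v₁ v₂) :
    x₁ * a₁ = v₁ * (a₁ * x₁) := by
  rw [← mul_assoc, ← D.tr₁.conj a₁ (cent_le _ _ D.a₁_mem) D.a₁_notMem, inv_mul_cancel_right]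

theorem ExceptionalData.inv_rel [Finite X] (h : MaxInverts t A)
    (hX : Nat.card X < 2 * numInvol X) (D : ExceptionalData t A x₁ x₂ a₁ a₂ v₁ v₂) :
    a₁⁻¹ * x₁ = v₁ * (x₁ * a₁⁻¹) := by
  have hv₁ := (D.isCentralInvol h hX).central
  rw [inv_mul_eq_iff_eq_mul, ← mul_assoc, ← hv₁, mul_assoc, ← mul_assoc a₁, ← mul_assoc v₁, ← D.rel,
    mul_inv_cancel_right]

/- After exchanging `A` for `E = C_A(x₁)⟨x₁⟩` there is still an exceptional coset of `E`. It differs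
from the coset of `x₂` or from that of `a₁ x₂`, and such an element acts on `E ∋ x₁` as a
transvection with center `v₂`. -/
theorem ExceptionalData.commutator [Finite X] (h : MaxInverts t A)
    (hX : Nat.card X < 2 * numInvol X)
    (hex : ¬ ∀ x ∉ A, 2 * Nat.card (cent A x) = Nat.card A)
    (D : ExceptionalData t A x₁ x₂ a₁ a₂ v₁ v₂) :
    ∃ c₁ c₂, (c₁ = 1 ∨ c₁ = v₁) ∧ (c₂ = 1 ∨ c₂ = v₂) ∧ x₂ * x₁ = c₁ * c₂ * (x₁ * x₂) := by
  obtain ⟨hE, hcard⟩ := h.exchange D.x₁_conj D.x₁_notMem D.tr₁.half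
  have hex' := mt (hE.all_half_iff hX).1 (by rw [hcard]; exact mt (h.all_half_iff hX).2 hex)
  push Not at hex'
  obtain ⟨z, hz, hzc⟩ := hex'
  have hn := hE.normal hX
  have hv₂ := (D.symm h hX).isCentralInvol h hX
  have ha₁ := cent_le _ _ D.a₁_mem
  have ha₂ := cent_le _ _ D.a₂_mem
  have rel_of_ne : ∀ {y : X}, y * a₂ * y⁻¹ = v₂ * a₂ → (y : X ⧸ exchangeWith A x₁) ≠ z →
      ∃ c, (c = 1 ∨ c = v₂) ∧ y * x₁ = c * (x₁ * y) := fun {y} hya hyz => by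
    rcases hE.conj_eq_or_of_exceptional hX hz hzc hyz hv₂.ne_one
      (cent_le_exchangeWith A x₁ D.a₂_mem) hya (mem_exchangeWith A x₁) with hconj | hconj
    · exact ⟨1, Or.inl rfl, by rw [one_mul, ← mul_inv_eq_iff_eq_mul, hconj]⟩
    · exact ⟨v₂, Or.inr rfl, by rw [← mul_assoc, ← mul_inv_eq_iff_eq_mul, hconj]⟩
  have hx₂a₂ := D.tr₂.conj a₂ ha₂ D.a₂_notMem
  by_cases hxz : (x₂ : X ⧸ exchangeWith A x₁) = z
  · have ha₁E : a₁ ∉ exchangeWith A x₁ := fun hc =>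
      D.a₁_notMem (mem_cent.2 ⟨ha₁, hE.comm hc (mem_exchangeWith A x₁)⟩)
    have hne : ((a₁ * x₂ : X) : X ⧸ exchangeWith A x₁) ≠ z := by
      rw [← hxz, QuotientGroup.mk_mul, ne_eq, mul_eq_right]
      exact fun hc => ha₁E ((QuotientGroup.eq_one_iff a₁).1 hc)
    have hconj : a₁ * x₂ * a₂ * (a₁ * x₂)⁻¹ = v₂ * a₂ := by
      calc a₁ * x₂ * a₂ * (a₁ * x₂)⁻¹ = a₁ * (x₂ * a₂ * x₂⁻¹) * a₁⁻¹ := by group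
        _ = v₂ * (a₁ * a₂) * a₁⁻¹ := by rw [hx₂a₂, ← mul_assoc, ← hv₂.central, mul_assoc v₂]
        _ = v₂ * a₂ := by rw [h.comm ha₁ ha₂]; group
    obtain ⟨c, hc, hrel⟩ := rel_of_ne hconj hne
    have hc_comm : ∀ z, c * z = z * c := by
      rcases hc with rfl | rfl
      exacts [fun z => by rw [one_mul, mul_one], hv₂.central]
    have hmul := rel_mul_left hc_comm (D.inv_rel h hX) hrel
    rw [inv_mul_cancel_left] at hmul
    exact ⟨v₁, c, Or.inr rfl, hc, hmul⟩
  · obtain ⟨c, hc, hrel⟩ := rel_of_ne hx₂a₂ hxz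
    exact ⟨1, c, Or.inl rfl, hc, by rwa [one_mul]⟩

theorem ExceptionalData.mul_right [Finite X] (h : MaxInverts t A)
    (hX : Nat.card X < 2 * numInvol X) (D : ExceptionalData t A x₁ x₂ a₁ a₂ v₁ v₂) {b : X}
    (hb : b ∈ cent A x₁) : ExceptionalData t A (x₁ * b) x₂ a₁ a₂ v₁ v₂ := by
  have hn := h.normal hX
  have hbA := cent_le _ _ hb
  refine ⟨(h.conj_mul_eq_inv_iff D.x₁_conj hbA).2 hb, D.x₂_conj,
    fun hc => D.x₁_notMem ((A.mul_mem_cancel_right hbA).1 hc), D.x₂_notMem,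
    h.isTransvection_congr hX ?_ D.tr₁, D.tr₂, D.ne, D.a₁_mem, ?_, ?_, D.a₂_notMem, fun g => ?_⟩
  · rw [← mul_assoc]
    exact A.mul_mem (h.mul_self_mem hX x₁) hbA
  · rw [h.cent_mul_right hbA]; exact D.a₁_notMem
  · rw [h.cent_mul_right hbA]; exact D.a₂_mem
  · obtain ⟨p₁, p₂, a, rfl | rfl, hp₂, ha, rfl⟩ := D.gen g
    · exact ⟨1, p₂, a, Or.inl rfl, hp₂, ha, rfl⟩
    · exact ⟨p₁ * b, p₂, p₂⁻¹ * b⁻¹ * p₂⁻¹⁻¹ * a, Or.inr rfl, hp₂,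
        A.mul_mem (hn.conj_mem _ (A.inv_mem hbA) _) ha, by group⟩

theorem ExceptionalData.exists_commuting [Finite X] (h : MaxInverts t A)
    (hX : Nat.card X < 2 * numInvol X)
    (hex : ¬ ∀ x ∉ A, 2 * Nat.card (cent A x) = Nat.card A)
    (D : ExceptionalData t A x₁ x₂ a₁ a₂ v₁ v₂) :
    ∃ y₁ y₂, ExceptionalData t A y₁ y₂ a₁ a₂ v₁ v₂ ∧ Commute y₁ y₂ := by
  have hv₁ := D.isCentralInvol h hX
  have hv₂ := (D.symm h hX).isCentralInvol h hX
  obtain ⟨c₁, c₂, hc₁, hc₂, hrel⟩ := D.commutator h hX hex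
  obtain ⟨y₁, D', hrel'⟩ : ∃ y₁, ExceptionalData t A y₁ x₂ a₁ a₂ v₁ v₂ ∧
      x₂ * y₁ = c₁ * (y₁ * x₂) := by
    rcases hc₂ with rfl | rfl
    · exact ⟨x₁, D, by rwa [mul_one] at hrel⟩
    · refine ⟨x₁ * a₂, D.mul_right h hX D.a₂_mem, ?_⟩
      rw [rel_mul_right hv₂.central hrel (D.symm h hX).rel, mul_assoc c₁, hv₂.sq, mul_one]
  rcases hc₁ with rfl | rfl
  · exact ⟨y₁, x₂, D', by rw [commute_iff_eq, hrel', one_mul]⟩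
  · refine ⟨y₁, x₂ * a₁, ((D'.symm h hX).mul_right h hX D'.a₁_mem).symm h hX, Eq.symm ?_⟩
    have ha₁ : a₁ * y₁ = c₁ * (y₁ * a₁) := by rw [D'.rel, ← mul_assoc, hv₁.sq, one_mul]
    rw [rel_mul_left hv₁.central hrel' ha₁, hv₁.sq, one_mul]

theorem ExceptionalData.exists_eq_mul_mul_of_mem [Finite X]
    (D : ExceptionalData t A x₁ x₂ a₁ a₂ v₁ v₂) {a : X} (ha : a ∈ A) :
    ∃ q₁ q₂ z, (q₁ = 1 ∨ q₁ = a₁) ∧ (q₂ = 1 ∨ q₂ = a₂) ∧ (z ∈ cent A x₁ ∧ z ∈ cent A x₂) ∧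
      a = q₁ * q₂ * z := by
  have exists_cosetRep : ∀ {x v b c : X}, IsTransvection A x v → b ∈ A → b ∉ cent A x → c ∈ A →
      ∃ q, (q = 1 ∨ q = b) ∧ q⁻¹ * c ∈ cent A x := fun {x v b c} hx hb hbx hc => by
    by_cases hcx : c ∈ cent A x
    · exact ⟨1, Or.inl rfl, by simpa using hcx⟩
    · have hhalf := hx.half
      have hpos : 0 < Nat.card A := Nat.card_pos
      exact ⟨b, Or.inr rfl, mul_mem_of_card_lt (cent_le A x) (by omega) (A.inv_mem hb) hc
        (inv_mem_iff.not.2 hbx) hcx⟩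
  obtain ⟨q₁, hq₁, hmem₁⟩ := exists_cosetRep D.tr₁ (cent_le _ _ D.a₁_mem) D.a₁_notMem ha
  obtain ⟨q₂, hq₂, hmem₂⟩ :=
    exists_cosetRep D.tr₂ (cent_le _ _ D.a₂_mem) D.a₂_notMem (cent_le _ _ hmem₁)
  have hq₂_mem : q₂ ∈ cent A x₁ := by
    rcases hq₂ with rfl | rfl
    exacts [one_mem _, D.a₂_mem]
  exact ⟨q₁, q₂, q₂⁻¹ * (q₁⁻¹ * a), hq₁, hq₂,
    ⟨Subgroup.mul_mem _ (Subgroup.inv_mem _ hq₂_mem) hmem₁, hmem₂⟩, by group⟩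

theorem ExceptionalData.exists_eq_mul_mul [Finite X] (h : Inverts t A)
    (D : ExceptionalData t A x₁ x₂ a₁ a₂ v₁ v₂) (g : X) :
    ∃ w₁ ∈ pairProducts a₁ x₁, ∃ w₂ ∈ pairProducts a₂ x₂, ∃ z ∈ Subgroup.center X,
      g = w₁ * w₂ * z := by
  obtain ⟨p₁, p₂, a, hp₁, hp₂, ha, rfl⟩ := D.gen g
  obtain ⟨q₁, q₂, z, hq₁, hq₂, hz, rfl⟩ := D.exists_eq_mul_mul_of_mem ha
  have hcomm : p₂ * q₁ = q₁ * p₂ := by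
    rcases hp₂ with rfl | rfl <;> rcases hq₁ with rfl | rfl <;>
      simp [(mem_cent.1 D.a₁_mem).2]
  refine ⟨p₁ * q₁, mul_mem_pairProducts hp₁ hq₁, p₂ * q₂, mul_mem_pairProducts hp₂ hq₂, z,
    D.mem_center h hz.1 hz.2, ?_⟩
  calc p₁ * p₂ * (q₁ * q₂ * z) = p₁ * (p₂ * q₁) * q₂ * z := by group
    _ = p₁ * q₁ * (p₂ * q₂) * z := by rw [hcomm]; group

theorem conj_mul_mul_of_commute {p q z g : X} (hz : z ∈ Subgroup.center X) (hg : Commute q g) :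
    p * q * z * g * (p * q * z)⁻¹ = p * g * p⁻¹ := by
  calc p * q * z * g * (p * q * z)⁻¹ = p * q * (z * g) * z⁻¹ * q⁻¹ * p⁻¹ := by group
    _ = p * (q * g) * q⁻¹ * p⁻¹ := by rw [← Subgroup.mem_center_iff.1 hz g]; group
    _ = p * g * p⁻¹ := by rw [hg.eq]; group

/- Write `t = w₁ w₂ z` with `wᵢ ∈ ⟨aᵢ, xᵢ⟩` and `z` central, so that `wᵢ` inverts `aᵢ` and `xᵢ`. As
`w₁² w₂² = t² = 1` and `v₁ ≠ v₂`, neither `wᵢ² = vᵢ` is possible. -/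
theorem ExceptionalData.exists_dihedralPairs [Finite X] (h : MaxInverts t A)
    (hX : Nat.card X < 2 * numInvol X) (D : ExceptionalData t A x₁ x₂ a₁ a₂ v₁ v₂)
    (hx : Commute x₁ x₂) :
    (∃ d e, DihedralPair d e v₁ ∧ ∀ H : Subgroup X, d ∈ H ∧ e ∈ H ↔ a₁ ∈ H ∧ x₁ ∈ H) ∧
      ∃ d e, DihedralPair d e v₂ ∧ ∀ H : Subgroup X, d ∈ H ∧ e ∈ H ↔ a₂ ∈ H ∧ x₂ ∈ H := by
  have ha₁ := cent_le _ _ D.a₁_mem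
  have ha₂ := cent_le _ _ D.a₂_mem
  have ha : Commute a₁ a₂ := h.comm ha₁ ha₂
  have ha₁x₂ : Commute a₁ x₂ := (mem_cent.1 D.a₁_mem).2
  have ha₂x₁ : Commute a₂ x₁ := (mem_cent.1 D.a₂_mem).2
  obtain ⟨w₁, hw₁, w₂, hw₂, z, hz, ht⟩ := D.exists_eq_mul_mul h.toInverts t
  have hw₂a₁ : Commute w₂ a₁ := commute_of_mem_pairProducts hw₂ ha.symm ha₁x₂.symm
  have hw₂x₁ : Commute w₂ x₁ := commute_of_mem_pairProducts hw₂ ha₂x₁ hx.symm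
  have hw : Commute w₁ w₂ := commute_of_mem_pairProducts hw₁ hw₂a₁.symm hw₂x₁.symm
  have conj_w₁ : ∀ {g}, Commute w₂ g → t * g * t = g⁻¹ → w₁ * g * w₁⁻¹ = g⁻¹ := fun hg hinv => by
    rw [← conj_mul_mul_of_commute (p := w₁) hz hg, ← ht, h.inv_eq, hinv]
  have conj_w₂ : ∀ {g}, Commute w₁ g → t * g * t = g⁻¹ → w₂ * g * w₂⁻¹ = g⁻¹ := fun hg hinv => by
    rw [← conj_mul_mul_of_commute (p := w₂) hz hg, ← hw.eq, ← ht, h.inv_eq, hinv]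
  have pair₁ := exists_dihedralPair (D.isCentralInvol h hX) D.rel hw₁
    (conj_w₁ hw₂a₁ (h.conj _ ha₁)) (conj_w₁ hw₂x₁ D.x₁_conj)
  have pair₂ := exists_dihedralPair ((D.symm h hX).isCentralInvol h hX) (D.symm h hX).rel hw₂
    (conj_w₂ (commute_of_mem_pairProducts hw₁ ha ha₂x₁.symm) (h.conj _ ha₂))
    (conj_w₂ (commute_of_mem_pairProducts hw₁ ha₁x₂ hx) D.x₂_conj)
  have hsq : w₁ * w₁ * (w₂ * w₂) = 1 := by
    have hz_comm : Commute (w₁ * w₂) z := Subgroup.mem_center_iff.1 hz _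
    calc w₁ * w₁ * (w₂ * w₂) = w₁ * w₂ * (w₁ * w₂) * (z * z) := by
          rw [hw.mul_mul_mul_comm, h.center_sq hX hz, mul_one]
      _ = 1 := by rw [hz_comm.mul_mul_mul_comm, ← ht, h.sq]
  rcases pair₁ with ⟨hw₁_sq, pair₁⟩ | hw₁_sq <;> rcases pair₂ with ⟨hw₂_sq, pair₂⟩ | hw₂_sq <;>
    rw [hw₁_sq, hw₂_sq] at hsq
  · exact ⟨pair₁, pair₂⟩
  · exact absurd (by simpa using hsq) D.tr₂.ne_one
  · exact absurd (by simpa using hsq) D.tr₁.ne_one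
  · exact absurd (mul_left_cancel (D.tr₁.sq.trans hsq.symm)) D.ne

theorem ExceptionalData.exists_family [Finite X] (h : MaxInverts t A)
    (hX : Nat.card X < 2 * numInvol X) (D : ExceptionalData t A x₁ x₂ a₁ a₂ v₁ v₂)
    (hx : Commute x₁ x₂) :
    ∃ d e v : Fin 2 → X, DihedralFamily d e v ∧ v 0 ≠ v 1 := by
  have ha : Commute a₁ a₂ := h.comm (cent_le _ _ D.a₁_mem) (cent_le _ _ D.a₂_mem)
  have ha₁x₂ : Commute a₁ x₂ := (mem_cent.1 D.a₁_mem).2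
  have ha₂x₁ : Commute a₂ x₁ := (mem_cent.1 D.a₂_mem).2
  obtain ⟨⟨d₁, e₁, hpair₁, hmem₁⟩, d₂, e₂, hpair₂, hmem₂⟩ := D.exists_dihedralPairs h hX hx
  have ha₂_comm := commute_of_mem_iff hmem₁ ha ha₂x₁.symm
  have hx₂_comm := commute_of_mem_iff hmem₁ ha₁x₂ hx
  have hd₁_comm := commute_of_mem_iff hmem₂ ha₂_comm.1.symm hx₂_comm.1.symm
  have he₁_comm := commute_of_mem_iff hmem₂ ha₂_comm.2.symm hx₂_comm.2.symm
  refine ⟨_, _, _, hpair₁.family_two hpair₂ ⟨hd₁_comm.1.symm, he₁_comm.1.symm⟩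
    ⟨hd₁_comm.2.symm, he₁_comm.2.symm⟩ (fun H hH hde₁ hde₂ => ?_) fun z => h.center_sq hX, D.ne⟩
  obtain ⟨ha₁H, hx₁H⟩ := (hmem₁ H).1 hde₁
  obtain ⟨ha₂H, hx₂H⟩ := (hmem₂ H).1 hde₂
  refine (Subgroup.eq_top_iff' H).2 fun g => ?_
  obtain ⟨w₁, hw₁, w₂, hw₂, z, hz, rfl⟩ := D.exists_eq_mul_mul h.toInverts g
  exact H.mul_mem (H.mul_mem (pairProducts_subset ha₁H hx₁H hw₁)
    (pairProducts_subset ha₂H hx₂H hw₂)) (hH hz)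

end Exceptional

section CentralProduct

variable {X : Type*} [Group X] {A K : Subgroup X} {a x v : X}

theorem IsExtraspecial.rel (hv : IsExtraspecial v) {g z : X} (h : ¬ Commute g z) :
    g * z = v * (z * g) := by
  rcases hv.conj g z with hconj | hconj
  · exact absurd (mul_inv_eq_iff_eq_mul.1 hconj) h
  · rw [mul_inv_eq_iff_eq_mul.1 hconj, mul_assoc]

theorem IsExtraspecial.commute_mul (hv : IsExtraspecial v) {g z₁ z₂ : X} (h₁ : ¬ Commute g z₁)
    (h₂ : ¬ Commute g z₂) : Commute g (z₁ * z₂) := by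
  have hrel := rel_mul_right hv.central (hv.rel h₁) (hv.rel h₂)
  rwa [hv.sq, one_mul] at hrel

/-- Relative version of `DihedralFamily` for a subgroup `K` and dihedral pairs with a common
center, suited to induction on `K`. -/
structure DihedralFamilyIn (K : Subgroup X) (v : X) {r : ℕ} (d e : Fin r → X) : Prop where
  mem : ∀ i, d i ∈ K ∧ e i ∈ K
  pair : ∀ i, DihedralPair (d i) (e i) v
  comm : ∀ i j, i ≠ j → Commute (d i) (d j) ∧ Commute (d i) (e j) ∧ Commute (e i) (e j)
  gen : ∀ H : Subgroup X, (∀ z ∈ K, (∀ k ∈ K, Commute z k) → z ∈ H) →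
    (∀ i, d i ∈ H ∧ e i ∈ H) → K ≤ H

/-- Every coset of `A` meeting `K` contains an involution of `K` or the identity, and `A ∩ K` is its
own centralizer in `K`. This is what remains of maximality when `A` is intersected with smaller and
smaller subgroups `K`. -/
structure InvolutoryCosets (A K : Subgroup X) : Prop where
  exists_mul_self : ∀ y ∈ K, ∃ b ∈ A ⊓ K, y * b * (y * b) = 1
  mem_of_commute : ∀ y ∈ K, (∀ b ∈ A ⊓ K, Commute b y) → y ∈ A

theorem MaxInverts.involutoryCosets_top [Finite X] (hA : MaxInverts 1 A)
    (hX : Nat.card X < 2 * numInvol X) : InvolutoryCosets A ⊤ where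
  exists_mul_self y _ := by
    obtain ⟨b, hb, hyb⟩ := hA.exists_mul_inverted hX y
    exact ⟨b, ⟨hb, Subgroup.mem_top b⟩, one_mul_mul_one_eq_inv_iff.1 hyb⟩
  mem_of_commute _ _ h := hA.mem_of_commute hX fun b hb => h b ⟨hb, Subgroup.mem_top b⟩

/-- The centralizer of a pair of elements in a subgroup. -/
def pairCentralizer (K : Subgroup X) (a x : X) : Subgroup X :=
  K ⊓ (Subgroup.centralizer {a} ⊓ Subgroup.centralizer {x})

theorem mem_pairCentralizer {z : X} :
    z ∈ pairCentralizer K a x ↔ z ∈ K ∧ Commute z a ∧ Commute z x := by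
  simp only [pairCentralizer, Subgroup.mem_inf, Subgroup.mem_centralizer_singleton_iff,
    commute_iff_eq]

theorem pairCentralizer_le : pairCentralizer K a x ≤ K :=
  inf_le_left

theorem card_pairCentralizer_lt [Finite X] (ha : a ∈ K) (hax : ¬ Commute a x) :
    Nat.card (pairCentralizer K a x) < Nat.card K := by
  refine lt_of_le_of_ne (Subgroup.card_le_of_le pairCentralizer_le) fun hcard => ?_
  rw [← Subgroup.eq_of_le_of_card_ge pairCentralizer_le hcard.ge] at ha
  exact hax (mem_pairCentralizer.1 ha).2.2

theorem IsExtraspecial.mul_mem_pairCentralizer (hv : IsExtraspecial v) (hax : ¬ Commute a x) {k : X}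
    (hk : k ∈ K) (ha : a ∈ K) (hka : Commute k a) (hkx : ¬ Commute k x) :
    k * a ∈ pairCentralizer K a x :=
  mem_pairCentralizer.2 ⟨K.mul_mem hk ha, hka.mul_left (Commute.refl a),
    (hv.commute_mul (fun h => hkx h.symm) fun h => hax h.symm).symm⟩

theorem IsExtraspecial.exists_mul_mem_pairCentralizer (hv : IsExtraspecial v)
    (hax : ¬ Commute a x) (ha : a ∈ K) (hx : x ∈ K) {k : X} (hk : k ∈ K) :
    ∃ w ∈ pairProducts a x, k * w ∈ pairCentralizer K a x := by
  obtain ⟨p, hp, hpK, hka⟩ : ∃ p, (p = 1 ∨ p = x) ∧ p ∈ K ∧ Commute (k * p) a := by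
    by_cases hka : Commute k a
    · exact ⟨1, Or.inl rfl, K.one_mem, by rwa [mul_one]⟩
    · exact ⟨x, Or.inr rfl, hx, (hv.commute_mul (fun h => hka h.symm) hax).symm⟩
  have hkp : k * p ∈ K := K.mul_mem hk hpK
  by_cases hkx : Commute (k * p) x
  · exact ⟨p * 1, mul_mem_pairProducts hp (Or.inl rfl),
      mem_pairCentralizer.2 (by rw [mul_one]; exact ⟨hkp, hka, hkx⟩)⟩
  · exact ⟨p * a, mul_mem_pairProducts hp (Or.inr rfl),
      by rw [← mul_assoc]; exact hv.mul_mem_pairCentralizer hax hkp ha hka hkx⟩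

theorem InvolutoryCosets.pairCentralizer (h : InvolutoryCosets A K) (hv : IsExtraspecial v)
    (hA : Inverts 1 A) (ha : a ∈ A ⊓ K) (hax : ¬ Commute a x) :
    InvolutoryCosets A (pairCentralizer K a x) where
  exists_mul_self y hy := by
    obtain ⟨hyK, hya, -⟩ := mem_pairCentralizer.1 hy
    obtain ⟨b, hb, hyb⟩ := h.exists_mul_self y hyK
    have hba : Commute b a := hA.comm hb.1 ha.1
    by_cases hbx : Commute b x
    · exact ⟨b, ⟨hb.1, mem_pairCentralizer.2 ⟨hb.2, hba, hbx⟩⟩, hyb⟩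
    · refine ⟨b * a, ⟨A.mul_mem hb.1 ha.1, hv.mul_mem_pairCentralizer hax hb.2 ha.2 hba hbx⟩, ?_⟩
      calc y * (b * a) * (y * (b * a)) = y * b * a * (y * b * a) := by simp only [mul_assoc]
        _ = 1 := by rw [(hya.mul_left hba).symm.mul_mul_mul_comm, hyb, one_mul,
          hA.mul_self_eq_one ha.1]
  mem_of_commute y hy hcomm := by
    obtain ⟨hyK, hya, -⟩ := mem_pairCentralizer.1 hy
    refine h.mem_of_commute y hyK fun b hb => ?_
    have hba : Commute b a := hA.comm hb.1 ha.1
    by_cases hbx : Commute b x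
    · exact hcomm b ⟨hb.1, mem_pairCentralizer.2 ⟨hb.2, hba, hbx⟩⟩
    · have hcomm_mul := hcomm (b * a)
        ⟨A.mul_mem hb.1 ha.1, hv.mul_mem_pairCentralizer hax hb.2 ha.2 hba hbx⟩
      have := hcomm_mul.mul_left hya.symm.inv_left
      rwa [mul_inv_cancel_right] at this

theorem DihedralFamilyIn.cons {r : ℕ} {d e : Fin r → X}
    (hF : DihedralFamilyIn (pairCentralizer K a x) v d e) (hv : IsExtraspecial v)
    (hax : DihedralPair a x v) (hnc : ¬ Commute a x) (ha : a ∈ K) (hx : x ∈ K) :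
    DihedralFamilyIn K v (Fin.cons a d : Fin (r + 1) → X) (Fin.cons x e) := by
  have hmem := fun i => And.intro (mem_pairCentralizer.1 (hF.mem i).1)
    (mem_pairCentralizer.1 (hF.mem i).2)
  refine ⟨Fin.cases ⟨ha, hx⟩ fun i => ⟨(hmem i).1.1, (hmem i).2.1⟩, Fin.cases hax hF.pair, ?_, ?_⟩
  · refine Fin.cases (Fin.cases (fun h => absurd rfl h) fun j _ => ?_) fun i =>
      Fin.cases (fun _ => ?_) fun j hij => hF.comm i j fun h => hij (congrArg Fin.succ h)
    · exact ⟨(hmem j).1.2.1.symm, (hmem j).2.2.1.symm, (hmem j).2.2.2.symm⟩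
    · exact ⟨(hmem i).1.2.1, (hmem i).1.2.2, (hmem i).2.2.2⟩
  · intro H hH hdeH k hk
    have exists_mul_mem : ∀ {k}, k ∈ K → ∃ w ∈ pairProducts a x, k * w ∈ pairCentralizer K a x :=
      fun hk => hv.exists_mul_mem_pairCentralizer hnc ha hx hk
    have hle : pairCentralizer K a x ≤ H := by
      refine hF.gen H (fun z hz hzc => ?_) fun i => hdeH i.succ
      obtain ⟨hzK, hza, hzx⟩ := mem_pairCentralizer.1 hz
      refine hH z hzK fun k hk => ?_
      obtain ⟨w, hw, hkw⟩ := exists_mul_mem hk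
      have hzw : Commute z w := (commute_of_mem_pairProducts hw hza.symm hzx.symm).symm
      have := (hzc _ hkw).mul_right hzw.inv_right
      rwa [mul_inv_cancel_right] at this
    obtain ⟨w, hw, hkw⟩ := exists_mul_mem hk
    exact (H.mul_mem_cancel_right (pairProducts_subset (hdeH 0).1 (hdeH 0).2 hw)).1 (hle hkw)

theorem InvolutoryCosets.exists_dihedralPair (h : InvolutoryCosets A K) (hv : IsExtraspecial v)
    (hA : Inverts 1 A) (hKA : ¬ K ≤ A) :
    ∃ a ∈ A ⊓ K, ∃ x ∈ K, DihedralPair a x v ∧ ¬ Commute a x := by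
  obtain ⟨y, hyK, hyA⟩ := SetLike.not_le_iff_exists.1 hKA
  obtain ⟨b, hb, hyb⟩ := h.exists_mul_self y hyK
  have hybK : y * b ∈ K := K.mul_mem hyK hb.2
  have hybA : y * b ∉ A := fun hc => hyA ((A.mul_mem_cancel_right hb.1).1 hc)
  obtain ⟨a, ha, hax⟩ : ∃ a ∈ A ⊓ K, ¬ Commute a (y * b) := by
    by_contra! hc
    exact hybA (h.mem_of_commute _ hybK hc)
  exact ⟨a, ha, y * b, hybK,
    ⟨hv.toIsCentralInvol, hA.mul_self_eq_one ha.1, hyb, hv.rel fun hc => hax hc.symm⟩, hax⟩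

/- Split off a dihedral pair and pass to its centralizer in `K`. -/
theorem InvolutoryCosets.exists_family [Finite X] (hv : IsExtraspecial v) (hA : Inverts 1 A)
    {K : Subgroup X} (h : InvolutoryCosets A K) :
    ∃ (r : ℕ) (d e : Fin r → X), DihedralFamilyIn K v d e := by
  by_cases hKA : K ≤ A
  · exact ⟨0, Fin.elim0, Fin.elim0, fun i => i.elim0, fun i => i.elim0, fun i => i.elim0,
      fun H hH _ z hz => hH z hz fun k hk => hA.comm (hKA hz) (hKA hk)⟩
  · obtain ⟨a, ha, x, hx, hpair, hax⟩ := h.exists_dihedralPair hv hA hKA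
    obtain ⟨r, d, e, hF⟩ := (h.pairCentralizer hv hA ha hax).exists_family hv hA
    exact ⟨r + 1, Fin.cons a d, Fin.cons x e, hF.cons hv hpair hax ha.2 hx⟩
termination_by Nat.card K
decreasing_by exact card_pairCentralizer_lt ha.2 hax

theorem IsExtraspecial.exists_family [Finite X] (hv : IsExtraspecial v) (hA : MaxInverts 1 A)
    (hX : Nat.card X < 2 * numInvol X) :
    ∃ (r : ℕ) (d e : Fin r → X), DihedralFamily d e fun _ => v := by
  obtain ⟨r, d, e, hF⟩ := (hA.involutoryCosets_top hX).exists_family hv hA.toInverts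
  refine ⟨r, d, e, hF.pair, hF.comm, fun H hH hde => ?_, fun z hz => hA.center_sq hX hz⟩
  exact top_le_iff.1 (hF.gen H (fun z _ hz => hH (Subgroup.mem_center_iff.2 fun g =>
    (hz g (Subgroup.mem_top g)).symm)) hde)

theorem exists_abelian_or_family (X : Type*) [Group X] [Finite X]
    (hX : Nat.card X < 2 * numInvol X) :
    (∃ A : Subgroup X, (∀ a ∈ A, ∀ b ∈ A, a * b = b * a) ∧ Nat.card X ≤ 2 * Nat.card A) ∨
    (∃ (v : X) (r : ℕ) (d e : Fin r → X), DihedralFamily d e fun _ => v) ∨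
    ∃ d e v : Fin 2 → X, DihedralFamily d e v ∧ v 0 ≠ v 1 := by
  obtain ⟨t, A, h⟩ := exists_maxInverts X
  by_cases hA : Nat.card X ≤ 2 * Nat.card A
  · exact Or.inl ⟨A, fun a ha b hb => h.comm ha hb, hA⟩
  rw [not_le] at hA
  by_cases hall : ∀ x ∉ A, 2 * Nat.card (cent A x) = Nat.card A
  · right; left
    obtain ⟨B, hB, hBA⟩ := h.exists_maxInverts_one (hall t)
    obtain ⟨v, hv⟩ := hB.exists_isExtraspecial hX (by omega) ((hB.all_half_iff hX).2 (by
      rw [hBA]; exact (h.all_half_iff hX).1 hall))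
    exact ⟨v, hv.exists_family hB hX⟩
  · right; right
    obtain ⟨x₁, x₂, a₁, a₂, v₁, v₂, D⟩ := h.exists_exceptionalData hX hA hall
    obtain ⟨y₁, y₂, D', hcomm⟩ := D.exists_commuting h hX hall
    exact D'.exists_family h hX hcomm

end CentralProduct

/-! ### Central products of dihedral groups -/

section ElementaryAbelian

/-- The commutative group structure on a group in which every element squares to `1`. -/
abbrev commGroupOfSq {E : Type*} [Group E] (h : ∀ e : E, e * e = 1) : CommGroup E :=
  { (inferInstance : Group E) with
    mul_comm := fun a b => by
      have hab := mul_eq_one_iff_eq_inv.1 (h (a * b))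
      rwa [mul_inv_rev, inv_eq_of_mul_eq_one_left (h a), inv_eq_of_mul_eq_one_left (h b)] at hab }

theorem exists_isCompl_of_sq {Z : Type*} [Group Z] (h : ∀ z : Z, z * z = 1)
    (V : Subgroup Z) : ∃ E : Subgroup Z, IsCompl V E := by
  let _ : CommGroup Z := commGroupOfSq h
  let _ : Module (ZMod 2) (Additive Z) := AddCommGroup.zmodModule (n := 2) fun x => by
    rw [two_nsmul]; exact h x
  have : ComplementedLattice (Subgroup Z) :=
    (OrderIso.complementedLattice_iff
      (Subgroup.toAddSubgroup.trans (AddSubgroup.toZModSubmodule 2))).2 inferInstance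
  exact exists_isCompl V

theorem exists_equiv_cpow {p : ℕ} [Fact p.Prime] {E : Type*} [CommGroup E] [Finite E]
    (h : ∀ e : E, e ^ p = 1) : ∃ m, Nonempty (E ≃* CPow p m) := by
  let _ : Module (ZMod p) (Additive E) := AddCommGroup.zmodModule (n := p) h
  have : Module.Finite (ZMod p) (Additive E) := Module.Finite.of_finite
  let b := Module.finBasis (ZMod p) (Additive E)
  exact ⟨_, ⟨{ toFun := fun e i => Multiplicative.ofAdd (b.equivFun (Additive.ofMul e) i)
               invFun := fun f => (b.equivFun.symm fun i => (f i).toAdd).toMul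
               left_inv := fun e => by simp
               right_inv := fun f => funext fun i => congrArg Multiplicative.ofAdd
                 (congrFun (b.equivFun.apply_symm_apply fun i => (f i).toAdd) i)
               map_mul' := fun x y => by ext i; simp }⟩⟩

theorem exists_equiv_cpow_two {E : Type*} [Group E] [Finite E] (h : ∀ e : E, e * e = 1) :
    ∃ m, Nonempty (E ≃* CPow 2 m) := by
  let _ : CommGroup E := commGroupOfSq h
  exact exists_equiv_cpow fun e => by rw [pow_two]; exact h e

theorem exists_complement_center {X : Type*} [Group X] (h : ∀ z ∈ Subgroup.center X, z * z = 1)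
    {V : Subgroup X} (hV : V ≤ Subgroup.center X) :
    ∃ E : Subgroup X, E ≤ Subgroup.center X ∧ (∀ z ∈ V, z ∈ E → z = 1) ∧
      Subgroup.center X ≤ V ⊔ E := by
  obtain ⟨E, hE⟩ := exists_isCompl_of_sq (Z := Subgroup.center X)
    (fun z => Subtype.ext (h z z.2)) (V.subgroupOf (Subgroup.center X))
  refine ⟨E.map (Subgroup.center X).subtype, ?_, ?_, ?_⟩
  · rintro _ ⟨z, -, rfl⟩
    exact z.2
  · rintro _ hz ⟨z, hzE, rfl⟩
    exact congrArg _ (Subgroup.disjoint_def.1 hE.disjoint hz hzE)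
  · have hsup := congrArg (Subgroup.map (Subgroup.center X).subtype) hE.sup_eq_top
    rw [Subgroup.map_sup, Subgroup.subgroupOf_map_subtype, inf_eq_left.2 hV,
      ← MonoidHom.range_eq_map, Subgroup.range_subtype] at hsup
    exact hsup.ge

end ElementaryAbelian

section DihedralHom

variable {X : Type*} [Group X]

theorem pow_val_add {ρ : X} (h : ρ ^ 4 = 1) (i j : ZMod 4) :
    ρ ^ (i + j).val = ρ ^ i.val * ρ ^ j.val := by
  rw [ZMod.val_add, ← pow_eq_pow_mod _ h, pow_add]

theorem pow_val_sub {ρ : X} (h : ρ ^ 4 = 1) (i j : ZMod 4) :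
    ρ ^ (j - i).val = (ρ ^ i.val)⁻¹ * ρ ^ j.val := by
  rw [eq_inv_mul_iff_mul_eq, ← pow_val_add h, add_sub_cancel]

/-- The homomorphism from the dihedral group of order `8` sending the rotation `r 1` to `ρ` and the
reflection `sr 0` to `d`. -/
def dihedralHom (d ρ : X) (hρ : ρ ^ 4 = 1) (hd : d * d = 1) (hdρ : d * ρ * d⁻¹ = ρ⁻¹) :
    D8 →* X where
  toFun
    | .r i => ρ ^ i.val
    | .sr i => d * ρ ^ i.val
  map_one' := by
    change ρ ^ (0 : ZMod 4).val = 1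
    simp
  map_mul' := by
    have pow_mul_d : ∀ n : ℕ, ρ ^ n * d = d * (ρ ^ n)⁻¹ := fun n => by
      rw [← inv_pow, ← hdρ, conj_pow, ← mul_assoc, ← mul_assoc, hd, one_mul,
        inv_eq_of_mul_eq_one_left hd]
    rintro (i | i) (j | j)
    · exact pow_val_add hρ i j
    · change d * ρ ^ (j - i).val = ρ ^ i.val * (d * ρ ^ j.val)
      rw [pow_val_sub hρ, ← mul_assoc, ← mul_assoc, pow_mul_d]
    · change d * ρ ^ (i + j).val = d * ρ ^ i.val * ρ ^ j.val
      rw [pow_val_add hρ, mul_assoc]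
    · change ρ ^ (j - i).val = d * ρ ^ i.val * (d * ρ ^ j.val)
      rw [pow_val_sub hρ, mul_assoc d, ← mul_assoc _ d, pow_mul_d, ← mul_assoc, ← mul_assoc, hd,
        one_mul]

end DihedralHom

section Family

open scoped commutatorElement

theorem D8.eq_of_mem_center : ∀ {z : D8}, z ∈ Subgroup.center D8 → z = 1 ∨ z = .r 2 := by
  simp only [Subgroup.mem_center_iff]
  decide

theorem D8.commutator_eq : ∀ x y : D8, ⁅x, y⁆ = 1 ∨ ⁅x, y⁆ = .r 2 := by
  decide

theorem commutator_mulSingle {ι G : Type*} [DecidableEq ι] [Group G] (a : ι → G) (i : ι) (y : G) :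
    ⁅a, (Pi.mulSingle i y : ι → G)⁆ = Pi.mulSingle i ⁅a i, y⁆ := by
  ext1 j
  obtain rfl | hj := eq_or_ne j i <;> simp [commutatorElement_def, *]

variable {X : Type*} [Group X]

theorem DihedralPair.mul_sq {d e v : X} (h : DihedralPair d e v) : (d * e) * (d * e) = v := by
  calc (d * e) * (d * e) = d * (e * d) * e := by group
    _ = v * (d * d) * (e * e) := by rw [h.rel, ← mul_assoc d, ← h.central]; group
    _ = v := by rw [h.d_sq, h.e_sq, mul_one, mul_one]

theorem DihedralPair.mul_pow_four {d e v : X} (h : DihedralPair d e v) : (d * e) ^ 4 = 1 := by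
  rw [show 4 = 2 * 2 from rfl, pow_mul, pow_two (d * e), h.mul_sq, pow_two, h.sq]

theorem DihedralPair.conj_mul {d e v : X} (h : DihedralPair d e v) :
    d * (d * e) * d⁻¹ = (d * e)⁻¹ := by
  rw [mul_inv_rev, inv_eq_of_mul_eq_one_left h.d_sq, inv_eq_of_mul_eq_one_left h.e_sq, ← mul_assoc,
    h.d_sq, one_mul]

/-- The homomorphism from the dihedral group of order `8` given by a dihedral pair. It sends the
reflections `sr 0` and `sr 1` to `d` and `e`. -/
def DihedralPair.hom {d e v : X} (h : DihedralPair d e v) : D8 →* X :=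
  dihedralHom d (d * e) h.mul_pow_four h.d_sq h.conj_mul

theorem DihedralPair.hom_sr_zero {d e v : X} (h : DihedralPair d e v) : h.hom (.sr 0) = d := by
  change d * (d * e) ^ (0 : ZMod 4).val = d
  rw [ZMod.val_zero, pow_zero, mul_one]

theorem DihedralPair.hom_sr_one {d e v : X} (h : DihedralPair d e v) : h.hom (.sr 1) = e := by
  change d * (d * e) ^ (1 : ZMod 4).val = e
  rw [show (1 : ZMod 4).val = 1 from rfl, pow_one, ← mul_assoc, h.d_sq, one_mul]

theorem DihedralPair.hom_r_two {d e v : X} (h : DihedralPair d e v) : h.hom (.r 2) = v := by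
  change (d * e) ^ (2 : ZMod 4).val = v
  rw [show (2 : ZMod 4).val = 2 from rfl, pow_two, h.mul_sq]

theorem DihedralPair.hom_mem {d e v : X} (h : DihedralPair d e v) {H : Subgroup X} (hd : d ∈ H)
    (he : e ∈ H) (x : D8) : h.hom x ∈ H := by
  rcases x with k | k
  · exact H.pow_mem (H.mul_mem hd he) _
  · exact H.mul_mem hd (H.pow_mem (H.mul_mem hd he) _)

theorem DihedralPair.commute_hom {d e v g : X} (h : DihedralPair d e v) (hd : Commute d g)
    (he : Commute e g) (x : D8) : Commute (h.hom x) g :=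
  Subgroup.mem_centralizer_singleton_iff.1 (h.hom_mem (H := Subgroup.centralizer {g})
    (Subgroup.mem_centralizer_singleton_iff.2 hd) (Subgroup.mem_centralizer_singleton_iff.2 he) x)

variable {r : ℕ} {d e v : Fin r → X}

theorem DihedralFamily.pairwise_commute (F : DihedralFamily d e v) :
    Pairwise fun i j => ∀ x y, Commute ((F.pair i).hom x) ((F.pair j).hom y) := by
  intro i j hij x y
  obtain ⟨hdd, hde, hee⟩ := F.comm i j hij
  obtain ⟨-, hed, -⟩ := F.comm j i hij.symm
  exact (F.pair i).commute_hom ((F.pair j).commute_hom hdd.symm hde.symm y).symm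
    ((F.pair j).commute_hom hed hee.symm y).symm x

/-- The homomorphism from the direct power of the dihedral group of order `8` given by the pairs of
the family. -/
def DihedralFamily.piHom (F : DihedralFamily d e v) : (Fin r → D8) →* X :=
  MonoidHom.noncommPiCoprod (fun i => (F.pair i).hom) F.pairwise_commute

theorem DihedralFamily.piHom_mulSingle (F : DihedralFamily d e v) (i : Fin r) (x : D8) :
    F.piHom (Pi.mulSingle i x) = (F.pair i).hom x :=
  MonoidHom.noncommPiCoprod_mulSingle (fun i => (F.pair i).hom) i x

theorem DihedralFamily.mem_center_of_piHom_mem (F : DihedralFamily d e v) {a : Fin r → D8}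
    (h : F.piHom a ∈ Subgroup.center X) (i : Fin r) : a i ∈ Subgroup.center D8 := by
  refine Subgroup.mem_center_iff.2 fun y => (commutatorElement_eq_one_iff_mul_comm.1 ?_).symm
  refine (D8.commutator_eq _ y).resolve_right fun hc => (F.pair i).ne_one ?_
  calc v i = F.piHom (Pi.mulSingle i ⁅a i, y⁆) := by
        rw [F.piHom_mulSingle, hc, (F.pair i).hom_r_two]
    _ = ⁅F.piHom a, F.piHom (Pi.mulSingle i y)⁆ := by
        rw [← commutator_mulSingle, map_commutatorElement]
    _ = 1 := commutatorElement_eq_one_iff_mul_comm.2 (Subgroup.mem_center_iff.1 h _).symm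

theorem DihedralFamily.piHom_mem_closure (F : DihedralFamily d e v) {a : Fin r → D8}
    (h : F.piHom a ∈ Subgroup.center X) : F.piHom a ∈ Subgroup.closure (Set.range v) := by
  rw [DihedralFamily.piHom, MonoidHom.noncommPiCoprod_apply]
  refine Subgroup.noncommProd_mem _ _ fun i _ => ?_
  rcases D8.eq_of_mem_center (F.mem_center_of_piHom_mem h i) with hi | hi <;> rw [hi]
  · rw [map_one]
    exact one_mem _
  · rw [(F.pair i).hom_r_two]
    exact Subgroup.subset_closure ⟨i, rfl⟩

theorem DihedralFamily.closure_le_center (F : DihedralFamily d e v) :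
    Subgroup.closure (Set.range v) ≤ Subgroup.center X := by
  rw [Subgroup.closure_le]
  rintro _ ⟨i, rfl⟩
  exact Subgroup.mem_center_iff.2 fun g => ((F.pair i).central g).symm

theorem DihedralFamily.range_piHom_sup (F : DihedralFamily d e v) {E : Subgroup X}
    (hE : Subgroup.center X ≤ Subgroup.closure (Set.range v) ⊔ E) : F.piHom.range ⊔ E = ⊤ := by
  have hom_mem : ∀ i x, (F.pair i).hom x ∈ F.piHom.range := fun i x => ⟨_, F.piHom_mulSingle i x⟩
  have hle : F.piHom.range ≤ F.piHom.range ⊔ E := le_sup_left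
  refine F.gen _ (hE.trans (sup_le_sup_right ?_ E)) fun i =>
    ⟨hle ((F.pair i).hom_sr_zero ▸ hom_mem i _), hle ((F.pair i).hom_sr_one ▸ hom_mem i _)⟩
  rw [Subgroup.closure_le]
  rintro _ ⟨i, rfl⟩
  exact (F.pair i).hom_r_two ▸ hom_mem i _

/- The factor `C_2 ^ m` is a complement, inside the center of `X`, of the subgroup generated by the
centers of the dihedral groups. -/
theorem DihedralFamily.exists_equiv [Finite X] (F : DihedralFamily d e v)
    (N : Subgroup (Fin r → D8)) [N.Normal] (hN : ∀ a, F.piHom a = 1 ↔ a ∈ N) :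
    ∃ m, Nonempty (X ≃* CPow 2 m × ((Fin r → D8) ⧸ N)) := by
  obtain ⟨E, hEc, hVE, hZ⟩ := exists_complement_center F.center_sq F.closure_le_center
  obtain ⟨m, ⟨φ⟩⟩ := exists_equiv_cpow_two (E := E) fun z => Subtype.ext (F.center_sq z (hEc z.2))
  let f : (Fin r → D8) ⧸ N →* X := QuotientGroup.lift N F.piHom fun a ha => (hN a).2 ha
  have hcomm : ∀ a (z : E), Commute (f a) (E.subtype z) := fun a z =>
    Subgroup.mem_center_iff.1 (hEc z.2) _
  have hinj : Function.Injective (f.noncommCoprod E.subtype hcomm) := by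
    rw [injective_iff_map_eq_one]
    rintro ⟨a, z⟩ haz
    obtain ⟨a, rfl⟩ := QuotientGroup.mk_surjective a
    have hz : F.piHom a = (z : X)⁻¹ := mul_eq_one_iff_eq_inv.1 haz
    have ha : F.piHom a = 1 := hVE _
      (F.piHom_mem_closure (hz ▸ inv_mem (hEc z.2))) (hz ▸ inv_mem z.2)
    exact Prod.ext ((QuotientGroup.eq_one_iff a).2 ((hN a).1 ha))
      (Subtype.ext (inv_eq_one.1 (hz.symm.trans ha)))
  have hsurj : Function.Surjective (f.noncommCoprod E.subtype hcomm) := by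
    rw [← MonoidHom.range_eq_top, MonoidHom.noncommCoprod_range, Subgroup.range_subtype,
      eq_top_iff, ← F.range_piHom_sup hZ]
    refine sup_le_sup_right ?_ E
    rintro _ ⟨a, rfl⟩
    exact ⟨a, rfl⟩
  exact ⟨m, ⟨(MulEquiv.ofBijective _ ⟨hinj, hsurj⟩).symm.trans
    (MulEquiv.prodComm.trans (MulEquiv.prodCongr φ (MulEquiv.refl _)))⟩⟩

theorem noncommPiCoprod_comp {ι H Z : Type*} [Fintype ι] [Group H] [CommGroup Z] (φ : ι → H →* X)
    (hφ : Pairwise fun i j => ∀ x y, Commute (φ i x) (φ j y)) (f : Z →* H) (g : Z →* X)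
    (h : ∀ i x, φ i (f x) = g x) (z : ι → Z) :
    MonoidHom.noncommPiCoprod φ hφ (fun i => f (z i)) = g (∏ i, z i) := by
  rw [MonoidHom.noncommPiCoprod_apply, ← Finset.noncommProd_eq_prod]
  exact (Finset.noncommProd_congr rfl (fun i _ => h i (z i)) _).trans
    (Finset.map_noncommProd _ _ _ g).symm

open scoped IsMulCommutative in
theorem DihedralFamily.piHom_center {v : X} (F : DihedralFamily d e fun _ => v) (i₀ : Fin r)
    (z : Fin r → Subgroup.center D8) :
    F.piHom (fun i => z i) = (F.pair i₀).hom (∏ i, z i : Subgroup.center D8) := by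
  have hom_eq : ∀ (i) (z : Subgroup.center D8),
      (F.pair i).hom z = (((F.pair i₀).hom).comp (Subgroup.center D8).subtype) z := by
    intro i z
    change (F.pair i).hom z = (F.pair i₀).hom z
    rcases D8.eq_of_mem_center z.2 with hz | hz <;> rw [hz]
    · rw [map_one, map_one]
    · rw [(F.pair i).hom_r_two, (F.pair i₀).hom_r_two]
  exact noncommPiCoprod_comp _ F.pairwise_commute (Subgroup.center D8).subtype _ hom_eq z

open scoped IsMulCommutative in
theorem DihedralFamily.piHom_eq_one_iff {v : X} (F : DihedralFamily d e fun _ => v) (i₀ : Fin r)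
    (a : Fin r → D8) : F.piHom a = 1 ↔ a ∈ centralN r := by
  constructor
  · intro ha
    have hcenter := F.mem_center_of_piHom_mem (a := a) (ha ▸ one_mem _)
    let z : Fin r → Subgroup.center D8 := fun i => ⟨a i, hcenter i⟩
    have hprod : (F.pair i₀).hom (∏ i, z i : Subgroup.center D8) = 1 :=
      (F.piHom_center i₀ z).symm.trans ha
    refine ⟨z, fun _ => rfl, Subtype.ext ?_⟩
    refine (D8.eq_of_mem_center (∏ i, z i).2).resolve_right fun hz => (F.pair i₀).ne_one ?_
    rwa [hz, (F.pair i₀).hom_r_two] at hprod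
  · rintro ⟨z, hz, hz_prod⟩
    obtain rfl : (fun i => (z i : D8)) = a := funext hz
    rw [F.piHom_center i₀, hz_prod]
    exact map_one _

theorem DihedralFamily.exists_equiv_centralProduct [Finite X] {v : X}
    (F : DihedralFamily d e fun _ => v) (i₀ : Fin r) :
    ∃ m, Nonempty (X ≃* CPow 2 m × CentralProductD8 r) :=
  F.exists_equiv (centralN r) (F.piHom_eq_one_iff i₀)

theorem DihedralFamily.eq_one_of_piHom_eq_one {d e v : Fin 2 → X} (F : DihedralFamily d e v)
    (hv : v 0 ≠ v 1) {a : Fin 2 → D8} (ha : F.piHom a = 1) : a = 1 := by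
  have hcenter := fun i => D8.eq_of_mem_center (F.mem_center_of_piHom_mem (ha ▸ one_mem _) i)
  have ha_eq : a = Pi.mulSingle 0 (a 0) * Pi.mulSingle 1 (a 1) := by
    funext i; fin_cases i <;> simp
  have hmul : (F.pair 0).hom (a 0) * (F.pair 1).hom (a 1) = 1 := by
    rw [← F.piHom_mulSingle, ← F.piHom_mulSingle, ← map_mul, ← ha_eq, ha]
  rcases hcenter 0 with h₀ | h₀ <;> rcases hcenter 1 with h₁ | h₁ <;> rw [h₀, h₁] at hmul
  · rw [ha_eq, h₀, h₁, Pi.mulSingle_one, Pi.mulSingle_one, mul_one]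
  · rw [map_one, one_mul, (F.pair 1).hom_r_two] at hmul
    exact absurd hmul (F.pair 1).ne_one
  · rw [map_one, mul_one, (F.pair 0).hom_r_two] at hmul
    exact absurd hmul (F.pair 0).ne_one
  · rw [(F.pair 0).hom_r_two, (F.pair 1).hom_r_two] at hmul
    exact absurd (mul_left_cancel ((F.pair 0).sq.trans hmul.symm)) hv

theorem DihedralFamily.exists_equiv_prod [Finite X] {d e v : Fin 2 → X}
    (F : DihedralFamily d e v) (hv : v 0 ≠ v 1) :
    ∃ m, Nonempty (X ≃* CPow 2 m × (D8 × D8)) := by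
  obtain ⟨m, ⟨f⟩⟩ := F.exists_equiv ⊥ fun a =>
    ⟨fun ha => F.eq_one_of_piHom_eq_one hv ha, fun ha => by rw [Subgroup.mem_bot.1 ha, map_one]⟩
  exact ⟨m, ⟨f.trans (MulEquiv.prodCongr (MulEquiv.refl _)
    (QuotientGroup.quotientBot.trans
      { piFinTwoEquiv fun _ => D8 with map_mul' := fun _ _ => rfl }))⟩⟩

end Family

/-! ### Groups with an abelian subgroup of index at most two -/

section Totient

theorem dvd_twelve_of_totient_eq_two {n : ℕ} (h : n.totient = 2) : n ∣ 12 := by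
  rw [Nat.dvd_iff_prime_pow_dvd_dvd]
  rintro p (- | k) hp hpk
  · simp
  have hdvd : p ^ k * (p - 1) ∣ 2 := by
    rw [← h, ← Nat.totient_prime_pow_succ hp]
    exact Nat.totient_dvd_of_dvd hpk
  have hp_le : p ≤ 3 := by
    have := Nat.le_of_dvd two_pos ((dvd_mul_left _ _).trans hdvd)
    omega
  have hk : k < 2 := Nat.pow_lt_pow_iff_right (a := 2) one_lt_two |>.1 <|
    calc 2 ^ k ≤ p ^ k := Nat.pow_le_pow_left hp.two_le k
      _ ≤ 2 := Nat.le_of_dvd two_pos ((dvd_mul_right _ _).trans hdvd)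
      _ < 2 ^ 2 := by norm_num
  have := hp.two_le
  interval_cases p <;> interval_cases k <;> revert hdvd <;> decide

theorem dvd_of_totient_lt_four {n : ℕ} (hn : n ≠ 0) (h : n.totient < 4) : n ∣ 4 ∨ n ∣ 6 := by
  rcases le_or_gt n 2 with hle | hlt
  · left; interval_cases n <;> simp_all
  have hφ : n.totient = 2 := by
    obtain ⟨k, hk⟩ := Nat.totient_even hlt
    have := Nat.totient_pos.2 (Nat.pos_of_ne_zero hn)
    omega
  have hdiv : ∀ d ∈ Nat.divisors 12, d.totient < 4 → d ∣ 4 ∨ d ∣ 6 := by decide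
  exact hdiv n (Nat.mem_divisors.2 ⟨dvd_twelve_of_totient_eq_two hφ, by norm_num⟩) h

open scoped Classical in
theorem inv_totient_orderOf_le {G : Type*} [Group G] [Finite G] (g : G) :
    ((orderOf g).totient : ℚ)⁻¹ ≤ 1 / 2 + (if g * g = 1 then 1 / 2 else 0) -
      (if g ^ 4 ≠ 1 ∧ g ^ 6 ≠ 1 then 1 / 4 else 0) := by
  by_cases hsq : g * g = 1
  · have hfour : g ^ 4 = 1 := by rw [show 4 = 2 * 2 from rfl, pow_mul, pow_two g, hsq, one_pow]
    rw [(totient_orderOf_eq_one_iff g).2 hsq, if_pos hsq, if_neg fun h => h.1 hfour]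
    norm_num
  by_cases hexp : g ^ 4 ≠ 1 ∧ g ^ 6 ≠ 1
  · have hfour : 4 ≤ (orderOf g).totient := by
      by_contra! h
      rcases dvd_of_totient_lt_four (orderOf_pos g).ne' h with h | h
      · exact hexp.1 (orderOf_dvd_iff_pow_eq_one.1 h)
      · exact hexp.2 (orderOf_dvd_iff_pow_eq_one.1 h)
    rw [if_neg hsq, if_pos hexp]
    calc ((orderOf g).totient : ℚ)⁻¹ ≤ (4 : ℚ)⁻¹ :=
          inv_anti₀ (by norm_num) (by exact_mod_cast hfour)
      _ ≤ _ := by norm_num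
  · rw [if_neg hsq, if_neg hexp, add_zero, sub_zero]
    exact inv_totient_orderOf_le_half hsq

theorem alpha_mul_card_le (G : Type*) [Group G] [Finite G] :
    alpha G * Nat.card G ≤ Nat.card G / 2 + numInvol G / 2 -
      Nat.card {g : G // g ^ 4 ≠ 1 ∧ g ^ 6 ≠ 1} / 4 := by
  classical
  have : Fintype G := Fintype.ofFinite G
  have hcard : (Fintype.card G : ℚ) ≠ 0 := by exact_mod_cast Fintype.card_ne_zero
  rw [alpha_eq_sum, Nat.card_eq_fintype_card (α := G), div_mul_cancel₀ _ hcard]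
  refine (Finset.sum_le_sum fun g _ => inv_totient_orderOf_le g).trans (le_of_eq ?_)
  rw [Finset.sum_sub_distrib, Finset.sum_add_distrib, ← Finset.sum_filter, ← Finset.sum_filter,
    numInvol_eq_card_filter, Nat.card_eq_fintype_card, Fintype.card_subtype]
  simp only [Finset.sum_const, nsmul_eq_mul, Finset.card_univ]
  ring

/-- Multiplication by `q` and by `q⁻¹` moves the solutions of `e * e = 1` to disjoint sets of
elements of exponent dividing neither `4` nor `6`. -/
theorem two_mul_numInvol_le {A : Type*} [CommGroup A] [Finite A] {q : A} (hq4 : q ^ 4 ≠ 1)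
    (hq6 : q ^ 6 ≠ 1) :
    2 * numInvol A ≤ Nat.card {a : A // a ^ 4 ≠ 1 ∧ a ^ 6 ≠ 1} := by
  have hfour : ∀ {e : A}, e * e = 1 → e ^ 4 = 1 := fun {e} he => by
    rw [show 4 = 2 * 2 from rfl, pow_mul, pow_two e, he, one_pow]
  have hsix : ∀ {e : A}, e * e = 1 → e ^ 6 = 1 := fun {e} he => by
    rw [show 6 = 2 * 3 from rfl, pow_mul, pow_two e, he, one_pow]
  let shift : {e : A // e * e = 1} ⊕ {e : A // e * e = 1} → {a : A // a ^ 4 ≠ 1 ∧ a ^ 6 ≠ 1} :=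
    Sum.elim
      (fun e => ⟨q * e, by rwa [mul_pow, hfour e.2, mul_one], by rwa [mul_pow, hsix e.2, mul_one]⟩)
      fun e => ⟨q⁻¹ * e, by rwa [mul_pow, hfour e.2, mul_one, inv_pow, ne_eq, inv_eq_one],
        by rwa [mul_pow, hsix e.2, mul_one, inv_pow, ne_eq, inv_eq_one]⟩
  have hdisjoint : ∀ e f : {e : A // e * e = 1}, q * e ≠ q⁻¹ * f := fun e f h => hq4 <| by
    have hf : q * q * e = f := by rw [mul_assoc, h, mul_inv_cancel_left]
    have hsq := f.2
    rwa [← hf, mul_mul_mul_comm, e.2, mul_one, ← pow_two, ← pow_two, ← pow_mul] at hsq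
  have hinj : Function.Injective shift := by
    rintro (e | e) (f | f) h
    · exact congrArg Sum.inl (Subtype.ext (mul_left_cancel (congrArg Subtype.val h)))
    · exact absurd (congrArg Subtype.val h) (hdisjoint e f)
    · exact absurd (congrArg Subtype.val h).symm (hdisjoint f e)
    · exact congrArg Sum.inr (Subtype.ext (mul_left_cancel (congrArg Subtype.val h)))
  rw [two_mul, numInvol, ← Nat.card_sum]
  exact Nat.card_le_card_of_injective shift hinj

theorem pow_four_or_pow_six {A : Type*} [CommGroup A] [Finite A] (h : 1 / 2 < alpha A) :
    (∀ a : A, a ^ 4 = 1) ∨ ∀ a : A, a ^ 6 = 1 := by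
  by_contra! hc
  obtain ⟨⟨a, ha⟩, b, hb⟩ := hc
  obtain ⟨q, hq4, hq6⟩ : ∃ q : A, q ^ 4 ≠ 1 ∧ q ^ 6 ≠ 1 := by
    by_cases ha6 : a ^ 6 = 1
    · by_cases hb4 : b ^ 4 = 1
      · exact ⟨a * b, by rwa [mul_pow, hb4, mul_one], by rwa [mul_pow, ha6, one_mul]⟩
      · exact ⟨b, hb4, hb⟩
    · exact ⟨a, ha, ha6⟩
  have hmany : (2 * numInvol A : ℚ) ≤ Nat.card {a : A // a ^ 4 ≠ 1 ∧ a ^ 6 ≠ 1} := by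
    exact_mod_cast two_mul_numInvol_le hq4 hq6
  have hcard : (0 : ℚ) < Nat.card A := by exact_mod_cast Nat.card_pos
  have hlt := mul_lt_mul_of_pos_right h hcard
  linarith [alpha_mul_card_le A]

theorem alpha_eq_of_subgroup {X : Type*} [Group X] [Finite X] {A : Subgroup X}
    (hcard : Nat.card X = 2 * Nat.card A) (h : ∀ x ∉ A, x * x = 1) :
    alpha X = (alpha A + 1) / 2 := by
  classical
  have : Fintype X := Fintype.ofFinite X
  have hpos : (0 : ℚ) < Fintype.card A := by exact_mod_cast Fintype.card_pos
  rw [Nat.card_eq_fintype_card, Nat.card_eq_fintype_card] at hcard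
  have hcompl : Fintype.card {x // x ∉ A} = Fintype.card A := by
    have hsub : Fintype.card {x // x ∉ A} = Fintype.card X - Fintype.card A :=
      Fintype.card_subtype_compl (fun x => x ∈ A)
    omega
  have hout : ∑ x : {x // x ∉ A}, ((orderOf (x : X)).totient : ℚ)⁻¹ = Fintype.card A := by
    rw [Finset.sum_congr rfl fun x _ => by
      rw [(totient_orderOf_eq_one_iff (x : X)).2 (h x x.2), Nat.cast_one, inv_one],
      Finset.sum_const, Finset.card_univ, hcompl, nsmul_one]
  have hin : ∑ x : {x // x ∈ A}, ((orderOf (x : X)).totient : ℚ)⁻¹ =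
      ∑ a : A, ((orderOf a).totient : ℚ)⁻¹ :=
    Finset.sum_congr rfl fun a _ => by rw [Subgroup.orderOf_coe]
  rw [alpha_eq_sum, alpha_eq_sum, hcard, ← Fintype.sum_subtype_add_sum_subtype (· ∈ A), hout, hin]
  push_cast
  field_simp

end Totient

section Abelian

theorem exists_equiv_of_pow_six {A : Type*} [CommGroup A] [Finite A] (h : ∀ a : A, a ^ 6 = 1) :
    ∃ m n, Nonempty (CPow 2 m × CPow 3 n ≃* A) := by
  obtain ⟨m, ⟨f⟩⟩ := exists_equiv_cpow (p := 2) (E := (powMonoidHom 2 : A →* A).ker)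
    fun e => Subtype.ext e.2
  obtain ⟨n, ⟨g⟩⟩ := exists_equiv_cpow (p := 3) (E := (powMonoidHom 3 : A →* A).ker)
    fun e => Subtype.ext e.2
  refine ⟨m, n, ⟨(MulEquiv.prodCongr f.symm g.symm).trans
    { toFun := fun p => p.1 * p.2
      invFun := fun a => (⟨a ^ 3, ?_⟩, ⟨a ^ 4, ?_⟩)
      left_inv := fun p => ?_
      right_inv := fun a => ?_
      map_mul' := fun p q => ?_ }⟩⟩
  · change (a ^ 3) ^ 2 = 1
    rw [← pow_mul, h]
  · change (a ^ 4) ^ 3 = 1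
    rw [← pow_mul, show 4 * 3 = 6 * 2 from rfl, pow_mul, h, one_pow]
  · have hsq : (p.1 : A) ^ 2 = 1 := p.1.2
    have hcube : (p.2 : A) ^ 3 = 1 := p.2.2
    refine Prod.ext (Subtype.ext ?_) (Subtype.ext ?_)
    · change ((p.1 : A) * p.2) ^ 3 = p.1
      rw [mul_pow, hcube, pow_succ, hsq, one_mul, mul_one]
    · change ((p.1 : A) * p.2) ^ 4 = p.2
      rw [mul_pow, pow_succ (p.2 : A), hcube, show 4 = 2 * 2 from rfl, pow_mul, hsq, one_pow,
        one_mul, one_mul]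
  · change a ^ 3 * a ^ 4 = a
    rw [← pow_add, pow_succ, h, one_mul]
  · change ((p.1 : A) * q.1) * (p.2 * q.2) = p.1 * p.2 * (q.1 * q.2)
    exact mul_mul_mul_comm _ _ _ _

theorem exists_equiv_of_pow_four {A : Type*} [CommGroup A] [Finite A] (h : ∀ a : A, a ^ 4 = 1) :
    ∃ m n, Nonempty (CPow 2 m × CPow 4 n ≃* A) := by
  classical
  obtain ⟨ι, _, n, hn, ⟨e⟩⟩ := CommGroup.equiv_prod_multiplicative_zmod_of_finite A
  have hn4 : ∀ i, n i = 2 ∨ n i = 4 := by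
    intro i
    have hdvd := h (e.symm (Pi.mulSingle i (Multiplicative.ofAdd 1)))
    rw [← map_pow, MulEquiv.map_eq_one_iff, ← Pi.mulSingle_pow, Pi.mulSingle_eq_one_iff,
      ← ofAdd_nsmul, ofAdd_eq_one, nsmul_one, ZMod.natCast_eq_zero_iff] at hdvd
    have hle := Nat.le_of_dvd (by norm_num) hdvd
    have hlt := hn i
    interval_cases n i <;> simp_all
  have hcyclic : ∀ (k : ℕ) (p : ι → Prop) (_ : ∀ i, p i → n i = k),
      Nonempty ((∀ i : {i // p i}, Multiplicative (ZMod (n i))) ≃*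
        CPow k (Fintype.card {i // p i})) :=
    fun k p hp =>
      ⟨(MulEquiv.piCongrRight fun i : {i // p i} =>
          (ZMod.ringEquivCongr (hp i i.2)).toAddEquiv.toMultiplicative).trans
        (MulEquiv.arrowCongr (Fintype.equivFin _) (MulEquiv.refl _))⟩
  obtain ⟨f⟩ := hcyclic 2 (fun i => n i = 2) fun _ h => h
  obtain ⟨g⟩ := hcyclic 4 (fun i => ¬ n i = 2) fun i h => (hn4 i).resolve_left h
  exact ⟨_, _, ⟨(e.trans (MulEquiv.trans
    { Equiv.piEquivPiSubtypeProd (fun i => n i = 2) fun i => Multiplicative (ZMod (n i)) with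
      map_mul' := fun _ _ => rfl } (MulEquiv.prodCongr f g))).symm⟩⟩

end Abelian

section Semidirect

theorem C_two_eq_one_or (s : C 2) : s = 1 ∨ s = Multiplicative.ofAdd 1 := by
  decide +revert

theorem involutionHom_ofAdd_one {M : Type*} [Group M] (g : M) (hg : g * g = 1) :
    involutionHom g hg (Multiplicative.ofAdd 1) = g :=
  if_neg (c := Multiplicative.ofAdd (1 : ZMod 2) = 1) (t := 1) (by decide)

variable {X M : Type*} [Group X] [Group M]

/-- The homomorphism `M ⋊ C_2 → X` which extends `j : M → X` and sends the generator of `C_2` to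
`t`, where conjugation by `t` induces the automorphism `φ` of `M`. -/
def semidirectHom (j : M →* X) {φ : MulAut M} (hφ : φ * φ = 1) {t : X} (ht : t * t = 1)
    (hj : ∀ a, t * j a * t = j (φ a)) : M ⋊[involutionHom φ hφ] C 2 →* X :=
  SemidirectProduct.lift j (involutionHom t ht) fun c => by
    ext a
    rcases C_two_eq_one_or c with rfl | rfl
    · simp
    · change j (involutionHom φ hφ (Multiplicative.ofAdd 1) a) =
        involutionHom t ht (Multiplicative.ofAdd 1) * j a *
          (involutionHom t ht (Multiplicative.ofAdd 1))⁻¹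
      rw [involutionHom_ofAdd_one, involutionHom_ofAdd_one, inv_eq_of_mul_eq_one_left ht, hj]

theorem commute_semidirectHom {j : M →* X} {φ : MulAut M} {hφ : φ * φ = 1} {t : X}
    {ht : t * t = 1} {hj : ∀ a, t * j a * t = j (φ a)} {x : X} (hx : ∀ a, Commute x (j a))
    (hxt : Commute x t) (g : M ⋊[involutionHom φ hφ] C 2) :
    Commute x (semidirectHom j hφ ht hj g) := by
  refine (hx g.left).mul_right ?_
  rcases C_two_eq_one_or g.right with hc | hc <;> rw [hc]
  · rw [map_one]; exact Commute.one_right x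
  · rwa [involutionHom_ofAdd_one]

theorem exists_equiv_prod_semidirect {E : Type*} [Group E] {A : Subgroup X} (f : E × M ≃* A)
    {φ : MulAut M} (hφ : φ * φ = 1) {t : X} (ht : t * t = 1) (htA : t ∉ A)
    (hA : ∀ x ∉ A, x * t ∈ A) (hE : ∀ z, t * (f (z, 1) : X) = (f (z, 1) : X) * t)
    (hM : ∀ a, t * (f (1, a) : X) * t = f (1, φ a)) :
    Nonempty (X ≃* E × (M ⋊[involutionHom φ hφ] C 2)) := by
  let F : E × M →* X := A.subtype.comp f.toMonoidHom
  let l := semidirectHom (F.comp (MonoidHom.inr E M)) hφ ht hM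
  have hcomm : ∀ z g, Commute (F.comp (MonoidHom.inl E M) z) (l g) := fun z =>
    commute_semidirectHom (fun a => (MonoidHom.commute_inl_inr z a).map F) (hE z).symm
  let Φ := (F.comp (MonoidHom.inl E M)).noncommCoprod l hcomm
  have hΦ : ∀ z a c, Φ (z, ⟨a, c⟩) = f (z, a) * involutionHom t ht c := fun z a c => by
    change F (z, 1) * (F (1, a) * involutionHom t ht c) = F (z, a) * involutionHom t ht c
    rw [← mul_assoc, ← map_mul, Prod.mk_mul_mk, mul_one, one_mul]
  have hinj : Function.Injective Φ := by
    rw [injective_iff_map_eq_one]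
    rintro ⟨z, a, c⟩ h
    rw [hΦ] at h
    rcases C_two_eq_one_or c with rfl | rfl
    · rw [map_one, mul_one, OneMemClass.coe_eq_one, MulEquiv.map_eq_one_iff, Prod.mk_eq_one] at h
      rw [h.1, h.2]; rfl
    · rw [involutionHom_ofAdd_one] at h
      exact absurd (eq_inv_of_mul_eq_one_right h ▸ inv_mem (f (z, a)).2) htA
  have hsurj : Function.Surjective Φ := by
    intro x
    by_cases hx : x ∈ A
    · obtain ⟨⟨z, a⟩, h⟩ := f.surjective ⟨x, hx⟩
      exact ⟨(z, ⟨a, 1⟩), by rw [hΦ, h, map_one, mul_one]⟩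
    · obtain ⟨⟨z, a⟩, h⟩ := f.surjective ⟨x * t, hA x hx⟩
      refine ⟨(z, ⟨a, Multiplicative.ofAdd 1⟩), ?_⟩
      rw [hΦ, h, involutionHom_ofAdd_one, mul_assoc, ht, mul_one]
  exact ⟨(MulEquiv.ofBijective Φ ⟨hinj, hsurj⟩).symm⟩

theorem mul_self_of_equiv_of_subsingleton [Subsingleton M] {φ : C 2 →* MulAut M} {m : ℕ}
    (e : X ≃* CPow 2 m × (M ⋊[φ] C 2)) (x : X) : x * x = 1 := by
  have hC : ∀ s : C 2, s * s = 1 := by decide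
  refine e.injective ?_
  rw [map_mul, map_one]
  exact Prod.ext (cpow_two_mul_self _)
    (SemidirectProduct.ext (Subsingleton.elim _ _) (hC (e x).2.right))

theorem exists_equiv_invSemidirect {B : Type*} [CommGroup B] {A : Subgroup X} {m : ℕ}
    (f : CPow 2 m × B ≃* A) {t : X} (htA : t ∉ A) (hA : ∀ x ∉ A, x * t ∈ A) (h : Inverts t A) :
    Nonempty (X ≃* CPow 2 m × InvSemidirect B) := by
  have hconj : ∀ p, t * (f p : X) * t = f p⁻¹ := fun p => by
    rw [h.conj _ (f p).2, map_inv, Subgroup.coe_inv]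
  refine exists_equiv_prod_semidirect f _ h.sq htA hA (fun z => ?_) fun a => ?_
  · have hz := hconj (z, 1)
    rwa [Prod.inv_mk, inv_one, inv_eq_of_mul_eq_one_left (cpow_two_mul_self z),
      ← eq_mul_inv_iff_mul_eq, inv_eq_of_mul_eq_one_left h.sq] at hz
  · rw [hconj, Prod.inv_mk, inv_one]
    rfl

end Semidirect

section Shear

variable {K W : Type*} [AddCommGroup W]

theorem bijective_coprod_of_sq_zero [Ring K] [Module K W] {N : W →ₗ[K] W}
    (hN : ∀ w, N (N w) = 0) {U P : Submodule K W} (hU : IsCompl (LinearMap.ker N) U)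
    (hP : IsCompl (LinearMap.range N) P) :
    Function.Bijective ((P ⊓ LinearMap.ker N).subtype.coprod
      (U.subtype.coprod (N ∘ₗ U.subtype))) := by
  have hzero : ∀ u : U, N u = 0 → u = 0 := fun u hu =>
    Subtype.ext (Submodule.disjoint_def.1 hU.disjoint _ hu u.2)
  have hrange : ∀ w, ∃ u : U, N u = N w := fun w => by
    obtain ⟨k, hk, u, hu, rfl⟩ := Submodule.mem_sup.1 (hU.sup_eq_top ▸ Submodule.mem_top : w ∈ _)
    exact ⟨⟨u, hu⟩, by rw [map_add, LinearMap.mem_ker.1 hk, zero_add]⟩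
  constructor
  · rw [injective_iff_map_eq_zero]
    rintro ⟨⟨z, hzP, hzN⟩, a, b⟩ h
    replace h : z + (a + N b) = 0 := h
    have ha : a = 0 := hzero a <| by
      simpa only [map_add, LinearMap.mem_ker.1 hzN, hN, zero_add, add_zero, map_zero]
        using congrArg N h
    rw [ha, ZeroMemClass.coe_zero, zero_add] at h
    have hz : z = 0 := Submodule.disjoint_def.1 hP.disjoint _
      (eq_neg_of_add_eq_zero_left h ▸ neg_mem ⟨_, rfl⟩) hzP
    rw [hz, zero_add] at h
    exact Prod.ext (Subtype.ext hz) (Prod.ext ha (hzero b h))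
  · intro w
    obtain ⟨a, ha⟩ := hrange w
    obtain ⟨_, ⟨w', rfl⟩, p, hp, hsum⟩ := Submodule.mem_sup.1
      (hP.sup_eq_top ▸ Submodule.mem_top : w - a ∈ _)
    obtain ⟨b, hb⟩ := hrange w'
    have hpN : N p = 0 := by
      simpa only [map_add, map_sub, hN, ha, zero_add, sub_self] using congrArg N hsum
    refine ⟨(⟨p, hp, hpN⟩, (a, b)), ?_⟩
    change p + (a + N b) = w
    rw [hb, ← sub_add_cancel w a, ← hsum]
    abel

theorem exists_linearEquiv_of_sq_zero [Field K] [Module K W] [Module.Finite K W]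
    (N : W →ₗ[K] W) (hN : ∀ w, N (N w) = 0) :
    ∃ m r, ∃ f : ((Fin m → K) × ((Fin r → K) × (Fin r → K))) ≃ₗ[K] W,
      ∀ z a b, N (f (z, (a, b))) = f (0, (0, a)) := by
  obtain ⟨U, hU⟩ := exists_isCompl (LinearMap.ker N)
  obtain ⟨P, hP⟩ := exists_isCompl (LinearMap.range N)
  let eZ := (Module.finBasis K (P ⊓ LinearMap.ker N : Submodule K W)).equivFun.symm
  let eU := (Module.finBasis K U).equivFun.symm
  refine ⟨_, _, (eZ.prodCongr (eU.prodCongr eU)).trans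
    (LinearEquiv.ofBijective _ (bijective_coprod_of_sq_zero hN hU hP)), fun z a b => ?_⟩
  change N (eZ z + (eU a + N (eU b))) = (eZ 0 : W) + (eU 0 + N (eU a))
  rw [map_add, map_add, LinearMap.mem_ker.1 (eZ z).2.2, hN, map_zero, map_zero]
  simp only [ZeroMemClass.coe_zero, zero_add, add_zero]

theorem exists_equiv_shear {A : Type*} [CommGroup A] [Finite A] (hA : ∀ a : A, a * a = 1)
    (σ : A →* A) (hσ : ∀ a, σ (σ a) = a) :
    ∃ m r, ∃ g : CPow 2 m × V r ≃* A, ∀ z v, σ (g (z, v)) = g (z, shear r v) := by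
  let _ : Module (ZMod 2) (Additive A) := AddCommGroup.zmodModule (n := 2) fun x => by
    rw [two_nsmul]; exact hA x
  have : Module.Finite (ZMod 2) (Additive A) := Module.Finite.of_finite
  -- Written additively, `ν = σ + 1`, whose square `σ ^ 2 + 1` vanishes in characteristic two.
  let ν : A →* A := σ * MonoidHom.id A
  have hν : ∀ a, ν (ν a) = 1 := fun a => by
    change σ (σ a * a) * (σ a * a) = 1
    rw [map_mul, hσ, mul_comm a, hA]
  obtain ⟨m, r, f, hf⟩ := exists_linearEquiv_of_sq_zero
    (AddMonoidHom.toZModLinearMap 2 (MonoidHom.toAdditive ν)) hν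
  let g : CPow 2 m × V r ≃* A :=
    { toFun := fun p => (f (fun i => (p.1 i).toAdd, p.2.toAdd)).toMul
      invFun := fun a => (fun i => Multiplicative.ofAdd ((f.symm (Additive.ofMul a)).1 i),
        Multiplicative.ofAdd (f.symm (Additive.ofMul a)).2)
      left_inv := fun p => by simp
      right_inv := fun a => f.apply_symm_apply (Additive.ofMul a)
      map_mul' := fun p q => f.map_add (fun i => (p.1 i).toAdd, p.2.toAdd)
        (fun i => (q.1 i).toAdd, q.2.toAdd) }
  refine ⟨m, r, g, fun z v => ?_⟩
  have hg : σ (g (z, v)) * g (z, v) = g (1, Multiplicative.ofAdd (0, v.toAdd.1)) :=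
    hf (fun i => (z i).toAdd) v.toAdd.1 v.toAdd.2
  rw [← eq_mul_inv_iff_mul_eq, inv_eq_of_mul_eq_one_left (hA _), ← map_mul, Prod.mk_mul_mk,
    one_mul] at hg
  rw [hg]
  congr 2
  exact Multiplicative.toAdd.injective (Prod.ext (zero_add _) rfl)

theorem exists_equiv_shearSemidirect {X : Type*} [Group X] [Finite X] {A : Subgroup X}
    (hA2 : ∀ a ∈ A, a * a = 1) {t : X} (ht : t * t = 1) (htA : t ∉ A)
    (hA : ∀ x ∉ A, x * t ∈ A) :
    ∃ m r, Nonempty (X ≃* CPow 2 m × ShearSemidirect r) := by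
  have hconj : ∀ a ∈ A, t * a * t ∈ A := fun a ha =>
    hA _ fun h => htA ((A.mul_mem_cancel_right ha).1 h)
  have hsq : ∀ a : A, a * a = 1 := fun a => Subtype.ext (hA2 a a.2)
  let _ : CommGroup A := commGroupOfSq hsq
  let σ : A →* A :=
    { toFun := fun a => ⟨t * a * t, hconj a a.2⟩
      map_one' := Subtype.ext (by simp [ht])
      map_mul' := fun a b => Subtype.ext (conj_mul_of_sq ht (a : X) b) }
  have hσ : ∀ a, σ (σ a) = a := fun a => Subtype.ext <| by
    change t * (t * a * t) * t = a
    have hassoc : t * (t * a * t) * t = (t * t) * a * (t * t) := by group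
    rw [hassoc, ht, one_mul, mul_one]
  obtain ⟨m, r, g, hg⟩ := exists_equiv_shear hsq σ hσ
  have hgX : ∀ z v, t * (g (z, v) : X) * t = g (z, shear r v) := fun z v =>
    congrArg Subtype.val (hg z v)
  refine ⟨m, r, exists_equiv_prod_semidirect g _ ht htA hA (fun z => ?_) fun v => hgX 1 v⟩
  have hz := hgX z 1
  rwa [map_one, ← eq_mul_inv_iff_mul_eq, inv_eq_of_mul_eq_one_left ht] at hz

end Shear

section IndexTwo

variable {X : Type*} [Group X] {A : Subgroup X} {t : X}

/-- The elements of a commutative subgroup which are sent to their inverse by conjugation with an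
element squaring to `1`. -/
def invertedIn (A : Subgroup X) (hcomm : ∀ a ∈ A, ∀ b ∈ A, a * b = b * a) (ht : t * t = 1) :
    Subgroup X where
  carrier := {a | a ∈ A ∧ t * a * t = a⁻¹}
  one_mem' := ⟨A.one_mem, by simp [ht]⟩
  mul_mem' := fun {a b} ha hb => ⟨A.mul_mem ha.1 hb.1, by
    rw [conj_mul_of_sq ht, ha.2, hb.2, ← mul_inv_rev, hcomm b hb.1 a ha.1]⟩
  inv_mem' := fun {a} ha => ⟨A.inv_mem ha.1, by rw [conj_inv_of_sq ht, ha.2]⟩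

theorem mem_invertedIn_one {hcomm : ∀ a ∈ A, ∀ b ∈ A, a * b = b * a} {a : X} :
    a ∈ invertedIn A hcomm (one_mul 1) ↔ a ∈ A ∧ a * a = 1 :=
  and_congr_right' one_mul_mul_one_eq_inv_iff

theorem Inverts.mul_self_of_notMem (h : Inverts t A) (hA : ∀ x ∉ A, x * t ∈ A) {x : X}
    (hx : x ∉ A) : x * x = 1 := by
  have hxt := h.conj _ (hA x hx)
  rw [mul_inv_rev, inv_eq_of_mul_eq_one_left h.sq, mul_assoc, mul_assoc, h.sq, mul_one] at hxt
  exact mul_eq_one_iff_eq_inv.2 (mul_left_cancel hxt)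

variable [Finite X]

theorem numInvol_le_card_add_card (hcomm : ∀ a ∈ A, ∀ b ∈ A, a * b = b * a) (ht : t * t = 1)
    (hA : ∀ x ∉ A, x * t ∈ A) :
    numInvol X ≤ Nat.card (invertedIn A hcomm (one_mul 1)) + Nat.card (invertedIn A hcomm ht) := by
  classical
  have hin : ∀ g : {g : X // g * g = 1}, g.1 ∈ A → g.1 ∈ invertedIn A hcomm (one_mul 1) :=
    fun g hg => mem_invertedIn_one.2 ⟨hg, g.2⟩
  have hout : ∀ g : {g : X // g * g = 1}, g.1 ∉ A → g.1 * t ∈ invertedIn A hcomm ht :=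
    fun g hg => ⟨hA _ hg, by
      rw [mul_inv_rev, inv_eq_of_mul_eq_one_left ht, inv_eq_of_mul_eq_one_left g.2, mul_assoc,
        mul_assoc, ht, mul_one]⟩
  rw [← Nat.card_sum, numInvol]
  refine Nat.card_le_card_of_injective (fun g => if h : g.1 ∈ A
    then Sum.inl ⟨g.1, hin g h⟩ else Sum.inr ⟨g.1 * t, hout g h⟩) fun g g' h => ?_
  dsimp only at h
  split_ifs at h <;> exact Subtype.ext (by simpa using h)

theorem mul_self_or_inverts (hcomm : ∀ a ∈ A, ∀ b ∈ A, a * b = b * a)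
    (hX : Nat.card X < 2 * numInvol X) (hcard : Nat.card X = 2 * Nat.card A) (ht : t * t = 1)
    (hA : ∀ x ∉ A, x * t ∈ A) : (∀ a ∈ A, a * a = 1) ∨ Inverts t A := by
  by_contra! hc
  obtain ⟨⟨a, haA, ha⟩, hinv⟩ := hc
  obtain ⟨b, hbA, hb⟩ : ∃ b ∈ A, t * b * t ≠ b⁻¹ := by
    by_contra! h
    exact hinv ⟨ht, h⟩
  have hsquares : 2 * Nat.card (invertedIn A hcomm (one_mul 1)) ≤ Nat.card A :=
    two_mul_card_le_of_notMem (fun _ h => h.1) haA fun h => ha (mem_invertedIn_one.1 h).2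
  have hinverted : 2 * Nat.card (invertedIn A hcomm ht) ≤ Nat.card A :=
    two_mul_card_le_of_notMem (fun _ h => h.1) hbA fun h => hb h.2
  have := numInvol_le_card_add_card hcomm ht hA
  omega

theorem mul_self_of_involutions_mem (hcomm : ∀ a ∈ A, ∀ b ∈ A, a * b = b * a)
    (hX : Nat.card X < 2 * numInvol X) (h : ∀ x : X, x * x = 1 → x ∈ A) (x : X) : x * x = 1 := by
  by_contra hx
  have hindex := two_mul_card_le_of_notMem (B := invertedIn A hcomm (one_mul 1)) (M := ⊤) le_top
    (Subgroup.mem_top x) fun hmem => hx (mem_invertedIn_one.1 hmem).2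
  have hle : numInvol X ≤ Nat.card (invertedIn A hcomm (one_mul 1)) :=
    Nat.card_le_card_of_injective
      (fun g : {g : X // g * g = 1} => ⟨g.1, mem_invertedIn_one.2 ⟨h g.1 g.2, g.2⟩⟩)
      fun _ _ hgg => Subtype.ext (Subtype.mk.inj hgg)
  rw [Subgroup.card_top] at hindex
  omega

theorem exists_equiv_invSemidirect_cpow (hcomm : ∀ a ∈ A, ∀ b ∈ A, a * b = b * a)
    (hcard : Nat.card X = 2 * Nat.card A) (htA : t ∉ A) (hA : ∀ x ∉ A, x * t ∈ A)
    (h : Inverts t A) (hα : 3 / 4 < alpha X) (hsq : ¬ ∀ x : X, x * x = 1) :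
    (∃ m n, 1 ≤ n ∧ Nonempty (X ≃* CPow 2 m × InvSemidirect (CPow 3 n))) ∨
      ∃ m n, 1 ≤ n ∧ Nonempty (X ≃* CPow 2 m × InvSemidirect (CPow 4 n)) := by
  let _ : CommGroup A := { (inferInstance : Group A) with
    mul_comm := fun a b => Subtype.ext (hcomm a a.2 b b.2) }
  rw [alpha_eq_of_subgroup hcard fun _ hx => h.mul_self_of_notMem hA hx] at hα
  rcases pow_four_or_pow_six (A := A) (by linarith) with hp | hp
  · obtain ⟨m, n, ⟨f⟩⟩ := exists_equiv_of_pow_four hp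
    obtain ⟨e⟩ := exists_equiv_invSemidirect f htA hA h
    refine Or.inr ⟨m, n, Nat.one_le_iff_ne_zero.2 ?_, ⟨e⟩⟩
    rintro rfl
    exact hsq (mul_self_of_equiv_of_subsingleton e)
  · obtain ⟨m, n, ⟨f⟩⟩ := exists_equiv_of_pow_six hp
    obtain ⟨e⟩ := exists_equiv_invSemidirect f htA hA h
    refine Or.inl ⟨m, n, Nat.one_le_iff_ne_zero.2 ?_, ⟨e⟩⟩
    rintro rfl
    exact hsq (mul_self_of_equiv_of_subsingleton e)

theorem exists_equiv_of_comm_subgroup (hcomm : ∀ a ∈ A, ∀ b ∈ A, a * b = b * a)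
    (hcard : Nat.card X ≤ 2 * Nat.card A) (hα : 3 / 4 < alpha X) :
    (∀ x : X, x * x = 1) ∨
      (∃ m n, 1 ≤ n ∧ Nonempty (X ≃* CPow 2 m × InvSemidirect (CPow 3 n))) ∨
      (∃ m n, 1 ≤ n ∧ Nonempty (X ≃* CPow 2 m × InvSemidirect (CPow 4 n))) ∨
      ∃ m r, 1 ≤ r ∧ Nonempty (X ≃* CPow 2 m × ShearSemidirect r) := by
  have hX := card_lt_two_mul_numInvol hα
  by_cases hsq : ∀ x : X, x * x = 1
  · exact Or.inl hsq
  obtain ⟨t, ht, htA⟩ : ∃ t : X, t * t = 1 ∧ t ∉ A := by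
    by_contra! hmem
    exact hsq (mul_self_of_involutions_mem hcomm hX hmem)
  have hindex : Nat.card X = 2 * Nat.card A := by
    have := two_mul_card_le_of_notMem (B := A) (M := ⊤) le_top (Subgroup.mem_top t) htA
    rw [Subgroup.card_top] at this
    omega
  have hpos : 0 < Nat.card A := Nat.card_pos
  have hA : ∀ x ∉ A, x * t ∈ A := fun x hx => mul_mem_of_card_lt (M := ⊤) le_top
    (by rw [Subgroup.card_top]; omega) (Subgroup.mem_top x) (Subgroup.mem_top t) hx htA
  right
  rcases mul_self_or_inverts hcomm hX hindex ht hA with hA2 | hinv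
  · obtain ⟨m, r, ⟨e⟩⟩ := exists_equiv_shearSemidirect hA2 ht htA hA
    refine Or.inr (Or.inr ⟨m, r, Nat.one_le_iff_ne_zero.2 ?_, ⟨e⟩⟩)
    rintro rfl
    exact hsq (mul_self_of_equiv_of_subsingleton e)
  · rw [← or_assoc]
    exact Or.inl (exists_equiv_invSemidirect_cpow hcomm hindex htA hA hinv hα hsq)

end IndexTwo

open scoped commutatorElement

/-! ### The model groups -/

section NoFactor

theorem not_hasC2Factor {G : Type*} [Group G]
    (h : ∀ z ∈ Subgroup.center G, z * z = 1 → z ∈ commutator G) : ¬ HasC2Factor G := by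
  rintro ⟨H, K, hH, hK, hHK, ⟨e⟩⟩
  obtain ⟨z, hz⟩ := e.surjective (Multiplicative.ofAdd 1)
  have hz_ne : z ≠ 1 := by
    rw [← e.map_ne_one_iff, hz]; decide
  have hz_sq : z * z = 1 := by
    rw [← e.map_eq_one_iff, map_mul, hz]; decide
  have heq : ∀ a : H, a = 1 ∨ a = z := fun a =>
    (C_two_eq_one_or (e a)).imp e.map_eq_one_iff.1 fun ha => e.injective (ha.trans hz.symm)
  have hcenter : (z : G) ∈ Subgroup.center G := Subgroup.mem_center_iff.2 fun g => by
    have hconj : (⟨g * z * g⁻¹, hH.conj_mem _ z.2 g⟩ : H) ≠ 1 := fun hg =>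
      hz_ne (Subtype.ext (conj_eq_one_iff.1 (congrArg Subtype.val hg)))
    exact mul_inv_eq_iff_eq_mul.1 (congrArg Subtype.val ((heq _).resolve_left hconj))
  have hcomm : IsMulCommutative H := ⟨⟨fun a b => e.injective (by rw [map_mul, map_mul, mul_comm])⟩⟩
  have hzK : (z : G) ∈ K :=
    Subgroup.Normal.commutator_le_of_self_sup_commutative_eq_top hHK.symm.sup_eq_top hcomm
      (h z hcenter (congrArg Subtype.val hz_sq))
  exact hz_ne (Subtype.ext (Subgroup.disjoint_def.1 hHK.disjoint z.2 hzK))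

theorem HasC2Factor.map {G G' : Type*} [Group G] [Group G'] (e : G ≃* G') (h : HasC2Factor G) :
    HasC2Factor G' := by
  obtain ⟨H, K, hH, hK, hHK, ⟨f⟩⟩ := h
  exact ⟨H.map e.toMonoidHom, K.map e.toMonoidHom, hH.map _ e.surjective, hK.map _ e.surjective,
    e.mapSubgroup.isCompl hHK, ⟨(e.subgroupMap H).symm.trans f⟩⟩

end NoFactor

section Involutions

theorem numInvol_pi (G : Type*) [Group G] (ι : Type*) [Finite ι] :
    numInvol (ι → G) = numInvol G ^ Nat.card ι := by
  have e : {g : ι → G // g * g = 1} ≃ (ι → {x : G // x * x = 1}) :=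
    (Equiv.subtypeEquivRight fun g => funext_iff).trans
      (Equiv.subtypePiEquivPi (p := fun _ x => x * x = 1))
  rw [numInvol, Nat.card_congr e, Nat.card_fun, numInvol]

theorem numInvol_prod (G : Type*) (H : Type*) [Group G] [Group H] :
    numInvol (G × H) = numInvol G * numInvol H := by
  have e : {g : G × H // g * g = 1} ≃ {x : G // x * x = 1} × {x : H // x * x = 1} :=
    (Equiv.subtypeEquivRight fun g => Prod.ext_iff).trans
      (Equiv.subtypeProdEquivProd (p := fun x => x * x = 1) (q := fun x => x * x = 1))
  rw [numInvol, Nat.card_congr e, Nat.card_prod, numInvol, numInvol]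

theorem card_mul_numInvol_quotient {G : Type*} [Group G] (N : Subgroup G) [N.Normal] :
    Nat.card N * numInvol (G ⧸ N) = Nat.card {a : G // a * a ∈ N} :=
  (QuotientGroup.card_preimage_mk N {g : G ⧸ N | g * g = 1}).symm.trans
    (Nat.card_congr (Equiv.subtypeEquivRight fun a => QuotientGroup.eq_one_iff (a * a)))

theorem alpha_eq_of_mul_numInvol_eq {G : Type*} [Group G] [Finite G]
    (hord : ∀ g : G, orderOf g ∣ 4 ∨ orderOf g ∣ 6) {k : ℕ} (hk : k ≠ 0)
    (hI : 2 * k * numInvol G = (k + 1) * Nat.card G) : alpha G = (3 * k + 1) / (4 * k) := by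
  have hG : (Nat.card G : ℚ) ≠ 0 := by exact_mod_cast Nat.card_pos.ne'
  have hI' : (2 * k * numInvol G : ℚ) = (k + 1) * Nat.card G := by exact_mod_cast hI
  rw [alpha_eq_of_orderOf_dvd hord, div_eq_div_iff (by positivity) (by positivity)]
  linear_combination 2 * hI'

end Involutions

section SemidirectModels

theorem apply_left_of_mem_center {N G : Type*} [Group N] [Group G]
    {φ : G →* MulAut N} {g : N ⋊[φ] G} (hg : g ∈ Subgroup.center (N ⋊[φ] G)) (c : G) :
    φ c g.left = g.left := by
  simpa using congrArg SemidirectProduct.left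
    (Subgroup.mem_center_iff.1 hg (SemidirectProduct.inr c))

theorem apply_right_of_mem_center {N G : Type*} [CommGroup N] [Group G]
    {φ : G →* MulAut N} {g : N ⋊[φ] G} (hg : g ∈ Subgroup.center (N ⋊[φ] G)) :
    φ g.right = 1 := by
  refine MulEquiv.ext fun n => ?_
  have h := congrArg SemidirectProduct.left
    (Subgroup.mem_center_iff.1 hg (SemidirectProduct.inl n))
  simpa [mul_comm n] using h.symm

theorem commutator_inr_inl {N G : Type*} [Group N] [Group G] (φ : G →* MulAut N) (c : G) (n : N) :
    ⁅(SemidirectProduct.inr c : N ⋊[φ] G), (SemidirectProduct.inl n : N ⋊[φ] G)⁆ =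
      SemidirectProduct.inl (φ c n * n⁻¹) := by
  rw [commutatorElement_def, map_mul, SemidirectProduct.inl_aut, map_inv, map_inv]

variable {M : Type*} [CommGroup M]

theorem not_hasC2Factor_semidirect {φ : MulAut M} (hφ : φ * φ = 1) (hne : φ ≠ 1)
    (h : ∀ a, φ a = a → a * a = 1 → ∃ b, φ b * b⁻¹ = a) :
    ¬ HasC2Factor (M ⋊[involutionHom φ hφ] C 2) := by
  refine not_hasC2Factor fun g hg hsq => ?_
  have hright : g.right = 1 := (C_two_eq_one_or g.right).resolve_right fun hr => hne <| by
    rw [← involutionHom_ofAdd_one φ hφ, ← hr, apply_right_of_mem_center hg]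
  have hfix : φ g.left = g.left := by
    simpa only [involutionHom_ofAdd_one] using
      apply_left_of_mem_center hg (Multiplicative.ofAdd 1)
  have hleft_sq : g.left * g.left = 1 := by
    simpa [hright] using congrArg SemidirectProduct.left hsq
  obtain ⟨b, hb⟩ := h g.left hfix hleft_sq
  have hcomm : g = ⁅(SemidirectProduct.inr (Multiplicative.ofAdd (1 : ZMod 2)) :
      M ⋊[involutionHom φ hφ] C 2), (SemidirectProduct.inl b : M ⋊[involutionHom φ hφ] C 2)⁆ := by
    rw [commutator_inr_inl, involutionHom_ofAdd_one, hb]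
    exact SemidirectProduct.ext rfl hright
  rw [hcomm]
  exact Subgroup.commutator_mem_commutator (Subgroup.mem_top _) (Subgroup.mem_top _)

theorem alpha_invSemidirect [Finite M] : alpha (InvSemidirect M) = (alpha M + 1) / 2 := by
  have : Finite (InvSemidirect M) := Finite.of_equiv _ SemidirectProduct.equivProd.symm
  let A : Subgroup (InvSemidirect M) := MonoidHom.range SemidirectProduct.inl
  let e : M ≃* A := MonoidHom.ofInjective SemidirectProduct.inl_injective
  rw [alpha_congr e]
  refine alpha_eq_of_subgroup ?_ ?_
  · rw [SemidirectProduct.card, ← Nat.card_congr e.toEquiv, mul_comm]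
    exact congrArg (· * _) (Nat.card_zmod 2)
  · rintro ⟨a, c⟩ hmem
    rcases C_two_eq_one_or c with rfl | rfl
    · exact absurd ⟨a, rfl⟩ hmem
    · refine SemidirectProduct.ext ?_ ((by decide : ∀ c : C 2, c * c = 1) _)
      rw [SemidirectProduct.mul_left, involutionHom_ofAdd_one]
      exact mul_inv_cancel a

theorem not_hasC2Factor_invSemidirect (hne : ∃ w : M, w⁻¹ ≠ w)
    (h : ∀ a : M, a * a = 1 → ∃ b, b * b = a) : ¬ HasC2Factor (InvSemidirect M) := by
  obtain ⟨w, hw⟩ := hne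
  refine not_hasC2Factor_semidirect _ (fun hinv => hw (DFunLike.congr_fun hinv w)) fun a _ ha => ?_
  obtain ⟨b, rfl⟩ := h a ha
  exact ⟨b⁻¹, by rw [MulEquiv.inv_apply, inv_inv]⟩

theorem card_cpow (k n : ℕ) : Nat.card (CPow k n) = k ^ n := by
  rw [Nat.card_fun, Nat.card_fin]
  exact congrArg (· ^ n) (Nat.card_zmod k)

theorem numInvol_C_three : numInvol (C 3) = 1 := by
  rw [numInvol_eq_card_filter]; decide

theorem numInvol_C_four : numInvol (C 4) = 2 := by
  rw [numInvol_eq_card_filter]; decide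

theorem alpha_invSemidirect_cpow_three (n : ℕ) :
    alpha (InvSemidirect (CPow 3 n)) = (3 * 3 ^ n + 1) / (4 * 3 ^ n) := by
  have hord : ∀ g : CPow 3 n, orderOf g ∣ 6 := fun g => orderOf_dvd_of_pow_eq_one <|
    funext fun i => (by decide : ∀ x : C 3, x ^ 6 = 1) (g i)
  rw [alpha_invSemidirect, alpha_eq_of_orderOf_dvd fun g => Or.inr (hord g), card_cpow,
    numInvol_pi, numInvol_C_three]
  push_cast
  field_simp
  ring

theorem alpha_invSemidirect_cpow_four (n : ℕ) :
    alpha (InvSemidirect (CPow 4 n)) = (3 * 2 ^ n + 1) / (4 * 2 ^ n) := by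
  have hord : ∀ g : CPow 4 n, orderOf g ∣ 4 := fun g => orderOf_dvd_of_pow_eq_one <|
    funext fun i => (by decide : ∀ x : C 4, x ^ 4 = 1) (g i)
  rw [alpha_invSemidirect, alpha_eq_of_orderOf_dvd fun g => Or.inl (hord g), card_cpow,
    numInvol_pi, numInvol_C_four, Nat.card_fin]
  push_cast
  rw [show (4 : ℚ) = 2 * 2 by norm_num, mul_pow]
  field_simp
  ring

theorem not_hasC2Factor_invSemidirect_cpow_three {n : ℕ} (hn : 1 ≤ n) :
    ¬ HasC2Factor (InvSemidirect (CPow 3 n)) := by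
  have hroot : ∀ x : C 3, x * x = 1 → 1 * 1 = x := by decide
  refine not_hasC2Factor_invSemidirect ⟨fun _ => Multiplicative.ofAdd 1, fun hinv => ?_⟩
    fun a ha => ⟨1, funext fun i => hroot _ (congrFun ha i)⟩
  exact absurd (congrFun hinv ⟨0, hn⟩) (by decide : (Multiplicative.ofAdd (1 : ZMod 3))⁻¹ ≠ _)

theorem not_hasC2Factor_invSemidirect_cpow_four {n : ℕ} (hn : 1 ≤ n) :
    ¬ HasC2Factor (InvSemidirect (CPow 4 n)) := by
  have hroot : ∀ x : C 4, x * x = 1 → ∃ y, y * y = x := by decide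
  refine not_hasC2Factor_invSemidirect ⟨fun _ => Multiplicative.ofAdd 1, fun hinv => ?_⟩
    fun a ha => ?_
  · exact absurd (congrFun hinv ⟨0, hn⟩) (by decide : (Multiplicative.ofAdd (1 : ZMod 4))⁻¹ ≠ _)
  · choose b hb using fun i => hroot _ (congrFun ha i)
    exact ⟨b, funext hb⟩

end SemidirectModels

section ShearModel

variable {r : ℕ}

theorem V_mul_self (v : V r) : v * v = 1 :=
  Multiplicative.toAdd.injective (ZModModule.add_self v.toAdd)

theorem mul_shear (v : V r) : v * shear r v = Multiplicative.ofAdd (0, v.toAdd.1) := by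
  refine Multiplicative.toAdd.injective (Prod.ext (ZModModule.add_self v.toAdd.1) ?_)
  change v.toAdd.2 + (v.toAdd.1 + v.toAdd.2) = v.toAdd.1
  rw [add_left_comm, ZModModule.add_self, add_zero]

theorem not_hasC2Factor_shearSemidirect (hr : 1 ≤ r) : ¬ HasC2Factor (ShearSemidirect r) := by
  refine not_hasC2Factor_semidirect _ (fun hone => ?_) fun a ha _ => ?_
  · have hy : V.y (⟨0, hr⟩ : Fin r) = 1 := by
      rw [← mul_eq_left (a := V.x ⟨0, hr⟩), ← shear_x, hone, MulAut.one_apply]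
    have hy_apply := congrFun (congrArg (fun v : V r => v.toAdd.2) hy) ⟨0, hr⟩
    simp [V.y] at hy_apply
  · have hfst : a.toAdd.1 = 0 := by
      have hmul := mul_shear a
      rw [ha, V_mul_self] at hmul
      exact (congrArg (fun v : V r => v.toAdd.2) hmul).symm
    refine ⟨Multiplicative.ofAdd (a.toAdd.2, 0), ?_⟩
    rw [inv_eq_of_mul_eq_one_left (V_mul_self _), mul_comm, mul_shear]
    exact Multiplicative.toAdd.injective (Prod.ext hfst.symm rfl)

theorem shearSemidirect_mul_self (v : V r) (c : C 2) :
    (⟨v, c⟩ * ⟨v, c⟩ : ShearSemidirect r) =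
      SemidirectProduct.inl (if c = 1 then 1 else Multiplicative.ofAdd (0, v.toAdd.1)) := by
  refine SemidirectProduct.ext ?_ ((by decide : ∀ c : C 2, c * c = 1) c)
  rcases C_two_eq_one_or c with rfl | rfl
  · rw [SemidirectProduct.mul_left, map_one]
    exact V_mul_self v
  · rw [SemidirectProduct.mul_left, involutionHom_ofAdd_one]
    exact mul_shear v

theorem shearSemidirect_pow_four (g : ShearSemidirect r) : g ^ 4 = 1 := by
  rw [show 4 = 2 * 2 from rfl, pow_mul, pow_two g, shearSemidirect_mul_self, ← map_pow, pow_two,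
    V_mul_self, map_one]

theorem shearSemidirect_mul_self_eq_one_iff (v : V r) (c : C 2) :
    (⟨v, c⟩ * ⟨v, c⟩ : ShearSemidirect r) = 1 ↔ c = 1 ∨ v.toAdd.1 = 0 := by
  rw [shearSemidirect_mul_self, map_eq_one_iff _ SemidirectProduct.inl_injective]
  by_cases hc : c = 1
  · simp only [hc, if_true, true_or]
  · simp only [hc, if_false, false_or, ofAdd_eq_one, Prod.mk_eq_zero, true_and]

theorem card_fun_zmod_two (r : ℕ) : Nat.card (Fin r → ZMod 2) = 2 ^ r := by
  rw [Nat.card_fun, Nat.card_fin, Nat.card_zmod]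

theorem card_V (r : ℕ) : Nat.card (V r) = 2 ^ r * 2 ^ r := by
  rw [← card_fun_zmod_two, ← Nat.card_prod]
  rfl

theorem card_shearSemidirect (r : ℕ) : Nat.card (ShearSemidirect r) = 2 ^ r * 2 ^ r * 2 := by
  rw [SemidirectProduct.card, card_V]
  exact congrArg _ (Nat.card_zmod 2)

theorem numInvol_shearSemidirect (r : ℕ) :
    numInvol (ShearSemidirect r) = 2 ^ r * 2 ^ r + 2 ^ r := by
  rw [← card_V, ← card_fun_zmod_two, ← Nat.card_sum]
  let f : V r ⊕ (Fin r → ZMod 2) → {g : ShearSemidirect r // g * g = 1} :=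
    Sum.elim
      (fun v => ⟨⟨v, 1⟩, (shearSemidirect_mul_self_eq_one_iff v 1).2 (Or.inl rfl)⟩)
      fun b => ⟨⟨Multiplicative.ofAdd (0, b), Multiplicative.ofAdd 1⟩,
        (shearSemidirect_mul_self_eq_one_iff _ _).2 (Or.inr rfl)⟩
  refine (Nat.card_eq_of_bijective f ⟨?_, ?_⟩).symm
  · have hright : (1 : C 2) ≠ Multiplicative.ofAdd 1 := by decide
    rintro (v | b) (v' | b') h
    · exact congrArg (fun g => Sum.inl g.1.left) h
    · exact absurd (congrArg (fun g => g.1.right) h) hright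
    · exact absurd (congrArg (fun g => g.1.right) h) hright.symm
    · exact congrArg (fun g => Sum.inr g.1.left.toAdd.2) h
  · rintro ⟨⟨v, c⟩, hg⟩
    rcases C_two_eq_one_or c with rfl | rfl
    · exact ⟨Sum.inl v, rfl⟩
    · have hfst : v.toAdd.1 = 0 :=
        ((shearSemidirect_mul_self_eq_one_iff v _).1 hg).resolve_left (by decide)
      exact ⟨Sum.inr v.toAdd.2, Subtype.ext (SemidirectProduct.ext
        (Multiplicative.toAdd.injective (Prod.ext hfst.symm rfl)) rfl)⟩

theorem alpha_shearSemidirect (r : ℕ) :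
    alpha (ShearSemidirect r) = (3 * 2 ^ r + 1) / (4 * 2 ^ r) := by
  have : Finite (ShearSemidirect r) := Finite.of_equiv _ SemidirectProduct.equivProd.symm
  have hI : 2 * 2 ^ r * numInvol (ShearSemidirect r) =
      (2 ^ r + 1) * Nat.card (ShearSemidirect r) := by
    rw [numInvol_shearSemidirect, card_shearSemidirect]; ring
  simpa using alpha_eq_of_mul_numInvol_eq
    (fun g => Or.inl (orderOf_dvd_of_pow_eq_one (shearSemidirect_pow_four g))) (by positivity) hI

end ShearModel

section DihedralModels

theorem D8.pow_four (x : D8) : x ^ 4 = 1 := by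
  decide +revert

theorem card_D8 : Nat.card D8 = 8 :=
  DihedralGroup.nat_card

theorem numInvol_D8 : numInvol D8 = 6 := by
  rw [numInvol_eq_card_filter]; decide

theorem D8.mul_self_mem_center (x : D8) : x * x ∈ Subgroup.center D8 := by
  rw [Subgroup.mem_center_iff]; decide +revert

theorem D8.exists_commutator_eq {z : D8} (hz : z ∈ Subgroup.center D8) :
    ∃ x y : D8, ⁅x, y⁆ = z := by
  rcases D8.eq_of_mem_center hz with rfl | rfl
  · exact ⟨1, 1, by decide⟩
  · exact ⟨.r 1, .sr 0, by decide⟩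

theorem alpha_D8_prod_D8 : alpha (D8 × D8) = 25 / 32 := by
  have hord : ∀ g : D8 × D8, orderOf g ∣ 4 := fun g =>
    orderOf_dvd_of_pow_eq_one (Prod.ext (D8.pow_four g.1) (D8.pow_four g.2))
  rw [alpha_eq_of_orderOf_dvd fun g => Or.inl (hord g), Nat.card_prod, numInvol_prod, numInvol_D8,
    card_D8]
  norm_num

theorem not_hasC2Factor_D8_prod_D8 : ¬ HasC2Factor (D8 × D8) := by
  refine not_hasC2Factor ?_
  rintro ⟨x, y⟩ hcenter _
  rw [Subgroup.mem_center_iff] at hcenter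
  obtain ⟨a, b, rfl⟩ := D8.exists_commutator_eq
    (Subgroup.mem_center_iff.2 fun g => congrArg Prod.fst (hcenter (g, 1)))
  obtain ⟨c, d, rfl⟩ := D8.exists_commutator_eq
    (Subgroup.mem_center_iff.2 fun g => congrArg Prod.snd (hcenter (1, g)))
  exact Subgroup.commutator_mem_commutator (Subgroup.mem_top (a, c)) (Subgroup.mem_top (b, d))

end DihedralModels

section CentralProductModel

open scoped IsMulCommutative

variable {r : ℕ}

theorem mem_centralN_iff {a : Fin r → D8} {z : Fin r → Subgroup.center D8}
    (hz : ∀ i, (z i : D8) = a i) : a ∈ centralN r ↔ ∏ i, z i = 1 := by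
  refine ⟨?_, fun hprod => ⟨z, hz, hprod⟩⟩
  rintro ⟨w, hw, hprod⟩
  obtain rfl : w = z := funext fun i => Subtype.ext ((hw i).trans (hz i).symm)
  exact hprod

theorem eq_one_of_mulSingle_mem_centralN {i : Fin r} {c : D8}
    (h : Pi.mulSingle i c ∈ centralN r) : c = 1 := by
  obtain ⟨z, hz, hprod⟩ := h
  have hne : ∀ j, j ≠ i → z j = 1 := fun j hj => Subtype.ext (by
    rw [hz, Pi.mulSingle_eq_of_ne hj, OneMemClass.coe_one])
  rw [Fintype.prod_eq_single i hne] at hprod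
  rw [← Pi.mulSingle_eq_same (M := fun _ => D8) i c, ← hz, hprod, OneMemClass.coe_one]

theorem mk_eq_mk_mulSingle_prod (z : Fin r → Subgroup.center D8) (i₀ : Fin r) :
    (QuotientGroup.mk fun i => (z i : D8) : CentralProductD8 r) =
      QuotientGroup.mk (Pi.mulSingle i₀ ((∏ i, z i : Subgroup.center D8) : D8)) := by
  set w := ∏ i, z i with hw
  refine QuotientGroup.eq.2 ((mem_centralN_iff (z := z⁻¹ * Pi.mulSingle i₀ w) fun i => ?_).2 ?_)
  · obtain rfl | hi := eq_or_ne i i₀ <;> simp [*]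
  · simp only [Pi.mul_apply, Pi.inv_apply]
    rw [Finset.prod_mul_distrib, Finset.prod_inv_distrib, Finset.prod_pi_mulSingle',
      if_pos (Finset.mem_univ _), hw, inv_mul_cancel]

theorem apply_mem_center_of_mk_mem_center {a : Fin r → D8}
    (ha : (QuotientGroup.mk a : CentralProductD8 r) ∈ Subgroup.center (CentralProductD8 r))
    (i : Fin r) : a i ∈ Subgroup.center D8 := by
  refine Subgroup.mem_center_iff.2 fun y => ?_
  have hcomm : QuotientGroup.mk' (centralN r) ⁅a, (Pi.mulSingle i y : Fin r → D8)⁆ = 1 := by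
    rw [map_commutatorElement, commutatorElement_eq_one_iff_mul_comm]
    exact (Subgroup.mem_center_iff.1 ha _).symm
  rw [commutator_mulSingle] at hcomm
  exact (commutatorElement_eq_one_iff_mul_comm.1
    (eq_one_of_mulSingle_mem_centralN ((QuotientGroup.eq_one_iff _).1 hcomm))).symm

theorem not_hasC2Factor_centralProductD8 (hr : 1 ≤ r) : ¬ HasC2Factor (CentralProductD8 r) := by
  refine not_hasC2Factor fun g hg _ => ?_
  obtain ⟨a, rfl⟩ := QuotientGroup.mk_surjective g
  let z : Fin r → Subgroup.center D8 := fun i => ⟨a i, apply_mem_center_of_mk_mem_center hg i⟩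
  obtain ⟨x, y, hxy⟩ := D8.exists_commutator_eq (∏ i, z i).2
  have hcomm : (QuotientGroup.mk a : CentralProductD8 r) =
      QuotientGroup.mk' (centralN r)
        ⁅(Pi.mulSingle ⟨0, hr⟩ x : Fin r → D8), (Pi.mulSingle ⟨0, hr⟩ y : Fin r → D8)⁆ := by
    rw [commutator_mulSingle, Pi.mulSingle_eq_same, hxy]
    exact mk_eq_mk_mulSingle_prod z ⟨0, hr⟩
  rw [hcomm, map_commutatorElement]
  exact Subgroup.commutator_mem_commutator (Subgroup.mem_top _) (Subgroup.mem_top _)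

/-- The faithful character of the centre of the dihedral group of order `8`. It detects membership
in `centralN`, which makes the elements of `D8 ^ r` with square in `centralN` countable by a
product of character sums. -/
def centerSign : Subgroup.center D8 →* ℤ where
  toFun z := if z = 1 then 1 else -1
  map_one' := if_pos rfl
  map_mul' := by decide

open scoped Classical in
theorem prod_centerSign_mul_self (a : Fin r → D8) :
    ∏ i, centerSign ⟨a i * a i, D8.mul_self_mem_center _⟩ =
      2 * (if a * a ∈ centralN r then 1 else 0) - 1 := by
  have hmem : a * a ∈ centralN r ↔
      ∏ i, (⟨a i * a i, D8.mul_self_mem_center _⟩ : Subgroup.center D8) = 1 :=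
    mem_centralN_iff fun _ => rfl
  rw [← map_prod, if_congr hmem rfl rfl]
  change (if _ then (1 : ℤ) else -1) = _
  split_ifs <;> rfl

theorem sum_prod_centerSign_mul_self (r : ℕ) :
    ∑ a : Fin r → D8, ∏ i, centerSign ⟨a i * a i, D8.mul_self_mem_center _⟩ = 4 ^ r := by
  have hsum : ∑ x : D8, centerSign ⟨x * x, D8.mul_self_mem_center x⟩ = 4 := by decide
  rw [← Fintype.piFinset_univ,
    ← Finset.prod_univ_sum _ fun _ x => centerSign ⟨x * x, D8.mul_self_mem_center x⟩, hsum,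
    Finset.prod_const, Finset.card_univ, Fintype.card_fin]

theorem card_pi_D8 (r : ℕ) : Nat.card (Fin r → D8) = 8 ^ r := by
  rw [Nat.card_fun, card_D8, Nat.card_fin]

theorem two_mul_card_mul_self_mem_centralN (r : ℕ) :
    2 * Nat.card {a : Fin r → D8 // a * a ∈ centralN r} = 8 ^ r + 4 ^ r := by
  classical
  have hsum := sum_prod_centerSign_mul_self r
  rw [Finset.sum_congr rfl fun a _ => prod_centerSign_mul_self a, Finset.sum_sub_distrib,
    ← Finset.mul_sum, Finset.sum_boole, Finset.sum_const, Finset.card_univ,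
    ← Nat.card_eq_fintype_card, card_pi_D8, nsmul_one] at hsum
  rw [Nat.card_eq_fintype_card, Fintype.card_subtype]
  zify
  push_cast at hsum
  linear_combination hsum

theorem mul_numInvol_centralProductD8 (r : ℕ) :
    2 * 2 ^ r * numInvol (CentralProductD8 r) = (2 ^ r + 1) * Nat.card (CentralProductD8 r) := by
  have hcard : Nat.card (centralN r) * Nat.card (CentralProductD8 r) = 8 ^ r := by
    rw [mul_comm, ← Subgroup.card_eq_card_quotient_mul_card_subgroup, card_pi_D8]
  have hI : 2 * (Nat.card (centralN r) * numInvol (CentralProductD8 r)) = 8 ^ r + 4 ^ r := by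
    rw [card_mul_numInvol_quotient, two_mul_card_mul_self_mem_centralN]
  have hpow : 8 ^ r = 2 ^ r * 4 ^ r := by rw [← mul_pow]; rfl
  refine Nat.eq_of_mul_eq_mul_left (Nat.card_pos (α := centralN r)) ?_
  calc Nat.card (centralN r) * (2 * 2 ^ r * numInvol (CentralProductD8 r))
      = 2 ^ r * (2 * (Nat.card (centralN r) * numInvol (CentralProductD8 r))) := by ring
    _ = (2 ^ r + 1) * 8 ^ r := by rw [hI, hpow]; ring
    _ = Nat.card (centralN r) * ((2 ^ r + 1) * Nat.card (CentralProductD8 r)) := by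
      rw [← hcard]; ring

theorem alpha_centralProductD8 (r : ℕ) :
    alpha (CentralProductD8 r) = (3 * 2 ^ r + 1) / (4 * 2 ^ r) := by
  have hord : ∀ g : CentralProductD8 r, orderOf g ∣ 4 := fun g => by
    obtain ⟨a, rfl⟩ := QuotientGroup.mk_surjective g
    refine orderOf_dvd_of_pow_eq_one ?_
    rw [← QuotientGroup.mk_pow, show a ^ 4 = 1 from funext fun i => D8.pow_four (a i),
      QuotientGroup.mk_one]
  simpa using alpha_eq_of_mul_numInvol_eq (fun g => Or.inl (hord g)) (by positivity)
    (mul_numInvol_centralProductD8 r)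

end CentralProductModel

section Classification

theorem DihedralFamily.mul_self_of_fin_zero {X : Type*} [Group X] {d e v : Fin 0 → X}
    (F : DihedralFamily d e v) (x : X) : x * x = 1 :=
  F.center_sq x (F.gen (Subgroup.center X) le_rfl (fun i => i.elim0) ▸ Subgroup.mem_top x)

theorem exists_equiv_cpow_two_prod_model {X : Type*} [Group X] [Finite X] (hX : 3 / 4 < alpha X) :
    (∀ x : X, x * x = 1) ∨
      (∃ m n, 1 ≤ n ∧ Nonempty (X ≃* CPow 2 m × InvSemidirect (CPow 3 n))) ∨
      (∃ m n, 1 ≤ n ∧ Nonempty (X ≃* CPow 2 m × InvSemidirect (CPow 4 n))) ∨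
      (∃ m, Nonempty (X ≃* CPow 2 m × (D8 × D8))) ∨
      (∃ m r, 1 ≤ r ∧ Nonempty (X ≃* CPow 2 m × CentralProductD8 r)) ∨
      ∃ m r, 1 ≤ r ∧ Nonempty (X ≃* CPow 2 m × ShearSemidirect r) := by
  rcases exists_abelian_or_family X (card_lt_two_mul_numInvol hX) with
    ⟨A, hA, hcard⟩ | ⟨v, r, d, e, F⟩ | ⟨d, e, v, F, hv⟩
  · rcases exists_equiv_of_comm_subgroup hA hcard hX with hsq | hthree | hfour | hshear
    · exact .inl hsq
    · exact .inr (.inl hthree)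
    · exact .inr (.inr (.inl hfour))
    · exact .inr (.inr (.inr (.inr (.inr hshear))))
  · rcases r with - | r
    · exact .inl F.mul_self_of_fin_zero
    · obtain ⟨m, e⟩ := F.exists_equiv_centralProduct 0
      exact .inr (.inr (.inr (.inr (.inl ⟨m, r + 1, r.succ_pos, e⟩))))
  · exact .inr (.inr (.inr (.inl (F.exists_equiv_prod hv))))

-- `ULift` moves the model `M : Type` into the universe of `X`.
theorem exists_factor_of_equiv {X : Type u} {M : Type} [Group X] [Finite X] [Group M] {m : ℕ}
    {q : ℚ} (e : X ≃* CPow 2 m × M) (hM : ¬ HasC2Factor M) (hq : alpha M = q) :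
    ∃ (G : Type u) (_ : Group G), Nonempty (X ≃* CPow 2 m × G) ∧ alpha X = alpha G ∧
      ¬ HasC2Factor G ∧ Nonempty (G ≃* M) ∧ alpha G = q := by
  have : Finite (CPow 2 m × M) := Finite.of_equiv X e.toEquiv
  have : Finite M := Finite.of_surjective (Prod.snd : CPow 2 m × M → M) Prod.snd_surjective
  have hα : alpha (ULift.{u} M) = alpha M := alpha_congr MulEquiv.ulift
  refine ⟨ULift.{u} M, inferInstance,
    ⟨e.trans (MulEquiv.prodCongr (MulEquiv.refl _) MulEquiv.ulift.symm)⟩, ?_,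
    fun h => hM (h.map MulEquiv.ulift), ⟨MulEquiv.ulift⟩, hα.trans hq⟩
  rw [hα, alpha_congr e, alpha_prod_of_mul_self cpow_two_mul_self]

theorem not_hasC2Factor_of_subsingleton {G : Type*} [Group G] [Subsingleton G] :
    ¬ HasC2Factor G :=
  not_hasC2Factor fun z _ _ => Subsingleton.elim 1 z ▸ one_mem _

end Classification

end CyclicRatio

theorem mainTheorem2 {X : Type u} [Group X] [Finite X] (hX : 3 / 4 < CyclicRatio.alpha X) :
    ∃ (m : ℕ) (G : Type u) (_ : Group G),
      Nonempty (X ≃* CyclicRatio.CPow 2 m × G) ∧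
      CyclicRatio.alpha X = CyclicRatio.alpha G ∧
      ¬ CyclicRatio.HasC2Factor G ∧
      ((Subsingleton G ∧ CyclicRatio.alpha X = 1) ∨
        (∃ n : ℕ, 1 ≤ n ∧
          ((Nonempty (G ≃* CyclicRatio.InvSemidirect (CyclicRatio.CPow 3 n)) ∧
              CyclicRatio.alpha G = (3 * 3 ^ n + 1) / (4 * 3 ^ n)) ∨
            (Nonempty (G ≃* CyclicRatio.InvSemidirect (CyclicRatio.CPow 4 n)) ∧
              CyclicRatio.alpha G = (3 * 2 ^ n + 1) / (4 * 2 ^ n)))) ∨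
        (Nonempty (G ≃* CyclicRatio.D8 × CyclicRatio.D8) ∧
          CyclicRatio.alpha G = 25 / 32) ∨
        (∃ r : ℕ, 1 ≤ r ∧ Nonempty (G ≃* CyclicRatio.CentralProductD8 r) ∧
          CyclicRatio.alpha G = (3 * 2 ^ r + 1) / (4 * 2 ^ r)) ∨
        (∃ r : ℕ, 1 ≤ r ∧ Nonempty (G ≃* CyclicRatio.ShearSemidirect r) ∧
          CyclicRatio.alpha G = (3 * 2 ^ r + 1) / (4 * 2 ^ r))) := by
  open CyclicRatio in
  rcases exists_equiv_cpow_two_prod_model hX with hsq | ⟨m, n, hn, ⟨e⟩⟩ | ⟨m, n, hn, ⟨e⟩⟩ |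
    ⟨m, ⟨e⟩⟩ | ⟨m, r, hr, ⟨e⟩⟩ | ⟨m, r, hr, ⟨e⟩⟩
  · obtain ⟨m, ⟨e⟩⟩ := exists_equiv_cpow_two hsq
    obtain ⟨G, _, hXG, hα, hG, ⟨f⟩, -⟩ := exists_factor_of_equiv
      (e.trans (MulEquiv.prodUnique (N := Unit)).symm) not_hasC2Factor_of_subsingleton rfl
    exact ⟨m, G, _, hXG, hα, hG, .inl ⟨f.toEquiv.subsingleton, alpha_eq_one_of_mul_self hsq⟩⟩
  · obtain ⟨G, _, hXG, hα, hG, hmodel⟩ := exists_factor_of_equiv e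
      (not_hasC2Factor_invSemidirect_cpow_three hn) (alpha_invSemidirect_cpow_three n)
    exact ⟨m, G, _, hXG, hα, hG, .inr (.inl ⟨n, hn, .inl hmodel⟩)⟩
  · obtain ⟨G, _, hXG, hα, hG, hmodel⟩ := exists_factor_of_equiv e
      (not_hasC2Factor_invSemidirect_cpow_four hn) (alpha_invSemidirect_cpow_four n)
    exact ⟨m, G, _, hXG, hα, hG, .inr (.inl ⟨n, hn, .inr hmodel⟩)⟩
  · obtain ⟨G, _, hXG, hα, hG, hmodel⟩ := exists_factor_of_equiv e
      not_hasC2Factor_D8_prod_D8 alpha_D8_prod_D8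
    exact ⟨m, G, _, hXG, hα, hG, .inr (.inr (.inl hmodel))⟩
  · obtain ⟨G, _, hXG, hα, hG, hmodel⟩ := exists_factor_of_equiv e
      (not_hasC2Factor_centralProductD8 hr) (alpha_centralProductD8 r)
    exact ⟨m, G, _, hXG, hα, hG, .inr (.inr (.inr (.inl ⟨r, hr, hmodel⟩)))⟩
  · obtain ⟨G, _, hXG, hα, hG, hmodel⟩ := exists_factor_of_equiv e
      (not_hasC2Factor_shearSemidirect hr) (alpha_shearSemidirect r)
    exact ⟨m, G, _, hXG, hα, hG, .inr (.inr (.inr (.inr ⟨r, hr, hmodel⟩)))⟩
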